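/- Let $d\ge 1$ and let $(X_y)_{y\in\mathbb Z^d}$ be a stationary collection of real random variables with mean zero, finite variance and with densities, satisfying the FKG inequalities: for every finite subcollection, $\mathrm{Cov}(F,G)\ge 0$ for all coordinatewise increasing functions $F,G$ of it (whenever $F$, $G$ are measurable and square integrable). For $u\in\mathbb Z_{>0}^d$ put $B_u=\{y\in\mathbb Z^d: 1\le y_i\le u_i \text{ for all } i\}$ and $|u|=|B_u|=\prod_i u_i$. For each $\tau\ge 0$ let $(Z^{(\tau)}_y)_{y\in\mathbb Z^d}$ be $N(0,\tau)$ variables, independent of $(X_y)$ and of each other, and let $$V_u^{(\tau)}=\frac1{\sqrt{|u|}}\sum_{y\in B_u}\bigl(X_y+Z^{(\tau)}_y\bigr).$$ For a random variable $U$ with variance $\sigma^2$ and continuously differentiable density $f$ let $J_{\rm st}(U)=\sigma^2\,\mathbb E\bigl[(f'(U)/f(U))^2\bigr]-1$, and let $\kappa(n,\tau)=\sup_{|u|\ge n}J_{\rm st}(V_u^{(\tau)})$ for $\tau>0$. Assume 1. (finite susceptibility) $\sum_{y\in\mathbb Z^d}\mathrm{Cov}(X_0,X_y)<\infty$; 2.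 for some $n$, $\int_0^\infty \frac{\kappa(n,\tau)}{1+\tau}\,d\tau<\infty$. Let $\tau\ge 0$. Let $g_u$ be the density of $V_u^{(\tau)}$, let $\sigma_u^2=\mathrm{Var}(V_u^{(\tau)})$, let $\varphi_{\sigma_u^2}$ be the density of $N(0,\sigma_u^2)$, and let $D$ be relative entropy (with value $\infty$ if $V_u^{(\tau)}$ has no density, which can only occur for $\tau=0$). Then $$D(g_u\,\|\,\varphi_{\sigma_u^2})\to 0\quad\text{as } |u|\to\infty$$ (equivalently, the relative entropy of $V_u^{(\tau)}/\sigma_u$ from the standard normal tends to $0$) if and only if uniform integrability holds: there is a function $\psi$ with $\psi(R)\to0$ as $R\to\infty$ such that, for all $u$ and all $R$, $$\mathbb E\bigl[(V_u^{(\tau)})^2\,\mathbf 1(|V_u^{(\tau)}|\ge R\sigma_u)\bigr]\le \sigma_u^2\,\psi(R).$$ -/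

import Mathlib

open MeasureTheory ProbabilityTheory Filter Topology
open scoped NNReal ENNReal

noncomputable section

namespace FKGEntropy

variable {Ω : Type*} [MeasurableSpace Ω]

/-- The collection `X` satisfies the FKG inequalities: for every finite subcollection, any two
coordinatewise increasing (Borel) functions of it have nonnegative covariance, whenever they are
square integrable (so that the covariance exists). -/
def IsFKG {ι : Type*} (X : ι → Ω → ℝ) (P : Measure Ω) : Prop :=
  ∀ (s : Finset ι) (F G : (s → ℝ) → ℝ),
    Monotone F → Monotone G → Measurable F → Measurable G →
    MemLp (fun ω => F (fun i => X i ω)) 2 P →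
    MemLp (fun ω => G (fun i => X i ω)) 2 P →
    0 ≤ cov[fun ω => F (fun i => X i ω), fun ω => G (fun i => X i ω); P]

/-- Stationarity of a field on `ℤ^d`: all translates have the same joint law. -/
def IsStationary {d : ℕ} (X : (Fin d → ℤ) → Ω → ℝ) (P : Measure Ω) : Prop :=
  ∀ h : Fin d → ℤ,
    P.map (fun ω (y : Fin d → ℤ) => X (y + h) ω) = P.map (fun ω (y : Fin d → ℤ) => X y ω)

/-- The box `B_u = {y ∈ ℤ^d : 1 ≤ y_i ≤ u_i for all i}`, for a vector `u` of positive integers. -/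
def box {d : ℕ} (u : Fin d → ℕ+) : Finset (Fin d → ℤ) :=
  Finset.Icc (fun _ => 1) (fun i => ((u i : ℕ) : ℤ))

/-- The volume `|u| = ∏ i, u_i`. -/
def boxVol {d : ℕ} (u : Fin d → ℕ+) : ℕ := ∏ i, (u i : ℕ)

theorem card_box {d : ℕ} (u : Fin d → ℕ+) : (box u).card = boxVol u := by
  simp [box, boxVol, Pi.card_Icc]

/-- `(∑_{y ∈ B_u} Y_y) / √|u|`. -/
def normSum {d : ℕ} (Y : (Fin d → ℤ) → Ω → ℝ) (u : Fin d → ℕ+) (ω : Ω) : ℝ :=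
  (∑ y ∈ box u, Y y ω) / √(boxVol u : ℝ)

/-- For every `τ ≥ 0`, the variables `Z τ y` (`y ∈ ℤ^d`) are `N(0, τ)`, independent of each other
and (jointly) independent of the field `X`. -/
structure IsGaussianPerturbation {d : ℕ} (X : (Fin d → ℤ) → Ω → ℝ)
    (Z : ℝ≥0 → (Fin d → ℤ) → Ω → ℝ) (P : Measure Ω) : Prop where
  measurable : ∀ τ y, Measurable (Z τ y)
  law : ∀ τ y, P.map (Z τ y) = gaussianReal 0 τ
  iIndep : ∀ τ, iIndepFun (Z τ) P
  indep : ∀ τ, IndepFun (fun ω (y : Fin d → ℤ) => Z τ y ω) (fun ω (y : Fin d → ℤ) => X y ω) P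

/-- `V_u^{(τ)}`: the normalized box sum of the perturbed field `Y^{(τ)} = X + Z^{(τ)}`. -/
def V {d : ℕ} (X : (Fin d → ℤ) → Ω → ℝ) (Z : ℝ≥0 → (Fin d → ℤ) → Ω → ℝ)
    (τ : ℝ≥0) (u : Fin d → ℕ+) : Ω → ℝ :=
  normSum (fun y ω => X y ω + Z τ y ω) u

/-- `f` is a continuously differentiable probability density of the law `μ`. Such an `f` is
unique if it exists. -/
def IsC1Density (f : ℝ → ℝ) (μ : Measure ℝ) : Prop :=
  ContDiff ℝ 1 f ∧ (∀ x, 0 ≤ f x) ∧ μ = volume.withDensity (fun x => ENNReal.ofReal (f x))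

/-- Fisher information `∫ ρ² dμ`, with score `ρ = f' / f`, where `f` is the continuously
differentiable density of `μ`. The infimum runs over at most one `f`, and the
value is `∞` if there is no such density. -/
def fisherInfo (μ : Measure ℝ) : ℝ≥0∞ :=
  ⨅ (f : ℝ → ℝ) (_ : IsC1Density f μ), ∫⁻ x, ENNReal.ofReal ((deriv f x / f x) ^ 2) ∂μ

/-- Standardised Fisher information `σ² J - 1` of a random variable. For a variable of finite
nonzero variance `σ²` with a continuously differentiable density, `σ² J ≥ 1`, so that the
subtraction does not truncate. -/
def stdFisherInfo (U : Ω → ℝ) (P : Measure Ω) : ℝ≥0∞ :=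
  ENNReal.ofReal Var[U; P] * fisherInfo (P.map U) - 1

/-- `κ(n, τ) = sup_{|u| ≥ n} J_st(V_u^{(τ)})`. -/
def kappa {d : ℕ} (X : (Fin d → ℤ) → Ω → ℝ) (Z : ℝ≥0 → (Fin d → ℤ) → Ω → ℝ) (P : Measure Ω)
    (n : ℕ) (τ : ℝ≥0) : ℝ≥0∞ :=
  ⨆ (u : Fin d → ℕ+) (_ : n ≤ boxVol u), stdFisherInfo (V X Z τ u) P

/-- The class `C_ψ`: square integrable variables `U` of variance `σ²` such that
`E U² 1(|U| ≥ R σ) ≤ σ² ψ(R)` for all `R`. -/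
def InClass (ψ : ℝ → ℝ) (U : Ω → ℝ) (P : Measure Ω) : Prop :=
  MemLp U 2 P ∧
    ∀ R : ℝ, ∫ ω in {ω | R * √(Var[U; P]) ≤ |U ω|}, U ω ^ 2 ∂P ≤ Var[U; P] * ψ R

/-- Uniform integrability: there is one `ψ`, vanishing at infinity, such that
`V_u^{(τ)} ∈ C_ψ` for all `u`. -/
def UniformIntegrability {d : ℕ} (X : (Fin d → ℤ) → Ω → ℝ)
    (Z : ℝ≥0 → (Fin d → ℤ) → Ω → ℝ) (P : Measure Ω) (τ : ℝ≥0) : Prop :=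
  ∃ ψ : ℝ → ℝ, Tendsto ψ atTop (𝓝 0) ∧ ∀ u, InClass ψ (V X Z τ u) P

/-- `D(g ‖ φ)`, where `g` is the law (density) of `U` and `φ` the centred normal law with the same
variance as `U`. -/
def relEntropy (U : Ω → ℝ) (P : Measure Ω) : ℝ≥0∞ :=
  InformationTheory.klDiv (P.map U) (gaussianReal 0 Var[U; P].toNNReal)

end FKGEntropy

end

/-!
For the direction from entropy to uniform integrability, the variational formula
`∫ h dμ ≤ D(μ‖γ) + ∫ (eʰ - 1) dγ` is applied to the truncated quadratic `h = x²/4 · 1(|x| ≥ R)`,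
for which the last integral is finite and tends to zero as `R → ∞`.

Conversely, cut a box into slabs along its longest side. By Newman's inequality for associated
variables, the characteristic function of the normalised sum differs from the product of those of
its slabs by at most the covariances between slabs, which finite susceptibility makes negligible.
Uniform integrability is Lindeberg's condition for the slabs, so `V_u` is asymptotically normal.
Adding an independent `N(0, t)` upgrades weak convergence to convergence of the Fisher information,
so the excess Fisher information tends to zero for every `t > 0`; it is dominated by a multiple of
`κ(n, t) / (1 + t)`. De Bruijn's identity writes the relative entropy as the integral over `t` of
half the excess, up to the limit `t → 0`, where lower semicontinuity of the relative entropy, again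
from the variational formula, suffices.
-/

noncomputable section

namespace FKGEntropy

/-! ### Heat kernel and heat flow -/

section HeatKernel

/-- The heat kernel, i.e. the density of `N(0, t)`, with `t` real so that it can be differentiated
in time. -/
def heatKernel (t x : ℝ) : ℝ := (√(2 * Real.pi * t))⁻¹ * Real.exp (-x ^ 2 / (2 * t))

/-- The first space derivative of the heat kernel. -/
def heatKernelDeriv (t x : ℝ) : ℝ := -(x / t) * heatKernel t x

/-- The second space derivative of the heat kernel. -/
def heatKernelDeriv₂ (t x : ℝ) : ℝ := (x ^ 2 / t ^ 2 - 1 / t) * heatKernel t x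

variable {t a b : ℝ}

lemma heatKernel_pos (ht : 0 < t) (x : ℝ) : 0 < heatKernel t x := by
  unfold heatKernel; positivity

lemma heatKernel_nonneg (t x : ℝ) : 0 ≤ heatKernel t x := by
  unfold heatKernel; positivity

lemma gaussianPDFReal_zero_eq_heatKernel (t : ℝ≥0) : gaussianPDFReal 0 t = heatKernel t := by
  ext x; simp [heatKernel, gaussianPDFReal]

lemma measurable_uncurry_heatKernel : Measurable (Function.uncurry heatKernel) := by
  unfold heatKernel; fun_prop

lemma measurable_uncurry_heatKernelDeriv : Measurable (Function.uncurry heatKernelDeriv) := by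
  unfold heatKernelDeriv heatKernel; fun_prop

lemma measurable_uncurry_heatKernelDeriv₂ : Measurable (Function.uncurry heatKernelDeriv₂) := by
  unfold heatKernelDeriv₂ heatKernel; fun_prop

lemma continuous_heatKernel (t : ℝ) : Continuous (heatKernel t) := by
  unfold heatKernel; fun_prop

lemma continuous_heatKernelDeriv (t : ℝ) : Continuous (heatKernelDeriv t) := by
  unfold heatKernelDeriv heatKernel; fun_prop

lemma continuous_heatKernelDeriv₂ (t : ℝ) : Continuous (heatKernelDeriv₂ t) := by
  unfold heatKernelDeriv₂ heatKernel; fun_prop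

lemma hasDerivAt_heatKernel (t x : ℝ) : HasDerivAt (heatKernel t) (heatKernelDeriv t x) x := by
  have h : HasDerivAt (fun x : ℝ => -x ^ 2 / (2 * t)) (-(2 * x) / (2 * t)) x := by
    simpa using (hasDerivAt_pow 2 x).neg.div_const (2 * t)
  refine (h.exp.const_mul (√(2 * Real.pi * t))⁻¹).congr_deriv ?_
  have hlog : -(2 * x) / (2 * t) = -(x / t) := by rw [neg_div, mul_div_mul_left _ _ two_ne_zero]
  rw [hlog, heatKernelDeriv, heatKernel]
  ring

lemma hasDerivAt_heatKernelDeriv (t x : ℝ) :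
    HasDerivAt (heatKernelDeriv t) (heatKernelDeriv₂ t x) x := by
  refine (((hasDerivAt_id x).div_const t).neg.mul (hasDerivAt_heatKernel t x)).congr_deriv ?_
  simp only [heatKernelDeriv₂, heatKernelDeriv, Pi.neg_apply, id_eq]
  ring

lemma hasDerivAt_heatKernel_time (ht : 0 < t) (x : ℝ) :
    HasDerivAt (fun t => heatKernel t x) (heatKernelDeriv₂ t x / 2) t := by
  have hpos : 0 < 2 * Real.pi * t := by positivity
  have hsqrt : HasDerivAt (fun t : ℝ => 2 * Real.pi * t) (2 * Real.pi) t := by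
    simpa using (hasDerivAt_id t).const_mul (2 * Real.pi)
  have hexponent : HasDerivAt (fun t : ℝ => -x ^ 2 / (2 * t)) (x ^ 2 / (2 * t ^ 2)) t := by
    have h2t : HasDerivAt (fun t : ℝ => 2 * t) 2 t := by
      simpa using (hasDerivAt_id t).const_mul (2 : ℝ)
    refine ((hasDerivAt_const t (-x ^ 2)).div h2t (by positivity)).congr_deriv ?_
    field_simp
    ring
  refine (((hsqrt.sqrt hpos.ne').inv (Real.sqrt_pos.2 hpos).ne').mul
    hexponent.exp).congr_deriv ?_
  simp only [heatKernelDeriv₂, heatKernel, Pi.inv_apply, Real.sq_sqrt hpos.le]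
  field_simp
  ring

lemma heatKernel_le (t x : ℝ) : heatKernel t x ≤ (√(2 * Real.pi * t))⁻¹ := by
  rcases le_or_gt t 0 with ht | ht
  · simp [heatKernel, Real.sqrt_eq_zero_of_nonpos (mul_nonpos_of_nonneg_of_nonpos
      (by positivity : 0 ≤ 2 * Real.pi) ht)]
  · refine mul_le_of_le_one_right (by positivity) ?_
    rw [Real.exp_le_one_iff, neg_div, neg_nonpos]
    positivity

lemma heatKernel_le_of_mem_Icc (ha : 0 < a) (ht : t ∈ Set.Icc a b) (x : ℝ) :
    heatKernel t x ≤ (√(2 * Real.pi * a))⁻¹ * Real.exp (-x ^ 2 / (2 * b)) := by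
  have ht0 : 0 < t := ha.trans_le ht.1
  have hta := ht.1
  have hexp : -x ^ 2 / (2 * t) ≤ -x ^ 2 / (2 * b) := by
    rw [neg_div, neg_div, neg_le_neg_iff]
    gcongr
    exact ht.2
  unfold heatKernel
  gcongr

lemma exists_one_add_sq_mul_heatKernel_le (ha : 0 < a) (hab : a ≤ b) :
    ∃ C : ℝ, 0 < C ∧ ∀ t ∈ Set.Icc a b, ∀ x,
      (1 + x ^ 2) * heatKernel t x ≤ C * heatKernel (2 * b) x := by
  have hb : 0 < b := ha.trans_le hab
  refine ⟨(1 + 4 * b) * (√(2 * Real.pi * a))⁻¹ * √(2 * Real.pi * (2 * b)), by positivity,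
    fun t ht x => ?_⟩
  have hpoly : 1 + x ^ 2 ≤ (1 + 4 * b) * Real.exp (x ^ 2 / (4 * b)) := by
    calc 1 + x ^ 2 ≤ (1 + 4 * b) * (x ^ 2 / (4 * b) + 1) := by
          have : 0 ≤ x ^ 2 / (4 * b) := by positivity
          have hx : x ^ 2 = 4 * b * (x ^ 2 / (4 * b)) := by field_simp
          linarith
      _ ≤ _ := by gcongr; exact Real.add_one_le_exp _
  have hexp : Real.exp (x ^ 2 / (4 * b)) * Real.exp (-x ^ 2 / (2 * b)) =
      Real.exp (-x ^ 2 / (2 * (2 * b))) := by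
    rw [← Real.exp_add]
    congr 1
    field_simp
    ring
  calc (1 + x ^ 2) * heatKernel t x
      ≤ ((1 + 4 * b) * Real.exp (x ^ 2 / (4 * b))) *
          ((√(2 * Real.pi * a))⁻¹ * Real.exp (-x ^ 2 / (2 * b))) := by
        gcongr
        · exact heatKernel_nonneg t x
        · exact heatKernel_le_of_mem_Icc ha ht x
    _ = (1 + 4 * b) * (√(2 * Real.pi * a))⁻¹ *
          (Real.exp (x ^ 2 / (4 * b)) * Real.exp (-x ^ 2 / (2 * b))) := by ring
    _ = _ := by rw [hexp, heatKernel]; field_simp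

lemma abs_heatKernelDeriv_le (ht : 0 < t) (x : ℝ) :
    |heatKernelDeriv t x| ≤ t⁻¹ * ((1 + x ^ 2) * heatKernel t x) := by
  have hx : |x| ≤ 1 + x ^ 2 := by nlinarith [sq_abs x, sq_nonneg (|x| - 1)]
  rw [heatKernelDeriv, abs_mul, abs_neg, abs_div, abs_of_pos ht,
    abs_of_nonneg (heatKernel_nonneg t x), div_eq_inv_mul, mul_assoc]
  gcongr
  exact heatKernel_nonneg t x

lemma abs_heatKernelDeriv₂_le (ht : 0 < t) (x : ℝ) :
    |heatKernelDeriv₂ t x| ≤ (t⁻¹ ^ 2 + t⁻¹) * ((1 + x ^ 2) * heatKernel t x) := by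
  have hx : |x ^ 2 / t ^ 2 - 1 / t| ≤ (t⁻¹ ^ 2 + t⁻¹) * (1 + x ^ 2) := by
    calc |x ^ 2 / t ^ 2 - 1 / t| ≤ |x ^ 2 / t ^ 2| + |1 / t| := abs_sub _ _
      _ = t⁻¹ ^ 2 * x ^ 2 + t⁻¹ := by
        rw [abs_of_nonneg (by positivity), abs_of_nonneg (by positivity)]
        ring
      _ ≤ t⁻¹ ^ 2 * x ^ 2 + t⁻¹ + (t⁻¹ ^ 2 + t⁻¹ * x ^ 2) :=
        le_add_of_nonneg_right (by positivity)
      _ = _ := by ring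
  rw [heatKernelDeriv₂, abs_mul, abs_of_nonneg (heatKernel_nonneg t x), ← mul_assoc]
  gcongr
  exact heatKernel_nonneg t x

lemma exists_heatKernel_bound (ha : 0 < a) (hab : a ≤ b) :
    ∃ C : ℝ, 0 < C ∧ ∀ t ∈ Set.Icc a b, ∀ x, heatKernel t x ≤ C * heatKernel (2 * b) x ∧
      |heatKernelDeriv t x| ≤ C * heatKernel (2 * b) x ∧
      |heatKernelDeriv₂ t x| ≤ C * heatKernel (2 * b) x := by
  obtain ⟨C, hC, h⟩ := exists_one_add_sq_mul_heatKernel_le ha hab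
  refine ⟨(1 + a⁻¹ + (a⁻¹ ^ 2 + a⁻¹)) * C, by positivity, fun t ht x => ?_⟩
  have ht0 : 0 < t := ha.trans_le ht.1
  have hinv : t⁻¹ ≤ a⁻¹ := inv_anti₀ ha ht.1
  have hg := heatKernel_nonneg t x
  have of_le : ∀ {y q : ℝ}, y ≤ q * ((1 + x ^ 2) * heatKernel t x) →
      q ≤ 1 + a⁻¹ + (a⁻¹ ^ 2 + a⁻¹) →
      y ≤ (1 + a⁻¹ + (a⁻¹ ^ 2 + a⁻¹)) * C * heatKernel (2 * b) x := fun {y q} hy hq =>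
    calc y ≤ q * ((1 + x ^ 2) * heatKernel t x) := hy
      _ ≤ (1 + a⁻¹ + (a⁻¹ ^ 2 + a⁻¹)) * (C * heatKernel (2 * b) x) :=
        mul_le_mul hq (h t ht x) (by positivity) (by positivity)
      _ = _ := (mul_assoc _ _ _).symm
  have hinv_pos : 0 < a⁻¹ := inv_pos.2 ha
  refine ⟨of_le (q := 1) ?_ ?_, of_le (abs_heatKernelDeriv_le ht0 x) ?_,
    of_le (abs_heatKernelDeriv₂_le ht0 x) ?_⟩
  · nlinarith [mul_nonneg (sq_nonneg x) hg]
  · nlinarith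
  · nlinarith
  · have : t⁻¹ ^ 2 ≤ a⁻¹ ^ 2 := by gcongr
    linarith

lemma exists_heatKernel_bound_const (ha : 0 < a) (hab : a ≤ b) :
    ∃ C : ℝ, ∀ t ∈ Set.Icc a b, ∀ x, |heatKernel t x| ≤ C ∧ |heatKernelDeriv t x| ≤ C ∧
      |heatKernelDeriv₂ t x| ≤ C := by
  obtain ⟨C, hC, h⟩ := exists_heatKernel_bound ha hab
  refine ⟨C * (√(2 * Real.pi * (2 * b)))⁻¹, fun t ht x => ?_⟩
  obtain ⟨h₀, h₁, h₂⟩ := h t ht x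
  have hC' := mul_le_mul_of_nonneg_left (heatKernel_le (2 * b) x) hC.le
  rw [abs_of_nonneg (heatKernel_nonneg t x)]
  exact ⟨h₀.trans hC', h₁.trans hC', h₂.trans hC'⟩

end HeatKernel

section Smoothing

/-- The convolution `k ∗ μ` of a function with a measure. -/
def smoothing (k : ℝ → ℝ) (μ : Measure ℝ) (x : ℝ) : ℝ := ∫ y, k (x - y) ∂μ

lemma measurable_smoothing {K : ℝ → ℝ → ℝ} (hK : Measurable (Function.uncurry K))
    (μ : Measure ℝ) [SFinite μ] :
    Measurable (Function.uncurry fun t => smoothing (K t) μ) := by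
  have h : Measurable fun q : (ℝ × ℝ) × ℝ => K q.1.1 (q.1.2 - q.2) :=
    hK.comp (f := fun q : (ℝ × ℝ) × ℝ => (q.1.1, q.1.2 - q.2)) (by fun_prop)
  exact (h.stronglyMeasurable.integral_prod_right
    (f := fun (p : ℝ × ℝ) (y : ℝ) => K p.1 (p.2 - y))).measurable

lemma withDensity_conv {G : Type*} [AddCommGroup G] [MeasurableSpace G] [MeasurableAdd₂ G]
    [MeasurableNeg G] (μ π : Measure G) [SFinite μ] [SFinite π] [π.IsAddLeftInvariant]
    {f : G → ℝ≥0∞} (hf : Measurable f) [SFinite (π.withDensity f)] :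
    μ ∗ π.withDensity f = π.withDensity fun x => ∫⁻ y, f (x - y) ∂μ := by
  ext s hs
  have hs' : Measurable (s.indicator (1 : G → ℝ≥0∞)) := measurable_one.indicator hs
  have htranslate (y : G) : ∫⁻ z, s.indicator 1 (y + z) ∂π.withDensity f =
      ∫⁻ x, s.indicator 1 x * f (x - y) ∂π := by
    rw [lintegral_withDensity_eq_lintegral_mul _ hf (by fun_prop),
      ← lintegral_add_left_eq_self (fun x => s.indicator 1 x * f (x - y)) y]
    simp [mul_comm]
  rw [← lintegral_indicator_one hs, Measure.lintegral_conv hs']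
  simp_rw [htranslate]
  rw [lintegral_lintegral_swap (by fun_prop), withDensity_apply _ hs, ← lintegral_indicator hs]
  refine lintegral_congr fun x => ?_
  rw [lintegral_const_mul _ (by fun_prop)]
  by_cases hx : x ∈ s <;> simp [hx]

variable (μ : Measure ℝ) [IsFiniteMeasure μ] {k k' : ℝ → ℝ} {C : ℝ}

lemma integrable_comp_sub (hk : Continuous k) (hC : ∀ x, |k x| ≤ C) (x : ℝ) :
    Integrable (fun y => k (x - y)) μ :=
  .of_bound (hk.comp (by fun_prop)).aestronglyMeasurable C (.of_forall fun _ => hC _)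

lemma hasDerivAt_smoothing (hk : ∀ x, HasDerivAt k (k' x) x) (hk' : Continuous k')
    (hC : ∀ x, |k x| ≤ C) {C' : ℝ} (hC' : ∀ x, |k' x| ≤ C') (x : ℝ) :
    HasDerivAt (smoothing k μ) (smoothing k' μ x) x := by
  have hkc : Continuous k := continuous_iff_continuousAt.2 fun x => (hk x).continuousAt
  exact (hasDerivAt_integral_of_dominated_loc_of_deriv_le (bound := fun _ => C')
    (F := fun x y => k (x - y)) (F' := fun x y => k' (x - y)) univ_mem
    (.of_forall fun x => (hkc.comp (by fun_prop)).aestronglyMeasurable)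
    (integrable_comp_sub μ hkc hC x) (hk'.comp (by fun_prop)).aestronglyMeasurable
    (.of_forall fun _ _ _ => hC' _) (integrable_const _)
    (.of_forall fun y z _ => (hk (z - y)).comp_sub_const z y)).2

end Smoothing

section HeatFlow

/-- The heat flow started at `μ`: the density of `μ ∗ N(0, t)`. -/
def heatFlow (μ : Measure ℝ) (t : ℝ) : ℝ → ℝ := smoothing (heatKernel t) μ

/-- The first space derivative of the heat flow. -/
def heatFlowDeriv (μ : Measure ℝ) (t : ℝ) : ℝ → ℝ := smoothing (heatKernelDeriv t) μ

/-- The second space derivative of the heat flow. -/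
def heatFlowDeriv₂ (μ : Measure ℝ) (t : ℝ) : ℝ → ℝ := smoothing (heatKernelDeriv₂ t) μ

variable (μ : Measure ℝ) {t a b : ℝ}

lemma heatFlow_nonneg (t x : ℝ) : 0 ≤ heatFlow μ t x :=
  integral_nonneg fun _ => heatKernel_nonneg _ _

lemma measurable_uncurry_heatFlow [SFinite μ] :
    Measurable (Function.uncurry (heatFlow μ)) :=
  measurable_smoothing measurable_uncurry_heatKernel μ

lemma measurable_uncurry_heatFlowDeriv [SFinite μ] :
    Measurable (Function.uncurry (heatFlowDeriv μ)) :=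
  measurable_smoothing measurable_uncurry_heatKernelDeriv μ

lemma measurable_uncurry_heatFlowDeriv₂ [SFinite μ] :
    Measurable (Function.uncurry (heatFlowDeriv₂ μ)) :=
  measurable_smoothing measurable_uncurry_heatKernelDeriv₂ μ

variable [IsFiniteMeasure μ]

lemma integrable_heatKernel (ht : 0 < t) (x : ℝ) :
    Integrable (fun y => heatKernel t (x - y)) μ := by
  obtain ⟨C, h⟩ := exists_heatKernel_bound_const ht le_rfl
  exact integrable_comp_sub μ (continuous_heatKernel t) (fun x => (h t ⟨le_rfl, le_rfl⟩ x).1) x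

lemma integrable_heatKernelDeriv (ht : 0 < t) (x : ℝ) :
    Integrable (fun y => heatKernelDeriv t (x - y)) μ := by
  obtain ⟨C, h⟩ := exists_heatKernel_bound_const ht le_rfl
  exact integrable_comp_sub μ (continuous_heatKernelDeriv t)
    (fun x => (h t ⟨le_rfl, le_rfl⟩ x).2.1) x

lemma integrable_heatKernelDeriv₂ (ht : 0 < t) (x : ℝ) :
    Integrable (fun y => heatKernelDeriv₂ t (x - y)) μ := by
  obtain ⟨C, h⟩ := exists_heatKernel_bound_const ht le_rfl
  exact integrable_comp_sub μ (continuous_heatKernelDeriv₂ t)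
    (fun x => (h t ⟨le_rfl, le_rfl⟩ x).2.2) x

lemma heatFlow_pos [NeZero μ] (ht : 0 < t) (x : ℝ) : 0 < heatFlow μ t x := by
  refine (integral_pos_iff_support_of_nonneg (fun y => heatKernel_nonneg t _)
    (integrable_heatKernel μ ht x)).2 ?_
  have : Function.support (fun y => heatKernel t (x - y)) = Set.univ :=
    Set.eq_univ_of_forall fun y => (heatKernel_pos ht (x - y)).ne'
  simp [this, NeZero.ne μ]

lemma hasDerivAt_heatFlow (ht : 0 < t) (x : ℝ) :
    HasDerivAt (heatFlow μ t) (heatFlowDeriv μ t x) x := by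
  obtain ⟨C, h⟩ := exists_heatKernel_bound_const ht le_rfl
  exact hasDerivAt_smoothing μ (hasDerivAt_heatKernel t) (continuous_heatKernelDeriv t)
    (fun x => (h t ⟨le_rfl, le_rfl⟩ x).1) (fun x => (h t ⟨le_rfl, le_rfl⟩ x).2.1) x

lemma hasDerivAt_heatFlowDeriv (ht : 0 < t) (x : ℝ) :
    HasDerivAt (heatFlowDeriv μ t) (heatFlowDeriv₂ μ t x) x := by
  obtain ⟨C, h⟩ := exists_heatKernel_bound_const ht le_rfl
  exact hasDerivAt_smoothing μ (hasDerivAt_heatKernelDeriv t) (continuous_heatKernelDeriv₂ t)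
    (fun x => (h t ⟨le_rfl, le_rfl⟩ x).2.1) (fun x => (h t ⟨le_rfl, le_rfl⟩ x).2.2) x

lemma hasDerivAt_heatFlow_time (ht : 0 < t) (x : ℝ) :
    HasDerivAt (fun t => heatFlow μ t x) (heatFlowDeriv₂ μ t x / 2) t := by
  obtain ⟨C, h⟩ := exists_heatKernel_bound_const (half_pos ht) (by linarith : t / 2 ≤ 2 * t)
  have hnhds : Set.Icc (t / 2) (2 * t) ∈ 𝓝 t := Icc_mem_nhds (by linarith) (by linarith)
  have hbound (y : ℝ) (s : ℝ) (hs : s ∈ Set.Icc (t / 2) (2 * t)) :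
      ‖heatKernelDeriv₂ s (x - y) / 2‖ ≤ C := by
    rw [norm_div, Real.norm_eq_abs, Real.norm_eq_abs, abs_two]
    linarith [(h s hs (x - y)).2.2, abs_nonneg (heatKernelDeriv₂ s (x - y))]
  refine (hasDerivAt_integral_of_dominated_loc_of_deriv_le (bound := fun _ => C) (μ := μ)
    (F := fun t y => heatKernel t (x - y)) (F' := fun t y => heatKernelDeriv₂ t (x - y) / 2) hnhds
    (.of_forall fun t => ((continuous_heatKernel t).comp (by fun_prop)).aestronglyMeasurable)
    (integrable_heatKernel μ ht x)
    (((continuous_heatKernelDeriv₂ t).comp (by fun_prop)).div_const 2).aestronglyMeasurable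
    (.of_forall hbound) (integrable_const _)
    (.of_forall fun y s hs =>
      hasDerivAt_heatKernel_time (by linarith [hs.1]) (x - y))).2.congr_deriv ?_
  exact integral_div _ _

lemma exists_heatFlow_bound (ha : 0 < a) (hab : a ≤ b) :
    ∃ C : ℝ, 0 < C ∧ ∀ t ∈ Set.Icc a b, ∀ x, |heatFlowDeriv μ t x| ≤ C * heatFlow μ (2 * b) x ∧
      |heatFlowDeriv₂ μ t x| ≤ C * heatFlow μ (2 * b) x := by
  obtain ⟨C, hC, h⟩ := exists_heatKernel_bound ha hab
  refine ⟨C, hC, fun t ht x => ?_⟩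
  have hint : Integrable (fun y => C * heatKernel (2 * b) (x - y)) μ :=
    (integrable_heatKernel μ (by linarith) x).const_mul C
  rw [heatFlow, smoothing, ← integral_const_mul]
  exact ⟨norm_integral_le_of_norm_le (f := fun y => heatKernelDeriv t (x - y)) hint
      (.of_forall fun y => (h t ht _).2.1),
    norm_integral_le_of_norm_le (f := fun y => heatKernelDeriv₂ t (x - y)) hint
      (.of_forall fun y => (h t ht _).2.2)⟩

lemma conv_gaussianReal_eq_withDensity {t : ℝ≥0} (ht : t ≠ 0) :
    μ ∗ gaussianReal 0 t = volume.withDensity fun x => ENNReal.ofReal (heatFlow μ t x) := by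
  have : SFinite (volume.withDensity (gaussianPDF 0 t)) := by
    rw [← gaussianReal_of_var_ne_zero 0 ht]; infer_instance
  rw [gaussianReal_of_var_ne_zero 0 ht, withDensity_conv μ volume (measurable_gaussianPDF 0 t)]
  congr 1 with x
  rw [heatFlow, smoothing, ofReal_integral_eq_lintegral_ofReal
    (integrable_heatKernel μ (NNReal.coe_pos.2 (pos_iff_ne_zero.2 ht)) x)
    (.of_forall fun y => heatKernel_nonneg _ _)]
  simp only [gaussianPDF, gaussianPDFReal_zero_eq_heatKernel]

/-- This is Cauchy–Schwarz for the average over `y` of `(x - y) / t` with weight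
`heatKernel t (x - y)`, and it makes the Fisher information of `μ ∗ N(0, t)` at most `1 / t`. -/
lemma sq_heatFlowDeriv_div_le [NeZero μ] (ht : 0 < t) (x : ℝ) :
    heatFlowDeriv μ t x ^ 2 / heatFlow μ t x ≤ heatFlowDeriv₂ μ t x + heatFlow μ t x / t := by
  set l := heatFlowDeriv μ t x / heatFlow μ t x with hl
  have hpos := heatFlow_pos μ ht x
  have i₀ := integrable_heatKernel μ ht x
  have i₁ := integrable_heatKernelDeriv μ ht x
  have i₂ := integrable_heatKernelDeriv₂ μ ht x
  have hsquare (y : ℝ) : heatKernelDeriv₂ t (x - y) + heatKernel t (x - y) / t -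
      2 * l * heatKernelDeriv t (x - y) + l ^ 2 * heatKernel t (x - y) =
      ((x - y) / t + l) ^ 2 * heatKernel t (x - y) := by
    unfold heatKernelDeriv₂ heatKernelDeriv; ring
  have hnonneg : 0 ≤ heatFlowDeriv₂ μ t x + heatFlow μ t x / t - 2 * l * heatFlowDeriv μ t x +
      l ^ 2 * heatFlow μ t x := by
    calc 0 ≤ ∫ y, ((x - y) / t + l) ^ 2 * heatKernel t (x - y) ∂μ :=
          integral_nonneg fun y => mul_nonneg (sq_nonneg _) (heatKernel_nonneg _ _)
      _ = _ := by
          simp_rw [← hsquare]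
          rw [integral_add (by fun_prop) (by fun_prop), integral_sub (by fun_prop) (by fun_prop),
            integral_add (by fun_prop) (by fun_prop), integral_div, integral_const_mul,
            integral_const_mul]
          rfl
  have hopt : 2 * l * heatFlowDeriv μ t x - l ^ 2 * heatFlow μ t x =
      heatFlowDeriv μ t x ^ 2 / heatFlow μ t x := by
    rw [hl]; field_simp; ring
  linarith

end HeatFlow

section Moments

variable (μ : Measure ℝ) {t a b : ℝ}

lemma memLp_id_conv {ν : Measure ℝ} [IsFiniteMeasure μ] [IsFiniteMeasure ν] {p : ℝ≥0∞}
    (hμ : MemLp id p μ) (hν : MemLp id p ν) : MemLp id p (μ ∗ ν) := by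
  rw [Measure.conv]
  exact (memLp_map_measure_iff (by fun_prop) (by fun_prop)).2
    ((hμ.comp_fst ν).add (hν.comp_snd μ))

lemma integral_sq_conv {ν : Measure ℝ} [IsProbabilityMeasure μ] [IsProbabilityMeasure ν]
    (hμ : MemLp id 2 μ) (hν : MemLp id 2 ν) (hν0 : ∫ x, x ∂ν = 0) :
    ∫ x, x ^ 2 ∂(μ ∗ ν) = ∫ x, x ^ 2 ∂μ + ∫ x, x ^ 2 ∂ν := by
  have hμ2 : Integrable (fun x : ℝ => x ^ 2) μ := hμ.integrable_sq
  have hν1 : Integrable (fun y : ℝ => y) ν := hν.integrable one_le_two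
  have hν2 : Integrable (fun y : ℝ => y ^ 2) ν := hν.integrable_sq
  have hconv : Integrable (fun x : ℝ => x ^ 2) (μ ∗ ν) := (memLp_id_conv μ hμ hν).integrable_sq
  have hinner (x : ℝ) : ∫ y, (x + y) ^ 2 ∂ν = x ^ 2 + ∫ y, y ^ 2 ∂ν := by
    have hlin : Integrable (fun y : ℝ => x ^ 2 + 2 * x * y) ν :=
      (integrable_const _).add (hν1.const_mul _)
    simp_rw [add_sq]
    rw [integral_add hlin hν2, integral_add (integrable_const _) (hν1.const_mul _),
      integral_const_mul, hν0]
    simp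
  rw [integral_conv hconv]
  simp_rw [hinner]
  rw [integral_add hμ2 (integrable_const _)]
  simp

lemma integral_sq_gaussianReal (t : ℝ≥0) : ∫ x, x ^ 2 ∂gaussianReal 0 t = t := by
  have h := variance_fun_id_gaussianReal (μ := 0) (v := t)
  rw [variance_eq_integral (by fun_prop)] at h
  simpa using h

lemma integral_sq_conv_gaussianReal [IsProbabilityMeasure μ] (hμ : MemLp id 2 μ) (t : ℝ≥0) :
    ∫ x, x ^ 2 ∂(μ ∗ gaussianReal 0 t) = ∫ x, x ^ 2 ∂μ + t := by
  rw [integral_sq_conv μ hμ (memLp_id_gaussianReal' 2 (by simp)) (by simp),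
    integral_sq_gaussianReal]

lemma integrable_heatFlow_mul_iff [IsFiniteMeasure μ] (ht : 0 < t) (g : ℝ → ℝ) :
    Integrable (fun x => heatFlow μ t x * g x) ↔
      Integrable g (μ ∗ gaussianReal 0 t.toNNReal) := by
  rw [conv_gaussianReal_eq_withDensity μ (Real.toNNReal_pos.2 ht).ne', Real.coe_toNNReal _ ht.le,
    integrable_withDensity_iff_integrable_smul₀'
      (measurable_uncurry_heatFlow μ).of_uncurry_left.ennreal_ofReal.aemeasurable
      (.of_forall fun _ => ENNReal.ofReal_lt_top)]
  simp only [ENNReal.toReal_ofReal (heatFlow_nonneg μ t _), smul_eq_mul]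

lemma integral_heatFlow_mul [IsFiniteMeasure μ] (ht : 0 < t) (g : ℝ → ℝ) :
    ∫ x, heatFlow μ t x * g x = ∫ x, g x ∂(μ ∗ gaussianReal 0 t.toNNReal) := by
  rw [conv_gaussianReal_eq_withDensity μ (Real.toNNReal_pos.2 ht).ne', Real.coe_toNNReal _ ht.le,
    integral_withDensity_eq_integral_toReal_smul₀
      (measurable_uncurry_heatFlow μ).of_uncurry_left.ennreal_ofReal.aemeasurable
      (.of_forall fun _ => ENNReal.ofReal_lt_top)]
  simp only [ENNReal.toReal_ofReal (heatFlow_nonneg μ t _), smul_eq_mul]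

lemma integrable_heatFlow [IsFiniteMeasure μ] (ht : 0 < t) : Integrable (heatFlow μ t) := by
  simpa using (integrable_heatFlow_mul_iff μ ht fun _ => 1).2 (integrable_const _)

lemma integral_heatFlow [IsProbabilityMeasure μ] (ht : 0 < t) : ∫ x, heatFlow μ t x = 1 := by
  simpa using integral_heatFlow_mul μ ht fun _ => 1

lemma integrable_heatFlow_mul_one_add_sq [IsFiniteMeasure μ] (hμ : MemLp id 2 μ) (ht : 0 < t) :
    Integrable (fun x => heatFlow μ t x * (1 + x ^ 2)) :=
  (integrable_heatFlow_mul_iff μ ht _).2 <| (integrable_const _).add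
    (memLp_id_conv μ hμ (memLp_id_gaussianReal' 2 (by simp))).integrable_sq

end Moments

section LogBound

variable (μ : Measure ℝ) [IsProbabilityMeasure μ] {t a b : ℝ}

lemma exists_half_le_measureReal_Icc : ∃ K : ℝ, 1 / 2 ≤ μ.real (Set.Icc (-K) K) := by
  have h : Tendsto (fun K : ℝ => μ.real (Set.Icc (-K) K)) atTop (𝓝 1) := by
    simpa using (aecover_Icc (μ := μ) tendsto_neg_atTop_atBot tendsto_id
      ).integral_tendsto_of_countably_generated (integrable_const (1 : ℝ))
  exact (h.eventually (le_mem_nhds (by norm_num : (1 / 2 : ℝ) < 1))).exists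

lemma heatFlow_le (ht : 0 < t) (x : ℝ) : heatFlow μ t x ≤ (√(2 * Real.pi * t))⁻¹ := by
  calc heatFlow μ t x ≤ ∫ _, (√(2 * Real.pi * t))⁻¹ ∂μ :=
        integral_mono (integrable_heatKernel μ ht x) (integrable_const _) fun _ => heatKernel_le _ _
    _ = (√(2 * Real.pi * t))⁻¹ := by simp

lemma mul_exp_le_heatFlow (ht : 0 < t) (K x : ℝ) :
    μ.real (Set.Icc (-K) K) * ((√(2 * Real.pi * t))⁻¹ * Real.exp (-((x ^ 2 + K ^ 2) / t))) ≤
      heatFlow μ t x := by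
  have hkernel : ∀ y ∈ Set.Icc (-K) K,
      (√(2 * Real.pi * t))⁻¹ * Real.exp (-((x ^ 2 + K ^ 2) / t)) ≤ heatKernel t (x - y) := by
    intro y hy
    have hexp : (x - y) ^ 2 / (2 * t) ≤ (x ^ 2 + K ^ 2) / t := by
      rw [← mul_div_mul_left (x ^ 2 + K ^ 2) t two_ne_zero]
      gcongr
      nlinarith [sq_nonneg (x + y), sq_le_sq' hy.1 hy.2]
    rw [heatKernel, neg_div]
    gcongr
  calc _ = ∫ _ in Set.Icc (-K) K,
          (√(2 * Real.pi * t))⁻¹ * Real.exp (-((x ^ 2 + K ^ 2) / t)) ∂μ := by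
        rw [setIntegral_const, smul_eq_mul]
    _ ≤ ∫ y in Set.Icc (-K) K, heatKernel t (x - y) ∂μ :=
        setIntegral_mono_on (integrable_const _) (integrable_heatKernel μ ht x).integrableOn
          measurableSet_Icc hkernel
    _ ≤ heatFlow μ t x := setIntegral_le_integral (integrable_heatKernel μ ht x)
        (.of_forall fun _ => heatKernel_nonneg _ _)

lemma abs_log_heatFlow_le {K : ℝ} (hK : 1 / 2 ≤ μ.real (Set.Icc (-K) K)) (ht : 0 < t) (x : ℝ) :
    |Real.log (heatFlow μ t x)| ≤
      |Real.log (√(2 * Real.pi * t))⁻¹| + Real.log 2 + (x ^ 2 + K ^ 2) / t := by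
  set c := (√(2 * Real.pi * t))⁻¹
  have hc0 : 0 < c := by positivity
  have hupper : Real.log (heatFlow μ t x) ≤ Real.log c :=
    Real.log_le_log (heatFlow_pos μ ht x) (heatFlow_le μ ht x)
  have hlower : -Real.log 2 + (Real.log c - (x ^ 2 + K ^ 2) / t) ≤ Real.log (heatFlow μ t x) := by
    have h : 1 / 2 * (c * Real.exp (-((x ^ 2 + K ^ 2) / t))) ≤ heatFlow μ t x :=
      (by gcongr : _ ≤ μ.real (Set.Icc (-K) K) * (c * Real.exp (-((x ^ 2 + K ^ 2) / t)))).trans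
        (mul_exp_le_heatFlow μ ht K x)
    have := Real.log_le_log (by positivity) h
    rwa [Real.log_mul (by norm_num) (by positivity), Real.log_mul hc0.ne' (Real.exp_pos _).ne',
      Real.log_exp, one_div, Real.log_inv, ← sub_eq_add_neg] at this
  have herror : 0 ≤ Real.log 2 + (x ^ 2 + K ^ 2) / t := by positivity
  rw [abs_le]
  constructor <;> linarith [neg_abs_le (Real.log c), le_abs_self (Real.log c), herror]

lemma exists_abs_log_heatFlow_le (ha : 0 < a) (hab : a ≤ b) :
    ∃ C : ℝ, 0 ≤ C ∧
      ∀ t ∈ Set.Icc a b, ∀ x, |Real.log (heatFlow μ t x)| ≤ C * (1 + x ^ 2) := by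
  have hb : 0 < b := ha.trans_le hab
  obtain ⟨K, hK⟩ := exists_half_le_measureReal_Icc μ
  set c : ℝ → ℝ := fun t => Real.log (√(2 * Real.pi * t))⁻¹
  refine ⟨|c a| + |c b| + Real.log 2 + K ^ 2 / a + 1 / a, by positivity, fun t ht x => ?_⟩
  have ht0 : 0 < t := ha.trans_le ht.1
  have hca : c t ≤ c a := by
    have := ht.1
    exact Real.log_le_log (by positivity) (by gcongr)
  have hcb : c b ≤ c t := by
    have := ht.2
    exact Real.log_le_log (by positivity) (by gcongr)
  have hct : |c t| ≤ |c a| + |c b| := by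
    rw [abs_le]
    constructor <;>
      linarith [le_abs_self (c a), neg_abs_le (c b), abs_nonneg (c a), abs_nonneg (c b)]
  have hquad : (x ^ 2 + K ^ 2) / t ≤ 1 / a * x ^ 2 + K ^ 2 / a := by
    calc (x ^ 2 + K ^ 2) / t ≤ (x ^ 2 + K ^ 2) / a := by gcongr; exact ht.1
      _ = 1 / a * x ^ 2 + K ^ 2 / a := by ring
  have hconst : |c a| + |c b| + Real.log 2 + K ^ 2 / a + 1 / a * x ^ 2 ≤
      (|c a| + |c b| + Real.log 2 + K ^ 2 / a + 1 / a) * (1 + x ^ 2) := by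
    have : 0 ≤ (|c a| + |c b| + Real.log 2 + K ^ 2 / a) * x ^ 2 + 1 / a := by positivity
    linarith
  linarith [abs_log_heatFlow_le μ hK ht0 x]

end LogBound

/-! ### The de Bruijn identity -/

/-- The Fisher information of `μ ∗ N(0, t)`. -/
def flowFisherInfo (μ : Measure ℝ) (t : ℝ) : ℝ := ∫ x, heatFlowDeriv μ t x ^ 2 / heatFlow μ t x

/-- Minus the differential entropy of `μ ∗ N(0, t)`. -/
def flowNegEntropy (μ : Measure ℝ) (t : ℝ) : ℝ := ∫ x, heatFlow μ t x * Real.log (heatFlow μ t x)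

/-- The time derivative of the entropy density `p_t log p_t`, where `p_t` is the density of
`μ ∗ N(0, t)` and `∂ₜ p_t = p_t'' / 2`. -/
def entropyDensityDeriv (μ : Measure ℝ) (t x : ℝ) : ℝ :=
  (Real.log (heatFlow μ t x) + 1) * (heatFlowDeriv₂ μ t x / 2)

section DeBruijn

variable (μ : Measure ℝ) {t a b : ℝ}

lemma measurable_log_heatFlow_add_one [SFinite μ] (t : ℝ) :
    Measurable fun x => Real.log (heatFlow μ t x) + 1 :=
  (measurable_uncurry_heatFlow μ).of_uncurry_left.log.add_const 1

lemma measurable_uncurry_entropyDensityDeriv [SFinite μ] :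
    Measurable (Function.uncurry (entropyDensityDeriv μ)) :=
  ((measurable_uncurry_heatFlow μ).log.add_const 1).mul
    ((measurable_uncurry_heatFlowDeriv₂ μ).div_const 2)

lemma integrable_heatFlowDeriv [IsFiniteMeasure μ] (ht : 0 < t) :
    Integrable (heatFlowDeriv μ t) := by
  obtain ⟨C, -, h⟩ := exists_heatFlow_bound μ ht le_rfl
  exact ((integrable_heatFlow μ (by positivity)).const_mul C).mono'
    (measurable_uncurry_heatFlowDeriv μ).of_uncurry_left.aestronglyMeasurable
    (.of_forall fun x => (h t ⟨le_rfl, le_rfl⟩ x).1)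

lemma integrable_heatFlowDeriv₂ [IsFiniteMeasure μ] (ht : 0 < t) :
    Integrable (heatFlowDeriv₂ μ t) := by
  obtain ⟨C, -, h⟩ := exists_heatFlow_bound μ ht le_rfl
  exact ((integrable_heatFlow μ (by positivity)).const_mul C).mono'
    (measurable_uncurry_heatFlowDeriv₂ μ).of_uncurry_left.aestronglyMeasurable
    (.of_forall fun x => (h t ⟨le_rfl, le_rfl⟩ x).2)

lemma integrable_sq_heatFlowDeriv_div [IsFiniteMeasure μ] [NeZero μ] (ht : 0 < t) :
    Integrable (fun x => heatFlowDeriv μ t x ^ 2 / heatFlow μ t x) := by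
  refine ((integrable_heatFlowDeriv₂ μ ht).add ((integrable_heatFlow μ ht).div_const t)).mono'
    (((measurable_uncurry_heatFlowDeriv μ).of_uncurry_left.pow_const 2).div
      (measurable_uncurry_heatFlow μ).of_uncurry_left).aestronglyMeasurable (.of_forall fun x => ?_)
  rw [Real.norm_of_nonneg (div_nonneg (sq_nonneg _) (heatFlow_nonneg μ t x))]
  exact sq_heatFlowDeriv_div_le μ ht x

lemma integrable_mul_of_le_heatFlow [IsFiniteMeasure μ] (hμ : MemLp id 2 μ) {C D : ℝ}
    (ht : 0 < t) {g k : ℝ → ℝ} (hg : Measurable g) (hk : Measurable k)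
    (hgC : ∀ x, |g x| ≤ C * (1 + x ^ 2)) (hkD : ∀ x, |k x| ≤ D * heatFlow μ t x) :
    Integrable (fun x => g x * k x) := by
  refine ((integrable_heatFlow_mul_one_add_sq μ hμ ht).const_mul (C * D)).mono'
    (hg.mul hk).aestronglyMeasurable (.of_forall fun x => ?_)
  calc ‖g x * k x‖ = |g x| * |k x| := norm_mul _ _
    _ ≤ (C * (1 + x ^ 2)) * (D * heatFlow μ t x) :=
        mul_le_mul (hgC x) (hkD x) (abs_nonneg _) ((abs_nonneg _).trans (hgC x))
    _ = C * D * (heatFlow μ t x * (1 + x ^ 2)) := by ring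

variable [IsProbabilityMeasure μ]

lemma exists_abs_log_heatFlow_add_one_le (ha : 0 < a) (hab : a ≤ b) :
    ∃ C : ℝ, 0 ≤ C ∧
      ∀ t ∈ Set.Icc a b, ∀ x, |Real.log (heatFlow μ t x) + 1| ≤ C * (1 + x ^ 2) := by
  obtain ⟨C, hC, h⟩ := exists_abs_log_heatFlow_le μ ha hab
  refine ⟨C + 1, by positivity, fun t ht x => ?_⟩
  calc |Real.log (heatFlow μ t x) + 1| ≤ |Real.log (heatFlow μ t x)| + |(1 : ℝ)| := abs_add_le _ _
    _ ≤ C * (1 + x ^ 2) + 1 := by rw [abs_one]; gcongr; exact h t ht x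
    _ ≤ (C + 1) * (1 + x ^ 2) := by nlinarith [sq_nonneg x]

lemma integrable_heatFlow_mul_log (hμ : MemLp id 2 μ) (ht : 0 < t) :
    Integrable (fun x => heatFlow μ t x * Real.log (heatFlow μ t x)) := by
  obtain ⟨C, -, h⟩ := exists_abs_log_heatFlow_le μ ht le_rfl
  have hm : Measurable (heatFlow μ t) := (measurable_uncurry_heatFlow μ).of_uncurry_left
  simpa only [mul_comm] using integrable_mul_of_le_heatFlow (D := 1) μ hμ ht hm.log hm
    (h t ⟨le_rfl, le_rfl⟩) (fun x => by rw [one_mul, abs_of_nonneg (heatFlow_nonneg μ t x)])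

lemma integral_entropyDensityDeriv (hμ : MemLp id 2 μ) (ht : 0 < t) :
    ∫ x, entropyDensityDeriv μ t x = -flowFisherInfo μ t / 2 := by
  obtain ⟨C, -, hlog⟩ := exists_abs_log_heatFlow_add_one_le μ ht le_rfl
  obtain ⟨D, -, hD⟩ := exists_heatFlow_bound μ ht le_rfl
  have hlog' := hlog t ⟨le_rfl, le_rfl⟩
  have hD' := hD t ⟨le_rfl, le_rfl⟩
  have hscore (x : ℝ) : HasDerivAt (fun x => Real.log (heatFlow μ t x) + 1)
      (heatFlowDeriv μ t x / heatFlow μ t x) x :=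
    ((hasDerivAt_heatFlow μ ht x).log (heatFlow_pos μ ht x).ne').add_const 1
  have hfisher (x : ℝ) : heatFlowDeriv μ t x / heatFlow μ t x * heatFlowDeriv μ t x =
      heatFlowDeriv μ t x ^ 2 / heatFlow μ t x := by ring
  have hparts : ∫ x, (Real.log (heatFlow μ t x) + 1) * heatFlowDeriv₂ μ t x =
      -flowFisherInfo μ t := by
    rw [integral_mul_deriv_eq_deriv_mul_of_integrable (fun x _ => hscore x)
      (fun x _ => hasDerivAt_heatFlowDeriv μ ht x)]
    · simp only [hfisher, flowFisherInfo]
    · exact integrable_mul_of_le_heatFlow μ hμ (by positivity)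
        (measurable_log_heatFlow_add_one μ t) (measurable_uncurry_heatFlowDeriv₂ μ).of_uncurry_left
        hlog' fun x => (hD' x).2
    · simp only [Pi.mul_def, hfisher]
      exact integrable_sq_heatFlowDeriv_div μ ht
    · exact integrable_mul_of_le_heatFlow μ hμ (by positivity)
        (measurable_log_heatFlow_add_one μ t) (measurable_uncurry_heatFlowDeriv μ).of_uncurry_left
        hlog' fun x => (hD' x).1
  simp only [entropyDensityDeriv, ← mul_div_assoc]
  rw [integral_div, hparts]

lemma exists_abs_entropyDensityDeriv_le (ha : 0 < a) (hab : a ≤ b) :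
    ∃ C : ℝ, ∀ t ∈ Set.Icc a b, ∀ x,
      |entropyDensityDeriv μ t x| ≤ C * (heatFlow μ (2 * b) x * (1 + x ^ 2)) := by
  obtain ⟨C, hC, hlog⟩ := exists_abs_log_heatFlow_add_one_le μ ha hab
  obtain ⟨D, -, hD⟩ := exists_heatFlow_bound μ ha hab
  refine ⟨C * D, fun t ht x => ?_⟩
  have hhalf : |heatFlowDeriv₂ μ t x / 2| ≤ D * heatFlow μ (2 * b) x := by
    rw [abs_div, abs_two]
    exact (half_le_self (abs_nonneg _)).trans (hD t ht x).2
  calc |entropyDensityDeriv μ t x|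
      = |Real.log (heatFlow μ t x) + 1| * |heatFlowDeriv₂ μ t x / 2| := abs_mul _ _
    _ ≤ (C * (1 + x ^ 2)) * (D * heatFlow μ (2 * b) x) := by gcongr; exact hlog t ht x
    _ = C * D * (heatFlow μ (2 * b) x * (1 + x ^ 2)) := by ring

lemma intervalIntegral_entropyDensityDeriv (ha : 0 < a) (hab : a ≤ b) (x : ℝ) :
    ∫ t in a..b, entropyDensityDeriv μ t x =
      heatFlow μ b x * Real.log (heatFlow μ b x) - heatFlow μ a x * Real.log (heatFlow μ a x) := by
  obtain ⟨C, hC⟩ := exists_abs_entropyDensityDeriv_le μ ha hab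
  refine intervalIntegral.integral_eq_sub_of_hasDerivAt
    (f := fun t => heatFlow μ t x * Real.log (heatFlow μ t x)) (fun t ht => ?_) ?_
  · rw [Set.uIcc_of_le hab] at ht
    have ht0 : 0 < t := ha.trans_le ht.1
    have hne : heatFlow μ t x ≠ 0 := (heatFlow_pos μ ht0 x).ne'
    have hd := hasDerivAt_heatFlow_time μ ht0 x
    refine (hd.mul (hd.log hne)).congr_deriv ?_
    rw [entropyDensityDeriv]
    field_simp
  · rw [intervalIntegrable_iff_integrableOn_Ioc_of_le hab]
    refine IntegrableOn.of_bound (by simp)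
      (measurable_uncurry_entropyDensityDeriv μ).of_uncurry_right.aestronglyMeasurable
      (C * (heatFlow μ (2 * b) x * (1 + x ^ 2))) ?_
    filter_upwards [ae_restrict_mem measurableSet_Ioc] with t ht
    exact hC t (Set.Ioc_subset_Icc_self ht) x

lemma integrable_entropyDensityDeriv (hμ : MemLp id 2 μ) (ha : 0 < a) (hab : a ≤ b) :
    Integrable (Function.uncurry (entropyDensityDeriv μ))
      ((volume.restrict (Set.Ioc a b)).prod volume) := by
  obtain ⟨C, hC⟩ := exists_abs_entropyDensityDeriv_le μ ha hab
  have hdom : Integrable (fun p : ℝ × ℝ => C * (heatFlow μ (2 * b) p.2 * (1 + p.2 ^ 2)))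
      ((volume.restrict (Set.Ioc a b)).prod volume) :=
    ((integrable_heatFlow_mul_one_add_sq μ hμ
      (by linarith [ha.trans_le hab])).const_mul C).comp_snd _
  refine hdom.mono' (measurable_uncurry_entropyDensityDeriv μ).aestronglyMeasurable ?_
  filter_upwards [Measure.quasiMeasurePreserving_fst.ae (ae_restrict_mem measurableSet_Ioc)]
    with p hp
  exact hC p.1 (Set.Ioc_subset_Icc_self hp) p.2

lemma integrableOn_flowFisherInfo (hμ : MemLp id 2 μ) (ha : 0 < a) (hab : a ≤ b) :
    IntegrableOn (flowFisherInfo μ) (Set.Ioc a b) := by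
  refine ((integrable_entropyDensityDeriv μ hμ ha hab).integral_prod_left.const_mul (-2)).congr ?_
  filter_upwards [ae_restrict_mem measurableSet_Ioc] with t ht
  simp only [Function.uncurry_apply_pair, integral_entropyDensityDeriv μ hμ (ha.trans ht.1)]
  ring

lemma flowNegEntropy_sub_flowNegEntropy (hμ : MemLp id 2 μ) (ha : 0 < a) (hab : a ≤ b) :
    flowNegEntropy μ a - flowNegEntropy μ b = (∫ t in a..b, flowFisherInfo μ t) / 2 := by
  have hswap := integral_integral_swap (integrable_entropyDensityDeriv μ hμ ha hab)
  simp_rw [← intervalIntegral.integral_of_le hab, intervalIntegral_entropyDensityDeriv μ ha hab]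
    at hswap
  rw [integral_sub (integrable_heatFlow_mul_log μ hμ (ha.trans_le hab))
      (integrable_heatFlow_mul_log μ hμ ha),
    intervalIntegral.integral_of_le hab,
    setIntegral_congr_fun measurableSet_Ioc fun t ht =>
      integral_entropyDensityDeriv μ hμ (ha.trans ht.1),
    integral_div, integral_neg, ← intervalIntegral.integral_of_le hab] at hswap
  unfold flowNegEntropy
  linarith

end DeBruijn

/-! ### Fisher information and relative entropy of smoothed measures -/

lemma IsC1Density.unique {f g : ℝ → ℝ} {ν : Measure ℝ} [IsFiniteMeasure ν]
    (hf : IsC1Density f ν) (hg : IsC1Density g ν) : f = g := by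
  have hfin : ∫⁻ x, ENNReal.ofReal (f x) ≠ ∞ := by
    have := hf.2.2 ▸ measure_ne_top ν Set.univ
    rwa [withDensity_apply _ MeasurableSet.univ, Measure.restrict_univ] at this
  have hae := (withDensity_eq_iff hf.1.continuous.measurable.ennreal_ofReal.aemeasurable
    hg.1.continuous.measurable.ennreal_ofReal.aemeasurable hfin).1 (hf.2.2.symm.trans hg.2.2)
  refine (Continuous.ae_eq_iff_eq volume hf.1.continuous hg.1.continuous).1 ?_
  filter_upwards [hae] with x hx
  exact (ENNReal.ofReal_eq_ofReal_iff (hf.2.1 x) (hg.2.1 x)).1 hx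

lemma ofReal_integral_le_lintegral {α : Type*} [MeasurableSpace α] (μ : Measure α) (f : α → ℝ) :
    ENNReal.ofReal (∫ x, f x ∂μ) ≤ ∫⁻ x, ENNReal.ofReal (f x) ∂μ := by
  by_cases hf : Integrable f μ
  · rw [integral_eq_lintegral_pos_part_sub_lintegral_neg_part hf]
    exact ENNReal.ofReal_le_of_le_toReal (sub_le_self _ ENNReal.toReal_nonneg)
  · simp [integral_undef hf]

/-- The excess of the Fisher information of `μ ∗ N(0, t)` over that of the normal law with the same
second moment. For centred `μ` it is nonnegative (Cramér–Rao), so that the truncation by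
`ENNReal.ofReal` is harmless. -/
def excessFisherInfo (μ : Measure ℝ) (t : ℝ) : ℝ≥0∞ :=
  ENNReal.ofReal (flowFisherInfo μ t - 1 / (∫ x, x ^ 2 ∂μ + t))

section FisherInformation

variable (μ : Measure ℝ)

lemma deriv_heatFlow [IsFiniteMeasure μ] {t : ℝ} (ht : 0 < t) :
    deriv (heatFlow μ t) = heatFlowDeriv μ t :=
  funext fun x => (hasDerivAt_heatFlow μ ht x).deriv

lemma isC1Density_heatFlow [IsFiniteMeasure μ] {t : ℝ≥0} (ht : t ≠ 0) :
    IsC1Density (heatFlow μ t) (μ ∗ gaussianReal 0 t) := by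
  have ht0 : (0 : ℝ) < t := NNReal.coe_pos.2 (pos_iff_ne_zero.2 ht)
  refine ⟨?_, heatFlow_nonneg μ t, conv_gaussianReal_eq_withDensity μ ht⟩
  rw [contDiff_one_iff_deriv, deriv_heatFlow μ ht0]
  exact ⟨fun x => (hasDerivAt_heatFlow μ ht0 x).differentiableAt,
    continuous_iff_continuousAt.2 fun x => (hasDerivAt_heatFlowDeriv μ ht0 x).continuousAt⟩

lemma fisherInfo_conv_gaussianReal [IsFiniteMeasure μ] [NeZero μ] {t : ℝ≥0} (ht : t ≠ 0) :
    fisherInfo (μ ∗ gaussianReal 0 t) = ENNReal.ofReal (flowFisherInfo μ t) := by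
  have ht0 : (0 : ℝ) < t := NNReal.coe_pos.2 (pos_iff_ne_zero.2 ht)
  have hdensity := isC1Density_heatFlow μ ht
  have hm : Measurable (heatFlow μ t) := (measurable_uncurry_heatFlow μ).of_uncurry_left
  have hm' : Measurable (heatFlowDeriv μ t) := (measurable_uncurry_heatFlowDeriv μ).of_uncurry_left
  have hscore : Measurable fun x => ENNReal.ofReal ((heatFlowDeriv μ t x / heatFlow μ t x) ^ 2) :=
    ((hm'.div hm).pow_const 2).ennreal_ofReal
  have hvalue : ∫⁻ x, ENNReal.ofReal ((deriv (heatFlow μ t) x / heatFlow μ t x) ^ 2)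
      ∂(μ ∗ gaussianReal 0 t) = ENNReal.ofReal (flowFisherInfo μ t) := by
    rw [conv_gaussianReal_eq_withDensity μ ht, deriv_heatFlow μ ht0,
      lintegral_withDensity_eq_lintegral_mul _ hm.ennreal_ofReal hscore, flowFisherInfo,
      ofReal_integral_eq_lintegral_ofReal (integrable_sq_heatFlowDeriv_div μ ht0)
        (.of_forall fun x => div_nonneg (sq_nonneg _) (heatFlow_nonneg μ t x))]
    refine lintegral_congr fun x => ?_
    have hne : heatFlow μ t x ≠ 0 := (heatFlow_pos μ ht0 x).ne'
    rw [Pi.mul_apply, ← ENNReal.ofReal_mul (heatFlow_nonneg μ t x)]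
    congr 1
    field_simp
  refine le_antisymm ((iInf₂_le (heatFlow μ t) hdensity).trans_eq hvalue) (le_iInf₂ fun f hf => ?_)
  rw [hf.unique hdensity, hvalue]

lemma measurable_flowFisherInfo [SFinite μ] : Measurable (flowFisherInfo μ) := by
  have h : Measurable (Function.uncurry fun t x => heatFlowDeriv μ t x ^ 2 / heatFlow μ t x) :=
    ((measurable_uncurry_heatFlowDeriv μ).pow_const 2).div (measurable_uncurry_heatFlow μ)
  exact h.stronglyMeasurable.integral_prod_right.measurable

lemma measurable_excessFisherInfo [SFinite μ] : Measurable (excessFisherInfo μ) :=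
  ((measurable_flowFisherInfo μ).sub (by fun_prop)).ennreal_ofReal

end FisherInformation

lemma log_heatKernel {t : ℝ} (ht : 0 < t) (x : ℝ) :
    Real.log (heatKernel t x) = -(Real.log (2 * Real.pi * t) / 2) - x ^ 2 / (2 * t) := by
  have hpos : 0 < 2 * Real.pi * t := by positivity
  rw [heatKernel, Real.log_mul (by positivity) (Real.exp_pos _).ne', Real.log_exp, Real.log_inv,
    Real.log_sqrt hpos.le]
  ring

section GaussianDensityRatio

variable (μ : Measure ℝ) {t v : ℝ≥0}

lemma gaussianReal_eq_withDensity_heatKernel (hv : v ≠ 0) :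
    gaussianReal 0 v = volume.withDensity fun x => ENNReal.ofReal (heatKernel v x) := by
  rw [gaussianReal_of_var_ne_zero 0 hv]
  simp only [gaussianPDF_def, gaussianPDFReal_zero_eq_heatKernel]

lemma conv_gaussianReal_eq_withDensity_gaussianReal [IsFiniteMeasure μ] (ht : t ≠ 0) (hv : v ≠ 0) :
    μ ∗ gaussianReal 0 t = (gaussianReal 0 v).withDensity
      fun x => ENNReal.ofReal (heatFlow μ t x / heatKernel v x) := by
  have hm : Measurable (heatFlow μ t) := (measurable_uncurry_heatFlow μ).of_uncurry_left
  have hmk : Measurable (heatKernel v) := (continuous_heatKernel v).measurable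
  have hratio : Measurable fun x => ENNReal.ofReal (heatFlow μ t x / heatKernel v x) :=
    (hm.div hmk).ennreal_ofReal
  rw [conv_gaussianReal_eq_withDensity μ ht, gaussianReal_eq_withDensity_heatKernel hv,
    ← withDensity_mul _ hmk.ennreal_ofReal hratio]
  congr with x
  have hne : heatKernel v x ≠ 0 :=
    (heatKernel_pos (NNReal.coe_pos.2 (pos_iff_ne_zero.2 hv)) x).ne'
  rw [Pi.mul_apply, ← ENNReal.ofReal_mul (heatKernel_nonneg _ _), mul_div_cancel₀ _ hne]

lemma absolutelyContinuous_conv_gaussianReal [IsFiniteMeasure μ] (ht : t ≠ 0) (hv : v ≠ 0) :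
    μ ∗ gaussianReal 0 t ≪ gaussianReal 0 v := by
  rw [conv_gaussianReal_eq_withDensity_gaussianReal μ ht hv]
  exact withDensity_absolutelyContinuous _ _

lemma llr_conv_gaussianReal [IsFiniteMeasure μ] [NeZero μ] (ht : t ≠ 0) (hv : v ≠ 0) :
    llr (μ ∗ gaussianReal 0 t) (gaussianReal 0 v) =ᵐ[μ ∗ gaussianReal 0 t]
      fun x => Real.log (heatFlow μ t x) + (Real.log (2 * Real.pi * v) / 2 + x ^ 2 / (2 * v)) := by
  have ht0 : (0 : ℝ) < t := NNReal.coe_pos.2 (pos_iff_ne_zero.2 ht)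
  have hv0 : (0 : ℝ) < v := NNReal.coe_pos.2 (pos_iff_ne_zero.2 hv)
  have hrnDeriv : (μ ∗ gaussianReal 0 t).rnDeriv (gaussianReal 0 v) =ᵐ[gaussianReal 0 v]
      fun x => ENNReal.ofReal (heatFlow μ t x / heatKernel v x) := by
    rw [conv_gaussianReal_eq_withDensity_gaussianReal μ ht hv]
    exact Measure.rnDeriv_withDensity _ ((measurable_uncurry_heatFlow μ).of_uncurry_left.div
      (continuous_heatKernel v).measurable).ennreal_ofReal
  filter_upwards [(absolutelyContinuous_conv_gaussianReal μ ht hv).ae_le hrnDeriv] with x hx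
  rw [llr, hx, ENNReal.toReal_ofReal (div_nonneg (heatFlow_nonneg _ _ _) (heatKernel_nonneg _ _)),
    Real.log_div (heatFlow_pos μ ht0 x).ne' (heatKernel_pos hv0 x).ne', log_heatKernel hv0]
  ring

end GaussianDensityRatio

section EntropyOfFlow

variable (μ : Measure ℝ) [IsProbabilityMeasure μ]

lemma heatKernel_mul_log {t : ℝ} (ht : 0 < t) (x : ℝ) :
    heatKernel t x * Real.log (heatKernel t x) =
      -(Real.log (2 * Real.pi * t) / 2 + 1 / 2) * heatKernel t x -
        t / 2 * heatKernelDeriv₂ t x := by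
  rw [log_heatKernel ht, heatKernelDeriv₂]
  field_simp
  ring

lemma heatFlow_mul_log_le {t : ℝ} (ht : 0 < t) (x : ℝ) :
    heatFlow μ t x * Real.log (heatFlow μ t x) ≤
      -(Real.log (2 * Real.pi * t) / 2 + 1 / 2) * heatFlow μ t x -
        t / 2 * heatFlowDeriv₂ μ t x := by
  set c := -(Real.log (2 * Real.pi * t) / 2 + 1 / 2)
  have hint : Integrable (fun y => c * heatKernel t (x - y)) μ :=
    (integrable_heatKernel μ ht x).const_mul c
  have hint₂ : Integrable (fun y => t / 2 * heatKernelDeriv₂ t (x - y)) μ :=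
    (integrable_heatKernelDeriv₂ μ ht x).const_mul (t / 2)
  calc heatFlow μ t x * Real.log (heatFlow μ t x)
      ≤ ∫ y, heatKernel t (x - y) * Real.log (heatKernel t (x - y)) ∂μ := by
        refine Real.convexOn_mul_log.map_integral_le Real.continuous_mul_log.continuousOn
          isClosed_Ici (.of_forall fun y => heatKernel_nonneg t _) (integrable_heatKernel μ ht x) ?_
        simp only [Function.comp_def, heatKernel_mul_log ht]
        exact hint.sub hint₂
    _ = ∫ y, (c * heatKernel t (x - y) - t / 2 * heatKernelDeriv₂ t (x - y)) ∂μ := by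
        simp only [heatKernel_mul_log ht, c]
    _ = c * heatFlow μ t x - t / 2 * heatFlowDeriv₂ μ t x := by
        rw [integral_sub hint hint₂, integral_const_mul, integral_const_mul]
        rfl

lemma integral_heatFlowDeriv₂ {t : ℝ} (ht : 0 < t) : ∫ x, heatFlowDeriv₂ μ t x = 0 :=
  integral_eq_zero_of_hasDerivAt_of_integrable (hasDerivAt_heatFlowDeriv μ ht)
    (integrable_heatFlowDeriv₂ μ ht) (integrable_heatFlowDeriv μ ht)

lemma flowNegEntropy_le (hμ : MemLp id 2 μ) {t : ℝ} (ht : 0 < t) :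
    flowNegEntropy μ t ≤ -(Real.log (2 * Real.pi * t) / 2 + 1 / 2) := by
  set c := -(Real.log (2 * Real.pi * t) / 2 + 1 / 2)
  have hint := (integrable_heatFlow μ ht).const_mul c
  have hint₂ := (integrable_heatFlowDeriv₂ μ ht).const_mul (t / 2)
  calc flowNegEntropy μ t
      ≤ ∫ x, (c * heatFlow μ t x - t / 2 * heatFlowDeriv₂ μ t x) :=
        integral_mono (integrable_heatFlow_mul_log μ hμ ht) (hint.sub hint₂)
          (heatFlow_mul_log_le μ ht)
    _ = c := by
        rw [integral_sub hint hint₂, integral_const_mul, integral_const_mul, integral_heatFlow μ ht,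
          integral_heatFlowDeriv₂ μ ht]
        ring

lemma klDiv_conv_gaussianReal (hμ : MemLp id 2 μ) {t v : ℝ≥0} (ht : t ≠ 0) (hv : v ≠ 0) :
    InformationTheory.klDiv (μ ∗ gaussianReal 0 t) (gaussianReal 0 v) =
      ENNReal.ofReal (flowNegEntropy μ t + Real.log (2 * Real.pi * v) / 2 +
        (∫ x, x ^ 2 ∂μ + t) / (2 * v)) := by
  have ht0 : (0 : ℝ) < t := NNReal.coe_pos.2 (pos_iff_ne_zero.2 ht)
  have hlog : Integrable (fun x => Real.log (heatFlow μ t x)) (μ ∗ gaussianReal 0 t) := by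
    simpa using (integrable_heatFlow_mul_iff μ ht0 _).1 (integrable_heatFlow_mul_log μ hμ ht0)
  have hentropy : ∫ x, Real.log (heatFlow μ t x) ∂(μ ∗ gaussianReal 0 t) = flowNegEntropy μ t := by
    simpa [flowNegEntropy] using
      (integral_heatFlow_mul μ ht0 fun x => Real.log (heatFlow μ t x)).symm
  have hsq : Integrable (fun x : ℝ => x ^ 2 / (2 * v)) (μ ∗ gaussianReal 0 t) :=
    (memLp_id_conv μ hμ (memLp_id_gaussianReal' 2 (by simp))).integrable_sq.div_const _
  have hquad : Integrable (fun x : ℝ => Real.log (2 * Real.pi * v) / 2 + x ^ 2 / (2 * v))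
      (μ ∗ gaussianReal 0 t) := (integrable_const _).add hsq
  have hllr := llr_conv_gaussianReal μ ht hv
  rw [InformationTheory.klDiv_of_ac_of_integrable (absolutelyContinuous_conv_gaussianReal μ ht hv)
    ((hlog.add hquad).congr hllr.symm), integral_congr_ae hllr, integral_add hlog hquad,
    integral_add (integrable_const _) hsq, integral_div (2 * (v : ℝ)),
    integral_sq_conv_gaussianReal μ hμ, hentropy]
  simp only [integral_const, probReal_univ, one_smul]
  congr 1
  ring

end EntropyOfFlow

section EntropyBound

variable (μ : Measure ℝ) [IsProbabilityMeasure μ] {s a b : ℝ≥0}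

lemma intervalIntegral_flowFisherInfo_sub (hμ : MemLp id 2 μ) (ha : a ≠ 0) (hab : a ≤ b) :
    ∫ t in a..b, (flowFisherInfo μ t - 1 / (s + t)) =
      2 * (flowNegEntropy μ a - flowNegEntropy μ b) - Real.log ((s + b) / (s + a)) := by
  have ha0 : (0 : ℝ) < a := NNReal.coe_pos.2 (pos_iff_ne_zero.2 ha)
  have hab' : (a : ℝ) ≤ b := hab
  have hpos (t : ℝ) (ht : t ∈ Set.uIcc (a : ℝ) b) : (0 : ℝ) < s + t := by
    rw [Set.uIcc_of_le hab'] at ht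
    linarith [s.coe_nonneg, ht.1]
  have hfisher : IntervalIntegrable (flowFisherInfo μ) volume a b :=
    (intervalIntegrable_iff_integrableOn_Ioc_of_le hab').2
      (integrableOn_flowFisherInfo μ hμ ha0 hab')
  have hinv : IntervalIntegrable (fun t : ℝ => 1 / (s + t)) volume a b :=
    intervalIntegral.intervalIntegrable_one_div (fun t ht => (hpos t ht).ne')
      (by fun_prop)
  have hlog : ∫ t in a..b, 1 / (s + t) = Real.log ((s + b) / (s + a)) := by
    rw [intervalIntegral.integral_comp_add_left (fun t : ℝ => 1 / t),
      integral_one_div_of_pos (hpos _ Set.left_mem_uIcc) (hpos _ Set.right_mem_uIcc)]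
  rw [intervalIntegral.integral_sub hfisher hinv, hlog,
    flowNegEntropy_sub_flowNegEntropy μ hμ ha0 hab']
  ring

lemma klDiv_conv_gaussianReal_le_add (hμ : MemLp id 2 μ) (hs : ∫ x, x ^ 2 ∂μ = s)
    (ha : a ≠ 0) (hab : a ≤ b) :
    InformationTheory.klDiv (μ ∗ gaussianReal 0 a) (gaussianReal 0 (s + a)) ≤
      ENNReal.ofReal (Real.log (1 + s / b) / 2) +
        (∫⁻ t in Set.Ioi 0, excessFisherInfo μ t) / 2 := by
  have ha0 : (0 : ℝ) < a := NNReal.coe_pos.2 (pos_iff_ne_zero.2 ha)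
  have hab' : (a : ℝ) ≤ b := hab
  have hb0 : (0 : ℝ) < b := ha0.trans_le hab'
  have hbound : flowNegEntropy μ a + Real.log (2 * Real.pi * (s + a)) / 2 + 1 / 2 ≤
      Real.log (1 + s / b) / 2 + (∫ t in a..b, (flowFisherInfo μ t - 1 / (s + t))) / 2 := by
    have hsplit : (1 : ℝ) + s / b = (s + b) / b := by field_simp; ring
    have hle := flowNegEntropy_le μ hμ hb0
    rw [Real.log_mul (by positivity) hb0.ne'] at hle
    rw [intervalIntegral_flowFisherInfo_sub μ hμ ha hab, hsplit,
      Real.log_div (by positivity) hb0.ne', Real.log_div (by positivity) (by positivity),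
      Real.log_mul (by positivity) (by positivity)]
    linarith
  have hmoment : (∫ x, x ^ 2 ∂μ + a) / (2 * ↑(s + a)) = 1 / 2 := by
    rw [hs, NNReal.coe_add]
    field_simp
  rw [klDiv_conv_gaussianReal μ hμ ha (by simp [ha]), hmoment, NNReal.coe_add]
  refine (ENNReal.ofReal_le_ofReal hbound).trans (ENNReal.ofReal_add_le.trans ?_)
  gcongr
  rw [ENNReal.ofReal_div_of_pos two_pos, ENNReal.ofReal_ofNat]
  gcongr
  calc ENNReal.ofReal (∫ t in a..b, (flowFisherInfo μ t - 1 / (s + t)))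
      ≤ ∫⁻ t in Set.Ioc (a : ℝ) b, ENNReal.ofReal (flowFisherInfo μ t - 1 / (s + t)) := by
        rw [intervalIntegral.integral_of_le hab']
        exact ofReal_integral_le_lintegral _ _
    _ ≤ ∫⁻ t in Set.Ioi 0, excessFisherInfo μ t := by
        simp only [excessFisherInfo, hs]
        exact lintegral_mono_set fun t ht => ha0.trans ht.1

lemma klDiv_conv_gaussianReal_le (hμ : MemLp id 2 μ) (hs : ∫ x, x ^ 2 ∂μ = s) (ha : a ≠ 0) :
    InformationTheory.klDiv (μ ∗ gaussianReal 0 a) (gaussianReal 0 (s + a)) ≤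
      (∫⁻ t in Set.Ioi 0, excessFisherInfo μ t) / 2 := by
  have hlog : Tendsto (fun b : ℝ≥0 => ENNReal.ofReal (Real.log (1 + s / b) / 2)) atTop (𝓝 0) := by
    have hdiv : Tendsto (fun b : ℝ≥0 => (1 : ℝ) + s / b) atTop (𝓝 (1 + 0)) :=
      tendsto_const_nhds.add (tendsto_const_nhds.div_atTop (NNReal.tendsto_coe_atTop.2 tendsto_id))
    have := (hdiv.log (by norm_num)).div_const 2
    simp only [add_zero, Real.log_one, zero_div] at this
    simpa using ENNReal.tendsto_ofReal this
  have hlim := hlog.add_const ((∫⁻ t in Set.Ioi 0, excessFisherInfo μ t) / 2)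
  rw [zero_add] at hlim
  exact ge_of_tendsto hlim
    ((eventually_ge_atTop a).mono fun _ => klDiv_conv_gaussianReal_le_add μ hμ hs ha)

end EntropyBound

/-! ### The variational formula for relative entropy -/

section LogTrunc

/-- The logarithm of `r` truncated to `[-N, N]`, with the value `-N` (rather than `Real.log 0 = 0`)
at `r ≤ 0`. The functions `logTrunc N (dμ/dν)` are almost optimal in the variational formula for
`klDiv μ ν`. -/
def logTrunc (N : ℕ) (r : ℝ) : ℝ :=
  Real.log (max (Real.exp (-N)) (min (Real.exp N) r))

lemma exp_logTrunc (N : ℕ) (r : ℝ) :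
    Real.exp (logTrunc N r) = max (Real.exp (-N)) (min (Real.exp N) r) :=
  Real.exp_log (lt_max_of_lt_left (Real.exp_pos _))

lemma measurable_logTrunc (N : ℕ) : Measurable (logTrunc N) := by
  unfold logTrunc
  fun_prop

lemma abs_logTrunc_le (N : ℕ) (r : ℝ) : |logTrunc N r| ≤ N := by
  have hN : -(N : ℝ) ≤ N := neg_le_self N.cast_nonneg
  rw [abs_le, ← Real.exp_le_exp, ← Real.exp_le_exp (y := (N : ℝ)), exp_logTrunc]
  exact ⟨le_max_left _ _, max_le (Real.exp_le_exp.2 hN) (min_le_left _ _)⟩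

lemma exp_logTrunc_sub_one_le (N : ℕ) (r : ℝ) :
    Real.exp (logTrunc N r) - 1 ≤ r * logTrunc N r := by
  set h := logTrunc N r with hh
  have hsub : Real.exp h - 1 ≤ Real.exp h * h := by
    have := mul_le_mul_of_nonneg_left (Real.add_one_le_exp (-h)) (Real.exp_pos h).le
    rw [← Real.exp_add, add_neg_cancel, Real.exp_zero] at this
    linarith
  have hsign : Real.exp h * h ≤ r * h := by
    have hN : (0 : ℝ) ≤ N := N.cast_nonneg
    rw [exp_logTrunc]
    rcases le_or_gt r 1 with hr | hr
    · have hmin : min (Real.exp N) r = r := min_eq_right (hr.trans (Real.one_le_exp hN))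
      have hle : max (Real.exp (-N)) r ≤ 1 := max_le (Real.exp_le_one_iff.2 (neg_nonpos.2 hN)) hr
      refine mul_le_mul_of_nonpos_right (hmin.symm ▸ le_max_right _ _) ?_
      rw [hh, logTrunc, hmin]
      exact Real.log_nonpos (le_max_of_le_left (Real.exp_pos _).le) hle
    · have hle : 1 ≤ min (Real.exp N) r := le_min (Real.one_le_exp hN) hr.le
      have hmax : max (Real.exp (-N)) (min (Real.exp N) r) = min (Real.exp N) r :=
        max_eq_right ((Real.exp_le_one_iff.2 (neg_nonpos.2 hN)).trans hle)
      refine mul_le_mul_of_nonneg_right (hmax.trans_le (min_le_right _ _)) ?_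
      rw [hh, logTrunc, hmax]
      exact Real.log_nonneg hle
  exact hsub.trans hsign

lemma tendsto_mul_logTrunc_sub {r : ℝ} (hr : 0 ≤ r) :
    Tendsto (fun N : ℕ => r * logTrunc N r - (Real.exp (logTrunc N r) - 1)) atTop
      (𝓝 (InformationTheory.klFun r)) := by
  rcases hr.eq_or_lt with rfl | hr
  · have hexp : Tendsto (fun N : ℕ => Real.exp (-(N : ℝ))) atTop (𝓝 0) :=
      Real.tendsto_exp_neg_atTop_nhds_zero.comp tendsto_natCast_atTop_atTop
    have hmax (N : ℕ) : max (Real.exp (-N)) (min (Real.exp N) 0) = Real.exp (-N) := by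
      rw [min_eq_right (Real.exp_pos _).le, max_eq_left (Real.exp_pos _).le]
    simpa [exp_logTrunc, hmax, InformationTheory.klFun_zero] using hexp.const_sub 1
  · refine tendsto_const_nhds.congr' ?_
    obtain ⟨N₀, hN₀⟩ := exists_nat_ge |Real.log r|
    filter_upwards [eventually_ge_atTop N₀] with N hN
    obtain ⟨hlow, hupp⟩ := abs_le.1 (hN₀.trans (Nat.cast_le.2 hN))
    have htrunc : max (Real.exp (-N)) (min (Real.exp N) r) = r := by
      rw [min_eq_right ((Real.log_le_iff_le_exp hr).1 hupp),
        max_eq_right ((Real.le_log_iff_exp_le hr).1 hlow)]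
    rw [exp_logTrunc, logTrunc, htrunc, InformationTheory.klFun_apply]
    ring

end LogTrunc

section Variational

variable {α : Type*} [MeasurableSpace α] {μ ν : Measure α} [IsProbabilityMeasure μ] {C : ℝ}

lemma mul_le_klFun_add_exp {r : ℝ} (hr : 0 ≤ r) (h : ℝ) :
    r * h ≤ InformationTheory.klFun r + (Real.exp h - 1) := by
  rw [InformationTheory.klFun_apply]
  rcases hr.eq_or_lt with rfl | hr
  · simp [Real.exp_nonneg]
  · have htangent := mul_le_mul_of_nonneg_left (Real.add_one_le_exp (h - Real.log r)) hr.le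
    rw [Real.exp_sub, Real.exp_log hr, mul_div_cancel₀ _ hr.ne'] at htangent
    linarith

lemma absolutelyContinuous_of_forall_integral_le
    (H : ∀ (N : ℕ) (h : α → ℝ), Measurable h → (∀ x, |h x| ≤ N) →
      ∫ x, h x ∂μ ≤ C + ∫ x, (Real.exp (h x) - 1) ∂ν) :
    μ ≪ ν := by
  refine Measure.AbsolutelyContinuous.mk fun s hs hνs => ?_
  by_contra hμs
  have hpos : 0 < μ.real s := ENNReal.toReal_pos hμs (measure_ne_top _ _)
  obtain ⟨N, hN⟩ := exists_nat_gt (C / μ.real s)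
  have hle := H N (s.indicator fun _ => (N : ℝ)) (measurable_const.indicator hs) fun x => by
    by_cases hx : x ∈ s <;> simp [hx]
  have hzero : ∫ x, (Real.exp (s.indicator (fun _ => (N : ℝ)) x) - 1) ∂ν = 0 := by
    refine integral_eq_zero_of_ae ?_
    filter_upwards [measure_eq_zero_iff_ae_notMem.1 hνs] with x hx
    simp [hx]
  rw [hzero, integral_indicator_const _ hs, smul_eq_mul] at hle
  rw [div_lt_iff₀ hpos] at hN
  linarith

variable [IsProbabilityMeasure ν]

lemma integral_le_klDiv_add (hkl : InformationTheory.klDiv μ ν ≠ ∞) {h : α → ℝ}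
    (hμ : Integrable h μ) (hν : Integrable (fun x => Real.exp (h x)) ν) :
    ∫ x, h x ∂μ ≤ (InformationTheory.klDiv μ ν).toReal + ∫ x, (Real.exp (h x) - 1) ∂ν := by
  obtain ⟨hac, hllr⟩ := InformationTheory.klDiv_ne_top_iff.1 hkl
  have hkl := (InformationTheory.integrable_klFun_rnDeriv_iff hac).2 hllr
  have hexp : Integrable (fun x => Real.exp (h x) - 1) ν := hν.sub (integrable_const _)
  rw [InformationTheory.toReal_klDiv_eq_integral_klFun hac, ← integral_add hkl hexp,
    ← integral_rnDeriv_smul hac]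
  exact integral_mono ((integrable_rnDeriv_smul_iff hac).2 hμ) (hkl.add hexp)
    fun x => mul_le_klFun_add_exp ENNReal.toReal_nonneg (h x)

lemma integrable_exp_of_abs_le {ρ : Measure α} [IsFiniteMeasure ρ] {h : α → ℝ} {N : ℝ}
    (hm : Measurable h) (hN : ∀ x, |h x| ≤ N) : Integrable (fun x => Real.exp (h x)) ρ :=
  .of_bound hm.exp.aestronglyMeasurable (Real.exp N) (.of_forall fun x => by
    rw [Real.norm_of_nonneg (Real.exp_nonneg _)]
    exact Real.exp_le_exp.2 (le_of_abs_le (hN x)))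

lemma lintegral_logTrunc_rnDeriv_le
    (H : ∀ (N : ℕ) (h : α → ℝ), Measurable h → (∀ x, |h x| ≤ N) →
      ∫ x, h x ∂μ ≤ C + ∫ x, (Real.exp (h x) - 1) ∂ν) (N : ℕ) :
    ∫⁻ x, ENNReal.ofReal ((μ.rnDeriv ν x).toReal * logTrunc N (μ.rnDeriv ν x).toReal -
      (Real.exp (logTrunc N (μ.rnDeriv ν x).toReal) - 1)) ∂ν ≤ ENNReal.ofReal C := by
  have hac := absolutelyContinuous_of_forall_integral_le H
  set h : α → ℝ := fun x => logTrunc N (μ.rnDeriv ν x).toReal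
  have hm : Measurable h :=
    (measurable_logTrunc N).comp (Measure.measurable_rnDeriv μ ν).ennreal_toReal
  have hN (x : α) : |h x| ≤ N := abs_logTrunc_le N _
  have hmul : Integrable (fun x => (μ.rnDeriv ν x).toReal * h x) ν :=
    (integrable_rnDeriv_smul_iff hac).2 (.of_bound hm.aestronglyMeasurable N (.of_forall hN))
  have hexp : Integrable (fun x => Real.exp (h x) - 1) ν :=
    (integrable_exp_of_abs_le hm hN).sub (integrable_const _)
  have hchange : ∫ x, (μ.rnDeriv ν x).toReal * h x ∂ν = ∫ x, h x ∂μ := integral_rnDeriv_smul hac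
  calc ∫⁻ x, ENNReal.ofReal ((μ.rnDeriv ν x).toReal * h x - (Real.exp (h x) - 1)) ∂ν
      = ENNReal.ofReal (∫ x, ((μ.rnDeriv ν x).toReal * h x - (Real.exp (h x) - 1)) ∂ν) :=
        (ofReal_integral_eq_lintegral_ofReal (hmul.sub hexp)
          (.of_forall fun x => sub_nonneg.2 (exp_logTrunc_sub_one_le N _))).symm
    _ ≤ ENNReal.ofReal C := by
        rw [integral_sub hmul hexp, hchange]
        exact ENNReal.ofReal_le_ofReal (by linarith [H N h hm hN])

lemma klDiv_le_of_forall_measurable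
    (H : ∀ (N : ℕ) (h : α → ℝ), Measurable h → (∀ x, |h x| ≤ N) →
      ∫ x, h x ∂μ ≤ C + ∫ x, (Real.exp (h x) - 1) ∂ν) :
    InformationTheory.klDiv μ ν ≤ ENNReal.ofReal C := by
  have hr : Measurable fun x => (μ.rnDeriv ν x).toReal :=
    (Measure.measurable_rnDeriv μ ν).ennreal_toReal
  have hlog (N : ℕ) := (measurable_logTrunc N).comp hr
  rw [InformationTheory.klDiv_eq_lintegral_klFun_of_ac
    (absolutelyContinuous_of_forall_integral_le H)]
  calc ∫⁻ x, ENNReal.ofReal (InformationTheory.klFun (μ.rnDeriv ν x).toReal) ∂ν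
      = ∫⁻ x, liminf (fun N : ℕ => ENNReal.ofReal ((μ.rnDeriv ν x).toReal *
          logTrunc N (μ.rnDeriv ν x).toReal -
            (Real.exp (logTrunc N (μ.rnDeriv ν x).toReal) - 1))) atTop ∂ν :=
        lintegral_congr fun x => (ENNReal.tendsto_ofReal
          (tendsto_mul_logTrunc_sub ENNReal.toReal_nonneg)).liminf_eq.symm
    _ ≤ liminf (fun N : ℕ => ∫⁻ x, ENNReal.ofReal ((μ.rnDeriv ν x).toReal *
          logTrunc N (μ.rnDeriv ν x).toReal -
            (Real.exp (logTrunc N (μ.rnDeriv ν x).toReal) - 1)) ∂ν) atTop :=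
        lintegral_liminf_le fun N =>
          ((hr.mul (hlog N)).sub ((hlog N).exp.sub_const 1)).ennreal_ofReal
    _ ≤ ENNReal.ofReal C :=
        liminf_le_of_frequently_le' (.of_forall (lintegral_logTrunc_rnDeriv_le H))

end Variational

section BoundedContinuous

open scoped BoundedContinuousFunction

variable {E : Type*} [TopologicalSpace E] [NormalSpace E] [MeasurableSpace E] [BorelSpace E]

lemma exists_seq_boundedContinuous_tendsto_ae {ρ : Measure E} [IsFiniteMeasure ρ]
    [ρ.WeaklyRegular] {h : E → ℝ} {N : ℝ} (hm : Measurable h) (hN : ∀ x, |h x| ≤ N) :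
    ∃ k : ℕ → E →ᵇ ℝ, (∀ n x, |k n x| ≤ N) ∧
      ∀ᵐ x ∂ρ, Tendsto (fun n => k n x) atTop (𝓝 (h x)) := by
  have hmem : MemLp h 1 ρ := .of_bound hm.aestronglyMeasurable N (.of_forall hN)
  choose g hg using fun n : ℕ => hmem.exists_boundedContinuous_eLpNorm_sub_le ENNReal.one_ne_top
    (ε := ((n : ℝ≥0∞) + 1)⁻¹) (by simp)
  have hmeasure : TendstoInMeasure ρ (fun n => g n) atTop h := by
    refine tendstoInMeasure_of_tendsto_eLpNorm one_ne_zero (fun n => (hg n).2.1)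
      hmem.1 (tendsto_of_tendsto_of_tendsto_of_le_of_le tendsto_const_nhds
        ENNReal.tendsto_inv_nat_nhds_zero (fun _ => zero_le) fun n => ?_)
    rw [eLpNorm_sub_comm]
    exact (hg n).1.trans (ENNReal.inv_le_inv.2 le_self_add)
  obtain ⟨ns, -, hns⟩ := hmeasure.exists_seq_tendsto_ae
  have hNN (x : E) : -N ≤ N := neg_le_self ((abs_nonneg _).trans (hN x))
  refine ⟨fun n => .const E (-N) ⊔ (.const E N ⊓ g (ns n)), fun n x =>
    abs_le.2 ⟨le_max_left _ _, max_le (hNN x) (min_le_left _ _)⟩, ?_⟩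
  filter_upwards [hns] with x hx
  have hclamp : max (-N) (min N (h x)) = h x := by
    rw [min_eq_right (abs_le.1 (hN x)).2, max_eq_right (abs_le.1 (hN x)).1]
  rw [← hclamp]
  exact tendsto_const_nhds.max (tendsto_const_nhds.min hx)

lemma klDiv_le_of_forall_boundedContinuous {μ ν : Measure E} [IsProbabilityMeasure μ]
    [IsProbabilityMeasure ν] [(μ + ν).WeaklyRegular] {C : ℝ}
    (H : ∀ h : E →ᵇ ℝ, ∫ x, h x ∂μ ≤ C + ∫ x, (Real.exp (h x) - 1) ∂ν) :
    InformationTheory.klDiv μ ν ≤ ENNReal.ofReal C := by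
  refine klDiv_le_of_forall_measurable fun N h hm hN => ?_
  obtain ⟨k, hkN, hk⟩ := exists_seq_boundedContinuous_tendsto_ae (ρ := μ + ν) hm hN
  rw [ae_add_measure_iff] at hk
  have hμ : Tendsto (fun n => ∫ x, k n x ∂μ) atTop (𝓝 (∫ x, h x ∂μ)) :=
    tendsto_integral_of_dominated_convergence (fun _ => (N : ℝ))
      (fun n => (k n).continuous.measurable.aestronglyMeasurable) (integrable_const _)
      (fun n => .of_forall (hkN n)) hk.1
  have hν : Tendsto (fun n => ∫ x, (Real.exp (k n x) - 1) ∂ν) atTop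
      (𝓝 (∫ x, (Real.exp (h x) - 1) ∂ν)) := by
    refine tendsto_integral_of_dominated_convergence (fun _ => Real.exp N + 1)
      (fun n => ((k n).continuous.rexp.sub continuous_const).measurable.aestronglyMeasurable)
      (integrable_const _) (fun n => .of_forall fun x => ?_)
      (hk.2.mono fun x hx => hx.rexp.sub_const 1)
    refine (norm_sub_le _ _).trans ?_
    rw [Real.norm_of_nonneg (Real.exp_nonneg _), norm_one]
    gcongr
    exact le_of_abs_le (hkN n x)
  exact le_of_tendsto_of_tendsto' hμ (hν.const_add C) fun n => H (k n)

end BoundedContinuous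

lemma klDiv_le_of_tendsto {ι E : Type*} [TopologicalSpace E] [NormalSpace E] [MeasurableSpace E]
    [BorelSpace E] {L : Filter ι} [L.NeBot] {μ ν : ι → ProbabilityMeasure E}
    {μ₀ ν₀ : ProbabilityMeasure E} [(μ₀ + ν₀ : Measure E).WeaklyRegular]
    (hμ : Tendsto μ L (𝓝 μ₀)) (hν : Tendsto ν L (𝓝 ν₀)) {K : ℝ≥0∞}
    (hK : ∀ᶠ i in L, InformationTheory.klDiv (μ i : Measure E) (ν i : Measure E) ≤ K) :
    InformationTheory.klDiv (μ₀ : Measure E) (ν₀ : Measure E) ≤ K := by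
  by_cases htop : K = ∞
  · exact htop ▸ le_top
  rw [← ENNReal.ofReal_toReal htop]
  refine klDiv_le_of_forall_boundedContinuous fun h => ?_
  have hbound (x : E) : |Real.exp (h x) - 1| ≤ Real.exp ‖h‖ + 1 := by
    refine (abs_sub _ _).trans ?_
    rw [abs_of_pos (Real.exp_pos _), abs_one]
    gcongr
    exact (le_abs_self _).trans (h.norm_coe_le_norm x)
  let hexp : BoundedContinuousFunction E ℝ := .ofNormedAddCommGroup (fun x => Real.exp (h x) - 1)
    (by fun_prop) (Real.exp ‖h‖ + 1) hbound
  have hμh := ProbabilityMeasure.tendsto_iff_forall_integral_tendsto.1 hμ h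
  have hνh := ProbabilityMeasure.tendsto_iff_forall_integral_tendsto.1 hν hexp
  refine le_of_tendsto_of_tendsto hμh (hνh.const_add K.toReal) (hK.mono fun i hi => ?_)
  have hne := ne_top_of_le_ne_top htop hi
  refine (integral_le_klDiv_add hne (h.integrable _)
    (integrable_exp_of_abs_le h.continuous.measurable h.norm_coe_le_norm)).trans ?_
  exact add_le_add (ENNReal.toReal_mono htop hi) le_rfl

/-! ### Relative entropy and Fisher information along the heat flow -/

/-- The measure `μ ∗ gaussianReal 0 a` as a point of the space of probability measures, used to
speak of weak convergence. -/
def convGaussian (μ : Measure ℝ) [IsProbabilityMeasure μ] (a : ℝ≥0) : ProbabilityMeasure ℝ :=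
  ⟨μ ∗ gaussianReal 0 a, inferInstance⟩

lemma charFun_gaussianReal_zero (v : ℝ≥0) (s : ℝ) :
    charFun (gaussianReal 0 v) s = Complex.exp (-(v * s ^ 2 / 2)) := by
  simp [charFun_gaussianReal]

lemma continuous_convGaussian (μ : Measure ℝ) [IsProbabilityMeasure μ] :
    Continuous (convGaussian μ) := by
  refine continuous_iff_seqContinuous.2 fun a v ha =>
    ProbabilityMeasure.tendsto_iff_tendsto_charFun.2 fun s => ?_
  have hcont : Continuous fun v : ℝ≥0 => charFun (μ ∗ gaussianReal 0 v) s := by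
    simp only [charFun_conv, charFun_gaussianReal_zero]
    fun_prop
  exact (hcont.tendsto v).comp ha

lemma klDiv_gaussianReal_le (μ : Measure ℝ) [IsProbabilityMeasure μ] (hμ : MemLp id 2 μ) {s : ℝ≥0}
    (hs : ∫ x, x ^ 2 ∂μ = s) :
    InformationTheory.klDiv μ (gaussianReal 0 s) ≤
      (∫⁻ t in Set.Ioi 0, excessFisherInfo μ t) / 2 := by
  have hμ₀ : (convGaussian μ 0 : Measure ℝ) = μ := by simp [convGaussian]
  have hγ₀ : (convGaussian (gaussianReal 0 s) 0 : Measure ℝ) = gaussianReal 0 s := by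
    simp [convGaussian]
  suffices InformationTheory.klDiv (convGaussian μ 0 : Measure ℝ)
      (convGaussian (gaussianReal 0 s) 0 : Measure ℝ) ≤
        (∫⁻ t in Set.Ioi 0, excessFisherInfo μ t) / 2 by rwa [hμ₀, hγ₀] at this
  refine klDiv_le_of_tendsto (L := 𝓝[>] 0) (((continuous_convGaussian μ).tendsto 0).mono_left
    nhdsWithin_le_nhds) (((continuous_convGaussian _).tendsto 0).mono_left nhdsWithin_le_nhds) ?_
  filter_upwards [self_mem_nhdsWithin] with a ha
  simpa only [convGaussian, ProbabilityMeasure.coe_mk, gaussianReal_conv_gaussianReal, add_zero]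
    using klDiv_conv_gaussianReal_le μ hμ hs ha.ne'

section FisherConvergence

lemma flowFisherInfo_nonneg (μ : Measure ℝ) (t : ℝ) : 0 ≤ flowFisherInfo μ t :=
  integral_nonneg fun x => div_nonneg (sq_nonneg _) (heatFlow_nonneg μ t x)

lemma flowFisherInfo_dirac {t : ℝ} (ht : 0 < t) : flowFisherInfo (Measure.dirac 0) t = 1 / t := by
  have hpoint (x : ℝ) : heatFlowDeriv (Measure.dirac 0) t x ^ 2 / heatFlow (Measure.dirac 0) t x =
      heatFlowDeriv₂ (Measure.dirac 0) t x + heatFlow (Measure.dirac 0) t x / t := by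
    have := (heatKernel_pos ht x).ne'
    simp only [heatFlow, heatFlowDeriv, heatFlowDeriv₂, smoothing, integral_dirac, sub_zero,
      heatKernelDeriv, heatKernelDeriv₂]
    field_simp
    ring
  simp_rw [flowFisherInfo, hpoint]
  rw [integral_add (integrable_heatFlowDeriv₂ _ ht) ((integrable_heatFlow _ ht).div_const t),
    integral_heatFlowDeriv₂ _ ht, integral_div, integral_heatFlow _ ht, zero_add]

lemma flowFisherInfo_gaussianReal (v : ℝ≥0) {t : ℝ} (ht : 0 < t) :
    flowFisherInfo (gaussianReal 0 v) t = 1 / (v + t) := by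
  have hvt : (0 : ℝ) < v + t := by positivity
  have hflow := fisherInfo_conv_gaussianReal (gaussianReal 0 v) (t := t.toNNReal)
    (by simpa using ht)
  have hkernel := fisherInfo_conv_gaussianReal (Measure.dirac (0 : ℝ)) (t := v + t.toNNReal)
    (by simp [ht])
  rw [gaussianReal_conv_gaussianReal, Real.coe_toNNReal _ ht.le, add_zero] at hflow
  rw [Measure.dirac_zero_conv, NNReal.coe_add, Real.coe_toNNReal _ ht.le,
    flowFisherInfo_dirac hvt, hflow] at hkernel
  exact (ENNReal.ofReal_eq_ofReal_iff (flowFisherInfo_nonneg _ _) (by positivity)).1 hkernel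

variable {ι : Type*} {L : Filter ι} {ν : ι → ProbabilityMeasure ℝ} {ν₀ : ProbabilityMeasure ℝ}

lemma tendsto_smoothing (hν : Tendsto ν L (𝓝 ν₀)) {k : ℝ → ℝ} (hk : Continuous k) {C : ℝ}
    (hC : ∀ x, |k x| ≤ C) (x : ℝ) :
    Tendsto (fun i => smoothing k (ν i) x) L (𝓝 (smoothing k ν₀ x)) :=
  ProbabilityMeasure.tendsto_iff_forall_integral_tendsto.1 hν
    (.ofNormedAddCommGroup (fun y => k (x - y)) (by fun_prop) C fun y => hC (x - y))

/-- The gap in the pointwise bound `(∂ f)² / f ≤ ∂² f + f / t` for the heat flow `f`. It integrates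
to the amount by which the Fisher information of `μ ∗ N(0, t)` falls short of that of `N(0, t)`. -/
def fisherGap (μ : Measure ℝ) (t x : ℝ) : ℝ :=
  heatFlowDeriv₂ μ t x + heatFlow μ t x / t - heatFlowDeriv μ t x ^ 2 / heatFlow μ t x

variable (μ : Measure ℝ) [IsProbabilityMeasure μ] {t : ℝ}

lemma measurable_fisherGap (t : ℝ) : Measurable (fisherGap μ t) := by
  have h₀ : Measurable (heatFlow μ t) := (measurable_uncurry_heatFlow μ).of_uncurry_left
  have h₁ : Measurable (heatFlowDeriv μ t) := (measurable_uncurry_heatFlowDeriv μ).of_uncurry_left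
  have h₂ : Measurable (heatFlowDeriv₂ μ t) :=
    (measurable_uncurry_heatFlowDeriv₂ μ).of_uncurry_left
  exact (h₂.add (h₀.div_const t)).sub ((h₁.pow_const 2).div h₀)

lemma flowFisherInfo_le (ht : 0 < t) : flowFisherInfo μ t ≤ 1 / t := by
  have hupper : Integrable fun x => heatFlowDeriv₂ μ t x + heatFlow μ t x / t :=
    (integrable_heatFlowDeriv₂ μ ht).add ((integrable_heatFlow μ ht).div_const t)
  calc flowFisherInfo μ t ≤ ∫ x, (heatFlowDeriv₂ μ t x + heatFlow μ t x / t) :=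
        integral_mono (integrable_sq_heatFlowDeriv_div μ ht) hupper (sq_heatFlowDeriv_div_le μ ht)
    _ = 1 / t := by
        rw [integral_add (integrable_heatFlowDeriv₂ μ ht) ((integrable_heatFlow μ ht).div_const t),
          integral_heatFlowDeriv₂ μ ht, integral_div, integral_heatFlow μ ht, zero_add]

lemma lintegral_fisherGap (ht : 0 < t) :
    ∫⁻ x, ENNReal.ofReal (fisherGap μ t x) = ENNReal.ofReal (1 / t - flowFisherInfo μ t) := by
  have hupper : Integrable fun x => heatFlowDeriv₂ μ t x + heatFlow μ t x / t :=
    (integrable_heatFlowDeriv₂ μ ht).add ((integrable_heatFlow μ ht).div_const t)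
  have hfisher := integrable_sq_heatFlowDeriv_div μ ht
  have hgap : Integrable (fisherGap μ t) := hupper.sub hfisher
  rw [← ofReal_integral_eq_lintegral_ofReal hgap
    (.of_forall fun x => sub_nonneg.2 (sq_heatFlowDeriv_div_le μ ht x))]
  simp only [fisherGap]
  rw [integral_sub hupper hfisher, integral_add (integrable_heatFlowDeriv₂ μ ht)
    ((integrable_heatFlow μ ht).div_const t), integral_heatFlowDeriv₂ μ ht, integral_div,
    integral_heatFlow μ ht, zero_add, flowFisherInfo]

lemma tendsto_fisherGap (hν : Tendsto ν L (𝓝 ν₀)) (ht : 0 < t) (x : ℝ) :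
    Tendsto (fun i => fisherGap (ν i) t x) L (𝓝 (fisherGap ν₀ t x)) := by
  obtain ⟨C, hC⟩ := exists_heatKernel_bound_const ht le_rfl
  have hC := hC t (Set.left_mem_Icc.2 le_rfl)
  have h₀ := tendsto_smoothing hν (continuous_heatKernel t) (fun y => (hC y).1) x
  have h₁ := tendsto_smoothing hν (continuous_heatKernelDeriv t) (fun y => (hC y).2.1) x
  have h₂ := tendsto_smoothing hν (continuous_heatKernelDeriv₂ t) (fun y => (hC y).2.2) x
  exact (h₂.add (h₀.div_const t)).sub ((h₁.pow 2).div h₀ (heatFlow_pos ν₀ ht x).ne')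

lemma le_liminf_fisherGap [L.IsCountablyGenerated] (hν : Tendsto ν L (𝓝 ν₀)) (ht : 0 < t) :
    ENNReal.ofReal (1 / t - flowFisherInfo ν₀ t) ≤
      liminf (fun i => ENNReal.ofReal (1 / t - flowFisherInfo (ν i) t)) L := by
  simp_rw [← lintegral_fisherGap _ ht]
  calc ∫⁻ x, ENNReal.ofReal (fisherGap ν₀ t x)
      ≤ ∫⁻ x, liminf (fun i => ENNReal.ofReal (fisherGap (ν i) t x)) L := by
        refine lintegral_mono fun x => ?_
        rcases L.eq_or_neBot with rfl | _
        · simp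
        · exact (ENNReal.tendsto_ofReal (tendsto_fisherGap hν ht x)).liminf_eq.ge
    _ ≤ liminf (fun i => ∫⁻ x, ENNReal.ofReal (fisherGap (ν i) t x)) L :=
        lintegral_liminf_le fun i => (measurable_fisherGap (ν i) t).ennreal_ofReal

lemma tendsto_excessFisherInfo [L.IsCountablyGenerated] {v : ℝ≥0}
    (hν : Tendsto ν L (𝓝 (convGaussian (Measure.dirac 0) v)))
    (hv : Tendsto (fun i => ∫ x, x ^ 2 ∂(ν i : Measure ℝ)) L (𝓝 v)) (ht : 0 < t) :
    Tendsto (fun i => excessFisherInfo (ν i) t) L (𝓝 0) := by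
  have hgap := le_liminf_fisherGap hν ht
  simp only [convGaussian, ProbabilityMeasure.coe_mk, Measure.dirac_zero_conv,
    flowFisherInfo_gaussianReal v ht] at hgap
  have hinv : Tendsto (fun i => 1 / (∫ x, x ^ 2 ∂(ν i : Measure ℝ) + t)) L (𝓝 (1 / (v + t))) :=
    tendsto_const_nhds.div (hv.add_const t) (by positivity)
  refine ENNReal.tendsto_nhds_zero.2 fun ε hε => ?_
  rcases eq_or_ne ε ∞ with rfl | hεt
  · exact .of_forall fun i => le_top
  have hε0 := ENNReal.toReal_pos hε.ne' hεt
  have hlower : ∀ᶠ i in L,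
      1 / t - 1 / (v + t) - ε.toReal / 2 < 1 / t - flowFisherInfo (ν i) t := by
    rcases lt_or_ge (1 / t - 1 / (v + t) - ε.toReal / 2) 0 with hneg | hnn
    · exact .of_forall fun i => hneg.trans_le (sub_nonneg.2 (flowFisherInfo_le (ν i) ht))
    · have hlt := (ENNReal.ofReal_lt_ofReal_iff_of_nonneg hnn).2
        (show 1 / t - 1 / (v + t) - ε.toReal / 2 < 1 / t - 1 / (v + t) by linarith)
      filter_upwards [eventually_lt_of_lt_liminf (hlt.trans_le hgap)] with i hi
      exact (ENNReal.ofReal_lt_ofReal_iff_of_nonneg hnn).1 hi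
  filter_upwards [hlower, hinv.eventually (lt_mem_nhds
    (show 1 / (v + t) - ε.toReal / 2 < 1 / (v + t) by linarith))] with i hi hi'
  exact ENNReal.ofReal_le_of_le_toReal (by linarith)

end FisherConvergence

/-! ### Newman's inequality -/

section Newman

variable {Ω : Type*} [MeasurableSpace Ω] {P : Measure Ω} {S T : Ω → ℝ}

/-- `S` and `T` are positively quadrant dependent (in the sense of Lehmann): square integrable
increasing functions of `S` and of `T` are nonnegatively correlated. -/
def PosQuadrantDependent (S T : Ω → ℝ) (P : Measure Ω) : Prop :=
  ∀ p q : ℝ → ℝ, Monotone p → Monotone q → MemLp (fun ω => p (S ω)) 2 P →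
    MemLp (fun ω => q (T ω)) 2 P → 0 ≤ cov[fun ω => p (S ω), fun ω => q (T ω); P]

lemma monotone_mul_add_of_lipschitzWith {K : ℝ≥0} {f : ℝ → ℝ} (hf : LipschitzWith K f) :
    Monotone fun x => K * x + f x := fun x y hxy => by
  have := hf.dist_le_mul x y
  rw [Real.dist_eq, Real.dist_eq, abs_sub_comm x, abs_of_nonneg (sub_nonneg.2 hxy)] at this
  linarith [le_abs_self (f x - f y)]

lemma monotone_mul_sub_of_lipschitzWith {K : ℝ≥0} {f : ℝ → ℝ} (hf : LipschitzWith K f) :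
    Monotone fun x => K * x - f x := by
  simpa only [sub_eq_add_neg, Pi.neg_apply] using monotone_mul_add_of_lipschitzWith hf.neg

lemma lipschitzWith_cos_mul (r : ℝ) : LipschitzWith ‖r‖₊ fun x => Real.cos (r * x) :=
  .of_dist_le_mul fun x y => by
    simpa [Real.dist_eq, ← abs_mul, mul_sub] using Real.abs_cos_sub_cos_le (r * x) (r * y)

lemma lipschitzWith_sin_mul (r : ℝ) : LipschitzWith ‖r‖₊ fun x => Real.sin (r * x) :=
  .of_dist_le_mul fun x y => by
    simpa [Real.dist_eq, ← abs_mul, mul_sub] using Real.abs_sin_sub_sin_le (r * x) (r * y)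

section FiniteMeasure

variable [IsFiniteMeasure P]

lemma memLp_comp_of_lipschitzWith {K : ℝ≥0} {f : ℝ → ℝ} (hf : LipschitzWith K f)
    (hS : MemLp S 2 P) : MemLp (fun ω => f (S ω)) 2 P := by
  have hsub : MemLp (fun ω => f (S ω) - f 0) 2 P :=
    (hS.const_mul K).mono (by have := hf.continuous; have := hS.1; fun_prop)
      (.of_forall fun ω => by simpa [Real.dist_eq] using hf.dist_le_mul (S ω) 0)
  simpa [Pi.add_def] using hsub.add (memLp_const (f 0))

lemma abs_covariance_le_covariance {A B F G : Ω → ℝ} (hA : MemLp A 2 P) (hB : MemLp B 2 P)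
    (hF : MemLp F 2 P) (hG : MemLp G 2 P) (hpp : 0 ≤ cov[A + F, B + G; P])
    (hpm : 0 ≤ cov[A + F, B - G; P]) (hmp : 0 ≤ cov[A - F, B + G; P])
    (hmm : 0 ≤ cov[A - F, B - G; P]) : |cov[F, G; P]| ≤ cov[A, B; P] := by
  rw [covariance_add_left hA hF (hB.add hG), covariance_add_right hA hB hG,
    covariance_add_right hF hB hG] at hpp
  rw [covariance_add_left hA hF (hB.sub hG), covariance_sub_right hA hB hG,
    covariance_sub_right hF hB hG] at hpm
  rw [covariance_sub_left hA hF (hB.add hG), covariance_add_right hA hB hG,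
    covariance_add_right hF hB hG] at hmp
  rw [covariance_sub_left hA hF (hB.sub hG), covariance_sub_right hA hB hG,
    covariance_sub_right hF hB hG] at hmm
  rw [abs_le]
  constructor <;> linarith

lemma PosQuadrantDependent.abs_cov_lipschitz_le (h : PosQuadrantDependent S T P)
    (hS : MemLp S 2 P) (hT : MemLp T 2 P) {K K' : ℝ≥0} {f g : ℝ → ℝ} (hf : LipschitzWith K f)
    (hg : LipschitzWith K' g) :
    |cov[fun ω => f (S ω), fun ω => g (T ω); P]| ≤ K * K' * cov[S, T; P] := by
  have hKS : MemLp (fun ω => K * S ω) 2 P := hS.const_mul _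
  have hKT : MemLp (fun ω => K' * T ω) 2 P := hT.const_mul _
  have hfS := memLp_comp_of_lipschitzWith hf hS
  have hgT := memLp_comp_of_lipschitzWith hg hT
  -- `K x ± f x` and `K' x ± g x` are increasing.
  have hf₁ := monotone_mul_add_of_lipschitzWith hf
  have hf₂ := monotone_mul_sub_of_lipschitzWith hf
  have hg₁ := monotone_mul_add_of_lipschitzWith hg
  have hg₂ := monotone_mul_sub_of_lipschitzWith hg
  calc |cov[fun ω => f (S ω), fun ω => g (T ω); P]|
      ≤ cov[fun ω => K * S ω, fun ω => K' * T ω; P] :=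
        abs_covariance_le_covariance hKS hKT hfS hgT
          (h _ _ hf₁ hg₁ (hKS.add hfS) (hKT.add hgT)) (h _ _ hf₁ hg₂ (hKS.add hfS) (hKT.sub hgT))
          (h _ _ hf₂ hg₁ (hKS.sub hfS) (hKT.add hgT)) (h _ _ hf₂ hg₂ (hKS.sub hfS) (hKT.sub hgT))
    _ = K * K' * cov[S, T; P] := by
        rw [covariance_const_mul_left, covariance_const_mul_right, mul_assoc]

end FiniteMeasure

variable [IsProbabilityMeasure P]

lemma charFun_map_eq_cos_add_sin (hS : AEMeasurable S P) (r : ℝ) :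
    charFun (P.map S) r = (∫ ω, Real.cos (r * S ω) ∂P : ℝ) +
      (∫ ω, Real.sin (r * S ω) ∂P : ℝ) * Complex.I := by
  have hcos : Integrable (fun ω => Real.cos (r * S ω)) P :=
    .of_bound (by fun_prop) 1 (.of_forall fun ω => Real.abs_cos_le_one _)
  have hsin : Integrable (fun ω => Real.sin (r * S ω)) P :=
    .of_bound (by fun_prop) 1 (.of_forall fun ω => Real.abs_sin_le_one _)
  rw [charFun_apply_real, integral_map hS (by fun_prop), ← integral_complex_ofReal,
    ← integral_complex_ofReal, ← integral_mul_const,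
    ← integral_add hcos.ofReal (hsin.ofReal.mul_const _)]
  refine integral_congr_ae (.of_forall fun ω => ?_)
  simp only [Complex.exp_mul_I, Complex.ofReal_cos, Complex.ofReal_sin, Complex.ofReal_mul]

lemma charFun_map_add_sub_mul (hS : AEMeasurable S P) (hT : AEMeasurable T P) (r : ℝ) :
    charFun (P.map (S + T)) r - charFun (P.map S) r * charFun (P.map T) r =
      ((cov[fun ω => Real.cos (r * S ω), fun ω => Real.cos (r * T ω); P] -
        cov[fun ω => Real.sin (r * S ω), fun ω => Real.sin (r * T ω); P] : ℝ) : ℂ) +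
      ((cov[fun ω => Real.sin (r * S ω), fun ω => Real.cos (r * T ω); P] +
        cov[fun ω => Real.cos (r * S ω), fun ω => Real.sin (r * T ω); P] : ℝ) : ℂ) *
          Complex.I := by
  have hcos {Y : Ω → ℝ} (hY : AEMeasurable Y P) : MemLp (fun ω => Real.cos (r * Y ω)) 2 P :=
    .of_bound (by fun_prop) 1 (.of_forall fun ω => Real.abs_cos_le_one _)
  have hsin {Y : Ω → ℝ} (hY : AEMeasurable Y P) : MemLp (fun ω => Real.sin (r * Y ω)) 2 P :=
    .of_bound (by fun_prop) 1 (.of_forall fun ω => Real.abs_sin_le_one _)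
  rw [charFun_map_eq_cos_add_sin (hS.add hT), charFun_map_eq_cos_add_sin hS,
    charFun_map_eq_cos_add_sin hT, covariance_eq_sub (hcos hS) (hcos hT),
    covariance_eq_sub (hsin hS) (hsin hT), covariance_eq_sub (hsin hS) (hcos hT),
    covariance_eq_sub (hcos hS) (hsin hT)]
  simp only [Pi.add_apply, Pi.mul_apply, mul_add, Real.cos_add, Real.sin_add]
  have hcc : Integrable (fun ω => Real.cos (r * S ω) * Real.cos (r * T ω)) P :=
    (hcos hS).integrable_mul (hcos hT)
  have hss : Integrable (fun ω => Real.sin (r * S ω) * Real.sin (r * T ω)) P :=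
    (hsin hS).integrable_mul (hsin hT)
  have hsc : Integrable (fun ω => Real.sin (r * S ω) * Real.cos (r * T ω)) P :=
    (hsin hS).integrable_mul (hcos hT)
  have hcs : Integrable (fun ω => Real.cos (r * S ω) * Real.sin (r * T ω)) P :=
    (hcos hS).integrable_mul (hsin hT)
  rw [integral_sub hcc hss, integral_add hsc hcs]
  linear_combination (norm := (push_cast; ring_nf))
    (-(∫ ω, Real.sin (r * S ω) ∂P : ℝ) * (∫ ω, Real.sin (r * T ω) ∂P : ℝ) : ℂ) * Complex.I_sq

lemma PosQuadrantDependent.norm_charFun_add_sub_mul_le (h : PosQuadrantDependent S T P)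
    (hS : MemLp S 2 P) (hT : MemLp T 2 P) (r : ℝ) :
    ‖charFun (P.map (S + T)) r - charFun (P.map S) r * charFun (P.map T) r‖ ≤
      4 * r ^ 2 * cov[S, T; P] := by
  have hcos := lipschitzWith_cos_mul r
  have hsin := lipschitzWith_sin_mul r
  have hcc := h.abs_cov_lipschitz_le hS hT hcos hcos
  have hss := h.abs_cov_lipschitz_le hS hT hsin hsin
  have hsc := h.abs_cov_lipschitz_le hS hT hsin hcos
  have hcs := h.abs_cov_lipschitz_le hS hT hcos hsin
  rw [coe_nnnorm, Real.norm_eq_abs, abs_mul_abs_self, ← sq] at hcc hss hsc hcs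
  rw [charFun_map_add_sub_mul hS.1.aemeasurable hT.1.aemeasurable]
  refine (norm_add_le _ _).trans ?_
  rw [norm_mul, Complex.norm_I, mul_one, Complex.norm_real, Complex.norm_real, Real.norm_eq_abs,
    Real.norm_eq_abs]
  linarith [(abs_sub _ _).trans (add_le_add hcc hss), (abs_add_le _ _).trans (add_le_add hsc hcs)]

end Newman

lemma IsFKG.posQuadrantDependent_sum {Ω ι : Type*} [MeasurableSpace Ω] {P : Measure Ω}
    {X : ι → Ω → ℝ} (hX : IsFKG X P) (A B : Finset ι) :
    PosQuadrantDependent (fun ω => ∑ y ∈ A, X y ω) (fun ω => ∑ y ∈ B, X y ω) P := by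
  classical
  intro p q hp hq hpL hqL
  set s := A ∪ B
  have hsum {D : Finset ι} (hD : D ⊆ s) (ω : Ω) :
      ∑ i : s, (if (i : ι) ∈ D then X i ω else 0) = ∑ y ∈ D, X y ω := by
    rw [Finset.sum_coe_sort s fun i => if i ∈ D then X i ω else 0, Finset.sum_ite_mem,
      Finset.inter_eq_right.2 hD]
  have hmono (D : Finset ι) :
      Monotone fun x : s → ℝ => ∑ i : s, (if (i : ι) ∈ D then x i else 0) := fun x y hxy =>
    Finset.sum_le_sum fun i _ => by
      split_ifs
      exacts [hxy i, le_rfl]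
  have hmeas (D : Finset ι) :
      Measurable fun x : s → ℝ => ∑ i : s, (if (i : ι) ∈ D then x i else 0) :=
    Finset.measurable_sum _ fun i _ => by split_ifs <;> fun_prop
  have hcov := hX s _ _ (hp.comp (hmono A)) (hq.comp (hmono B)) (hp.measurable.comp (hmeas A))
    (hq.measurable.comp (hmeas B))
  simp only [Function.comp_def, hsum Finset.subset_union_left, hsum Finset.subset_union_right]
    at hcov
  exact hcov hpL hqL

/-! ### Box sums of a stationary FKG field -/

section Boxes

variable {d : ℕ}

/-- The box `∏ᵢ {1, …, nᵢ}`; unlike those of `box`, its sides may be empty. -/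
def natBox (n : Fin d → ℕ) : Finset (Fin d → ℤ) := Finset.Icc (fun _ => 1) fun i => (n i : ℤ)

lemma mem_natBox {n : Fin d → ℕ} {y : Fin d → ℤ} :
    y ∈ natBox n ↔ ∀ k, 1 ≤ y k ∧ y k ≤ n k := by
  simp only [natBox, Finset.mem_Icc, Pi.le_def, forall_and]

lemma mem_natBox_update {n : Fin d → ℕ} {i : Fin d} {c : ℕ} {y : Fin d → ℤ} :
    y ∈ natBox (Function.update n i c) ↔
      (1 ≤ y i ∧ y i ≤ c) ∧ ∀ k ≠ i, 1 ≤ y k ∧ y k ≤ n k := by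
  simp only [mem_natBox, Function.update_apply]
  grind

lemma sum_natBox_update_add {M : Type*} [AddCommMonoid M] (f : (Fin d → ℤ) → M) (n : Fin d → ℕ)
    (i : Fin d) (a b : ℕ) :
    ∑ y ∈ natBox (Function.update n i (a + b)), f y =
      ∑ y ∈ natBox (Function.update n i a), f y +
        ∑ y ∈ natBox (Function.update n i b), f (y + Pi.single i (a : ℤ)) := by
  rw [← Finset.sum_filter_add_sum_filter_not _ fun y => y i ≤ (a : ℤ)]
  congr 1
  · refine Finset.sum_congr (Finset.ext fun y => ?_) fun _ _ => rfl
    simp only [Finset.mem_filter, mem_natBox_update]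
    grind
  · refine Finset.sum_nbij' (· - Pi.single i (a : ℤ)) (· + Pi.single i (a : ℤ))
      (fun y hy => ?_) (fun y hy => ?_) (by simp) (by simp) (by simp) <;>
    simp only [Finset.mem_filter, mem_natBox_update, Pi.sub_apply, Pi.add_apply,
      Pi.single_apply] at hy ⊢ <;>
    grind

/-- The number of `y` such that `y` and `y + h` are both in the box `natBox n`. -/
def overlap (n : Fin d → ℕ) (h : Fin d → ℤ) : ℕ := ∏ k, (n k - (h k).natAbs)

lemma card_filter_add_mem_natBox (n : Fin d → ℕ) (h : Fin d → ℤ) :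
    ((natBox n).filter fun y => y + h ∈ natBox n).card = overlap n h := by
  have hIcc : (natBox n).filter (fun y => y + h ∈ natBox n) =
      Finset.Icc (fun k => max 1 (1 - h k)) (fun k => min (n k : ℤ) (n k - h k)) := by
    ext y
    simp only [Finset.mem_filter, mem_natBox, Finset.mem_Icc, Pi.le_def, Pi.add_apply,
      ← forall_and]
    refine forall_congr' fun k => ?_
    omega
  rw [hIcc, Pi.card_Icc, overlap]
  refine Finset.prod_congr rfl fun k _ => ?_
  rw [Int.card_Icc]
  omega

lemma overlap_zero (n : Fin d → ℕ) : overlap n 0 = ∏ k, n k := by simp [overlap]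

lemma overlap_le (n : Fin d → ℕ) (h : Fin d → ℤ) : overlap n h ≤ ∏ k, n k :=
  Finset.prod_le_prod' fun _ _ => Nat.sub_le _ _

lemma overlap_update (n : Fin d → ℕ) (i : Fin d) (c : ℕ) (h : Fin d → ℤ) :
    overlap (Function.update n i c) h =
      (c - (h i).natAbs) * ∏ k ∈ Finset.univ \ {i}, (n k - (h k).natAbs) := by
  simp only [overlap, Function.apply_update fun k m => m - (h k).natAbs]
  exact Finset.prod_update_of_mem (Finset.mem_univ i) _ _

lemma abs_sub_sub_mul_div_sub_le (m b : ℕ) {M : ℕ} (hM : 0 < M) :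
    |((m - b : ℕ) : ℝ) - M * ((m / M - b : ℕ) : ℝ)| ≤ M * (1 + b) := by
  have hlow : M * (m / M - b) ≤ (m - b) + M * (1 + b) :=
    calc M * (m / M - b) ≤ M * (m / M) := Nat.mul_le_mul_left _ (Nat.sub_le _ _)
      _ ≤ m := Nat.mul_div_le _ _
      _ ≤ (m - b) + 1 * (1 + b) := by omega
      _ ≤ (m - b) + M * (1 + b) := by gcongr; exact hM
  have hupp : m - b ≤ M * (m / M - b) + M * (1 + b) :=
    calc m - b ≤ m := Nat.sub_le _ _
      _ ≤ M * (m / M + 1) := (Nat.lt_mul_div_succ m hM).le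
      _ ≤ M * ((m / M - b) + (1 + b)) := Nat.mul_le_mul_left _ (by omega)
      _ = M * (m / M - b) + M * (1 + b) := mul_add _ _ _
  rify at hlow hupp
  rw [abs_le]
  constructor <;> linarith

lemma abs_overlap_sub_le (n : Fin d → ℕ) (i : Fin d) (h : Fin d → ℤ) {M : ℕ} (hM : 0 < M) :
    |(overlap n h : ℝ) - M * overlap (Function.update n i (n i / M)) h| * n i ≤
      M * (1 + (h i).natAbs) * ∏ k, (n k : ℝ) := by
  have hn := overlap_update n i (n i) h
  have hvol := Finset.prod_update_of_mem (Finset.mem_univ i) n (n i)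
  rw [Function.update_eq_self] at hn hvol
  set w := ∏ k ∈ Finset.univ \ {i}, (n k - (h k).natAbs) with hw_def
  have hw : (w : ℝ) ≤ ∏ k ∈ Finset.univ \ {i}, (n k : ℝ) := by
    exact_mod_cast Finset.prod_le_prod' fun k _ => Nat.sub_le (n k) (h k).natAbs
  have hvol' : ∏ k, (n k : ℝ) = n i * ∏ k ∈ Finset.univ \ {i}, (n k : ℝ) := by
    exact_mod_cast hvol
  calc |(overlap n h : ℝ) - M * overlap (Function.update n i (n i / M)) h| * n i
      = |((n i - (h i).natAbs : ℕ) : ℝ) - M * ((n i / M - (h i).natAbs : ℕ) : ℝ)| * w * n i := by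
        rw [hn, overlap_update, ← hw_def, Nat.cast_mul, Nat.cast_mul, ← mul_assoc, ← sub_mul,
          abs_mul, Nat.abs_cast]
    _ ≤ M * (1 + (h i).natAbs) * (∏ k ∈ Finset.univ \ {i}, (n k : ℝ)) * n i := by
        gcongr
        exact abs_sub_sub_mul_div_sub_le _ _ hM
    _ = M * (1 + (h i).natAbs) * ∏ k, (n k : ℝ) := by rw [hvol']; ring

lemma mul_overlap_update_div_le (n : Fin d → ℕ) (i : Fin d) (h : Fin d → ℤ) (M : ℕ) :
    M * overlap (Function.update n i (n i / M)) h ≤ ∏ k, n k := by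
  have hvol := Finset.prod_update_of_mem (Finset.mem_univ i) n (n i)
  rw [Function.update_eq_self] at hvol
  refine (Nat.mul_le_mul_left M (overlap_le _ h)).trans ?_
  rw [Finset.prod_update_of_mem (Finset.mem_univ i), hvol, ← mul_assoc]
  exact Nat.mul_le_mul_right _ (Nat.mul_div_le _ _)

end Boxes

/-- A centred stationary square integrable field with the FKG property and finite
susceptibility. -/
structure IsFKGField {Ω : Type*} [MeasurableSpace Ω] {d : ℕ} (X : (Fin d → ℤ) → Ω → ℝ)
    (P : Measure Ω) : Prop where
  meas : ∀ y, Measurable (X y)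
  memLp : ∀ y, MemLp (X y) 2 P
  mean : ∀ y, ∫ ω, X y ω ∂P = 0
  stat : IsStationary X P
  fkg : IsFKG X P
  susc : Summable fun y : Fin d → ℤ => cov[X 0, X y; P]

/-- The sum of the field over `natBox n`. -/
def boxSum {Ω : Type*} {d : ℕ} (X : (Fin d → ℤ) → Ω → ℝ) (n : Fin d → ℕ) (ω : Ω) : ℝ :=
  ∑ y ∈ natBox n, X y ω

/-- The susceptibility: the sum of all covariances `Cov(X₀, X_h)`. -/
def susceptibility {Ω : Type*} [MeasurableSpace Ω] {d : ℕ} (X : (Fin d → ℤ) → Ω → ℝ)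
    (P : Measure Ω) : ℝ := ∑' h, cov[X 0, X h; P]

namespace IsFKGField

variable {Ω : Type*} [MeasurableSpace Ω] {P : Measure Ω} {d : ℕ} {X : (Fin d → ℤ) → Ω → ℝ}

lemma identDistrib_comp_shift (hX : IsFKGField X P) (h : Fin d → ℤ)
    {g : ((Fin d → ℤ) → ℝ) → ℝ} (hg : Measurable g) :
    IdentDistrib (fun ω => g fun y => X (y + h) ω) (fun ω => g fun y => X y ω) P P :=
  (IdentDistrib.mk (measurable_pi_lambda _ fun _ => hX.meas _).aemeasurable
    (measurable_pi_lambda _ fun _ => hX.meas _).aemeasurable (hX.stat h)).comp hg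

lemma measurable_boxSum (hX : IsFKGField X P) (n : Fin d → ℕ) : Measurable (boxSum X n) :=
  Finset.measurable_sum _ fun y _ => hX.meas y

lemma memLp_boxSum (hX : IsFKGField X P) (n : Fin d → ℕ) : MemLp (boxSum X n) 2 P :=
  memLp_finsetSum _ fun y _ => hX.memLp y

lemma cov_nonneg (hX : IsFKGField X P) (y z : Fin d → ℤ) : 0 ≤ cov[X y, X z; P] := by
  simpa using hX.fkg.posQuadrantDependent_sum {y} {z} id id monotone_id monotone_id
    (by simpa using hX.memLp y) (by simpa using hX.memLp z)

variable [IsProbabilityMeasure P]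

lemma integral_boxSum (hX : IsFKGField X P) (n : Fin d → ℕ) : ∫ ω, boxSum X n ω ∂P = 0 := by
  unfold boxSum
  rw [integral_finsetSum _ fun y _ => (hX.memLp y).integrable one_le_two]
  exact Finset.sum_eq_zero fun y _ => hX.mean y

lemma cov_eq (hX : IsFKGField X P) (y z : Fin d → ℤ) :
    cov[X y, X z; P] = cov[X 0, X (z - y); P] := by
  rw [covariance_eq_sub (hX.memLp _) (hX.memLp _), covariance_eq_sub (hX.memLp _) (hX.memLp _),
    hX.mean y, hX.mean 0, zero_mul, zero_mul]
  simpa using (hX.identDistrib_comp_shift y (g := fun x => x 0 * x (z - y))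
    (by fun_prop)).integral_eq

lemma norm_charFun_boxSum_add_sub_mul_le (hX : IsFKGField X P) (n : Fin d → ℕ) (i : Fin d)
    (a b : ℕ) (r : ℝ) :
    ‖charFun (P.map (boxSum X (Function.update n i (a + b)))) r -
      charFun (P.map (boxSum X (Function.update n i a))) r *
        charFun (P.map (boxSum X (Function.update n i b))) r‖ ≤
      2 * r ^ 2 * (Var[boxSum X (Function.update n i (a + b)); P] -
        Var[boxSum X (Function.update n i a); P] - Var[boxSum X (Function.update n i b); P]) := by
  set S := boxSum X (Function.update n i a)
  set T : Ω → ℝ := fun ω => ∑ y ∈ (natBox (Function.update n i b)).map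
    (addRightEmbedding (Pi.single i (a : ℤ))), X y ω with hT
  have hST : boxSum X (Function.update n i (a + b)) = S + T := by
    ext ω
    simp only [hT, Pi.add_apply, Finset.sum_map, addRightEmbedding_apply]
    exact sum_natBox_update_add (X · ω) n i a b
  have hid : IdentDistrib T (boxSum X (Function.update n i b)) P P := by
    simp only [hT, Finset.sum_map, addRightEmbedding_apply]
    exact hX.identDistrib_comp_shift (Pi.single i (a : ℤ))
      (g := fun x => ∑ y ∈ natBox (Function.update n i b), x y) (by fun_prop)
  have hSL : MemLp S 2 P := hX.memLp_boxSum _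
  have hTL : MemLp T 2 P := memLp_finsetSum _ fun y _ => hX.memLp y
  rw [hST, ← hid.map_eq, ← hid.variance_eq, variance_add hSL hTL]
  have hpqd : PosQuadrantDependent S T P := hX.fkg.posQuadrantDependent_sum _ _
  linarith [hpqd.norm_charFun_add_sub_mul_le hSL hTL r]

lemma norm_charFun_boxSum_le_one (hX : IsFKGField X P) (n : Fin d → ℕ) (r : ℝ) :
    ‖charFun (P.map (boxSum X n)) r‖ ≤ 1 :=
  have := Measure.isProbabilityMeasure_map (μ := P) (hX.measurable_boxSum n).aemeasurable
  norm_charFun_le_one r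

/-- Newman's inequality for a box cut into slabs along one coordinate direction. -/
lemma norm_charFun_boxSum_sub_mul_pow_le (hX : IsFKGField X P) (n : Fin d → ℕ) (i : Fin d)
    (a q : ℕ) (r : ℝ) (m : ℕ) :
    ‖charFun (P.map (boxSum X (Function.update n i (a + m * q)))) r -
      charFun (P.map (boxSum X (Function.update n i a))) r *
        charFun (P.map (boxSum X (Function.update n i q))) r ^ m‖ ≤
      2 * r ^ 2 * (Var[boxSum X (Function.update n i (a + m * q)); P] -
        Var[boxSum X (Function.update n i a); P] -
          m * Var[boxSum X (Function.update n i q); P]) := by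
  induction m with
  | zero => simp
  | succ m ih =>
    have hadd := hX.norm_charFun_boxSum_add_sub_mul_le n i (a + m * q) q r
    have hq := hX.norm_charFun_boxSum_le_one (Function.update n i q) r
    rw [show a + (m + 1) * q = a + m * q + q by ring]
    set φ : ℕ → ℂ := fun c => charFun (P.map (boxSum X (Function.update n i c))) r
    change ‖φ (a + m * q) - φ a * φ q ^ m‖ ≤ _ at ih
    change ‖φ (a + m * q + q) - φ (a + m * q) * φ q‖ ≤ _ at hadd
    change ‖φ q‖ ≤ 1 at hq
    change ‖φ (a + m * q + q) - φ a * φ q ^ (m + 1)‖ ≤ _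
    calc ‖φ (a + m * q + q) - φ a * φ q ^ (m + 1)‖
        = ‖(φ (a + m * q + q) - φ (a + m * q) * φ q) +
            (φ (a + m * q) - φ a * φ q ^ m) * φ q‖ := by ring_nf
      _ ≤ ‖φ (a + m * q + q) - φ (a + m * q) * φ q‖ + ‖φ (a + m * q) - φ a * φ q ^ m‖ := by
          refine (norm_add_le _ _).trans ?_
          rw [norm_mul]
          gcongr
          exact mul_le_of_le_one_right (norm_nonneg _) hq
      _ ≤ _ := by
          push_cast
          linarith

lemma hasSum_variance_boxSum (hX : IsFKGField X P) (n : Fin d → ℕ) :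
    HasSum (fun h => cov[X 0, X h; P] * overlap n h) Var[boxSum X n; P] := by
  set c : (Fin d → ℤ) → ℝ := fun h => cov[X 0, X h; P]
  have hrow (y : Fin d → ℤ) : HasSum (fun h => if y + h ∈ natBox n then c h else 0)
      (∑ z ∈ natBox n, c (z - y)) := by
    have hsum := hasSum_sum_of_ne_finset_zero (L := .unconditional _) (s := natBox n)
      (f := fun z => if z ∈ natBox n then c (z - y) else 0) fun z hz => if_neg hz
    rw [Finset.sum_congr rfl fun z hz => if_pos hz] at hsum
    simpa [Function.comp_def] using (Equiv.addLeft y).hasSum_iff.2 hsum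
  have hvar : Var[boxSum X n; P] = ∑ y ∈ natBox n, ∑ z ∈ natBox n, c (z - y) := by
    unfold boxSum
    rw [variance_fun_sum' fun y _ => hX.memLp y]
    exact Finset.sum_congr rfl fun y _ => Finset.sum_congr rfl fun z _ => hX.cov_eq y z
  rw [hvar]
  refine (hasSum_sum fun y _ => hrow y).congr_fun fun h => ?_
  rw [← Finset.sum_filter, Finset.sum_const, card_filter_add_mem_natBox, nsmul_eq_mul, mul_comm]

lemma variance_boxSum_le (hX : IsFKGField X P) (n : Fin d → ℕ) :
    Var[boxSum X n; P] ≤ susceptibility X P * ∏ k, (n k : ℝ) :=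
  hasSum_le (fun h => mul_le_mul_of_nonneg_left (by exact_mod_cast overlap_le n h)
    (hX.cov_nonneg 0 h)) (hX.hasSum_variance_boxSum n) (hX.susc.hasSum.mul_right _)

lemma le_variance_boxSum (hX : IsFKGField X P) (n : Fin d → ℕ) :
    Var[X 0; P] * ∏ k, (n k : ℝ) ≤ Var[boxSum X n; P] := by
  have := le_hasSum (hX.hasSum_variance_boxSum n) 0 fun h _ =>
    mul_nonneg (hX.cov_nonneg 0 h) (Nat.cast_nonneg _)
  rwa [covariance_self (hX.meas 0).aemeasurable, overlap_zero, Nat.cast_prod] at this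

end IsFKGField

/-! ### Slabs across the longest side of a box -/

section Slabs

variable {d : ℕ}

/-- The sides of a box as natural numbers, to compare `box u` with `natBox`. -/
def sides (u : Fin d → ℕ+) (k : Fin d) : ℕ := u k

lemma boxVol_pos (u : Fin d → ℕ+) : 0 < boxVol u := Finset.prod_pos fun k _ => (u k).pos

variable [Nonempty (Fin d)]

/-- A direction in which the box is longest. -/
def longest (u : Fin d → ℕ+) : Fin d := Classical.choose (Finite.exists_max u)

lemma le_longest (u : Fin d → ℕ+) (k : Fin d) : u k ≤ u (longest u) :=
  Classical.choose_spec (Finite.exists_max u) k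

/-- The length of the longest side of the box. -/
def side (u : Fin d → ℕ+) : ℕ := u (longest u)

lemma boxVol_le_side_pow (u : Fin d → ℕ+) : boxVol u ≤ side u ^ d :=
  calc boxVol u ≤ ∏ _k : Fin d, side u :=
        Finset.prod_le_prod' fun k _ => PNat.coe_le_coe _ _ |>.2 (le_longest u k)
    _ = side u ^ d := by simp

lemma tendsto_side : Tendsto (side (d := d)) (comap boxVol atTop) atTop := by
  refine tendsto_atTop.2 fun K => ?_
  filter_upwards [tendsto_comap.eventually (eventually_gt_atTop (K ^ d))] with u hu
  exact (lt_of_pow_lt_pow_left₀ d (Nat.zero_le _) (hu.trans_le (boxVol_le_side_pow u))).le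

/-- One of `M` equal slabs into which a box is cut across its longest side, up to a remainder of
at most `M - 1` layers. Meaningful for `0 < M ≤ side u`; otherwise the slab is one layer thick. -/
def slab (M : ℕ) (u : Fin d → ℕ+) : Fin d → ℕ+ :=
  Function.update u (longest u) (side u / M).toPNat'

lemma sides_slab {M : ℕ} {u : Fin d → ℕ+} (hM : 0 < M) (hu : M ≤ side u) :
    sides (slab M u) = Function.update (sides u) (longest u) (sides u (longest u) / M) := by
  ext k
  obtain rfl | hk := eq_or_ne k (longest u)
  · simp only [sides, slab, Function.update_self, Nat.toPNat'_coe]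
    exact if_pos (Nat.div_pos hu hM)
  · simp [sides, slab, hk]

lemma boxVol_slab_mul_side {M : ℕ} {u : Fin d → ℕ+} (hM : 0 < M) (hu : M ≤ side u) :
    boxVol (slab M u) * side u = boxVol u * (side u / M) := by
  have hvol (v : Fin d → ℕ+) : boxVol v = ∏ k, sides v k := rfl
  have hupd := Finset.prod_update_of_mem (Finset.mem_univ (longest u)) (sides u) (side u)
  rw [show side u = sides u (longest u) from rfl, Function.update_eq_self] at hupd
  rw [hvol, hvol, sides_slab hM hu, Finset.prod_update_of_mem (Finset.mem_univ _), hupd]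
  change _ / M * _ * sides u _ = sides u _ * _ * (sides u _ / M)
  ring

/-- The proportion of the volume of a box taken by one slab. -/
def slabRatio (M : ℕ) (u : Fin d → ℕ+) : ℝ := boxVol (slab M u) / boxVol u

lemma slabRatio_nonneg (M : ℕ) (u : Fin d → ℕ+) : 0 ≤ slabRatio M u := by
  unfold slabRatio
  positivity

lemma tendsto_mul_slabRatio {M : ℕ} (hM : 0 < M) :
    Tendsto (fun u : Fin d → ℕ+ => M * slabRatio M u) (comap boxVol atTop) (𝓝 1) := by
  have hfloor : Tendsto (fun x : ℝ => (⌊(M : ℝ)⁻¹ * x⌋₊ : ℝ) / x) atTop (𝓝 (M : ℝ)⁻¹) :=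
    tendsto_nat_floor_mul_div_atTop (by positivity)
  have hM' : (M : ℝ) ≠ 0 := by positivity
  rw [← mul_inv_cancel₀ hM']
  refine ((hfloor.comp (tendsto_natCast_atTop_atTop.comp tendsto_side)).const_mul (M : ℝ)).congr' ?_
  filter_upwards [tendsto_side.eventually_ge_atTop M] with u hu
  have hvol : (boxVol (slab M u) : ℝ) * side u = boxVol u * (side u / M : ℕ) :=
    mod_cast boxVol_slab_mul_side hM hu
  have hpos : (0 : ℝ) < boxVol u := mod_cast boxVol_pos u
  have hside : (0 : ℝ) < side u := mod_cast hM.trans_le hu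
  have hfl : ⌊(M : ℝ)⁻¹ * side u⌋₊ = side u / M := by
    rw [inv_mul_eq_div, Nat.floor_div_eq_div]
  simp only [Function.comp_apply, hfl, slabRatio]
  congr 1
  rw [div_eq_div_iff hside.ne' hpos.ne', hvol]
  ring

lemma mul_slabRatio_le_one {M : ℕ} {u : Fin d → ℕ+} (hM : 0 < M) (hu : M ≤ side u) :
    M * slabRatio M u ≤ 1 := by
  have hpos : (0 : ℝ) < boxVol u := mod_cast boxVol_pos u
  have h := mul_overlap_update_div_le (sides u) (longest u) 0 M
  rw [overlap_zero, ← sides_slab hM hu] at h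
  rw [slabRatio, ← mul_div_assoc, div_le_one hpos]
  exact_mod_cast h

lemma tendsto_overlap_sub_mul_overlap_slab {M : ℕ} (hM : 0 < M) (h : Fin d → ℤ) :
    Tendsto (fun u : Fin d → ℕ+ =>
      ((overlap (sides u) h : ℝ) - M * overlap (sides (slab M u)) h) / boxVol u)
      (comap boxVol atTop) (𝓝 0) := by
  have hside : Tendsto (fun u : Fin d → ℕ+ => (side u : ℝ)) (comap boxVol atTop) atTop :=
    tendsto_natCast_atTop_atTop.comp tendsto_side
  refine squeeze_zero_norm' ?_ ((tendsto_const_nhds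
    (x := (M : ℝ) * (1 + (∑ k, (h k).natAbs : ℕ)))).div_atTop hside)
  filter_upwards [tendsto_side.eventually_ge_atTop M] with u hu
  have hpos : (0 : ℝ) < boxVol u := mod_cast boxVol_pos u
  have hdefect := abs_overlap_sub_le (sides u) (longest u) h hM
  rw [← sides_slab hM hu] at hdefect
  rw [norm_div, Real.norm_eq_abs, Real.norm_of_nonneg hpos.le,
    div_le_div_iff₀ hpos (mod_cast hM.trans_le hu)]
  refine hdefect.trans ?_
  rw [← Nat.cast_prod]
  refine mul_le_mul_of_nonneg_right ?_ (Nat.cast_nonneg _)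
  gcongr
  exact Finset.single_le_sum (f := fun k => (h k).natAbs) (fun _ _ => Nat.zero_le _)
    (Finset.mem_univ (longest u))

lemma abs_overlap_sub_mul_overlap_slab_le {M : ℕ} (hM : 0 < M) (h : Fin d → ℤ)
    {u : Fin d → ℕ+} (hu : M ≤ side u) :
    |((overlap (sides u) h : ℝ) - M * overlap (sides (slab M u)) h) / boxVol u| ≤ 1 := by
  have hpos : (0 : ℝ) < boxVol u := mod_cast boxVol_pos u
  rw [abs_div, abs_of_pos hpos, div_le_one hpos, sides_slab hM hu]
  refine abs_sub_le_of_nonneg_of_le (by positivity) (mod_cast overlap_le (sides u) h)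
    (by positivity) (mod_cast mul_overlap_update_div_le (sides u) (longest u) h M)

end Slabs

namespace IsFKGField

variable {Ω : Type*} [MeasurableSpace Ω] {P : Measure Ω} [IsProbabilityMeasure P] {d : ℕ}
  {X : (Fin d → ℤ) → Ω → ℝ} [Nonempty (Fin d)]

lemma tendsto_variance_sub_mul_variance_slab (hX : IsFKGField X P) {M : ℕ} (hM : 0 < M) :
    Tendsto (fun u : Fin d → ℕ+ =>
      (Var[boxSum X (sides u); P] - M * Var[boxSum X (sides (slab M u)); P]) / boxVol u)
      (comap boxVol atTop) (𝓝 0) := by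
  set f : (Fin d → ℕ+) → (Fin d → ℤ) → ℝ := fun u h => cov[X 0, X h; P] *
    (((overlap (sides u) h : ℝ) - M * overlap (sides (slab M u)) h) / boxVol u) with hf
  have hsum (u : Fin d → ℕ+) : HasSum (f u)
      ((Var[boxSum X (sides u); P] - M * Var[boxSum X (sides (slab M u)); P]) / boxVol u) := by
    refine (((hX.hasSum_variance_boxSum (sides u)).sub
      ((hX.hasSum_variance_boxSum (sides (slab M u))).mul_left (M : ℝ))).div_const _).congr_fun ?_
    intro h
    simp only [hf]
    ring
  have hlim : Tendsto (fun u => ∑' h, f u h) (comap boxVol atTop) (𝓝 (∑' _ : Fin d → ℤ, 0)) := by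
    refine tendsto_tsum_of_dominated_convergence hX.susc (fun h => ?_) ?_
    · simpa only [mul_zero] using (tendsto_overlap_sub_mul_overlap_slab hM h).const_mul _
    · filter_upwards [tendsto_side.eventually_ge_atTop M] with u hu h
      rw [norm_mul, Real.norm_of_nonneg (hX.cov_nonneg 0 h)]
      exact mul_le_of_le_one_right (hX.cov_nonneg 0 h)
        (abs_overlap_sub_mul_overlap_slab_le hM h hu)
  simpa only [(hsum _).tsum_eq, tsum_zero] using hlim

end IsFKGField

/-! ### Normalised box sums of the perturbed field -/

lemma normSum_eq {Ω : Type*} {d : ℕ} (Y : (Fin d → ℤ) → Ω → ℝ) (u : Fin d → ℕ+) :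
    normSum Y u = fun ω => (√(boxVol u : ℝ))⁻¹ * boxSum Y (sides u) ω :=
  funext fun _ => div_eq_inv_mul _ _

lemma V_eq_add {Ω : Type*} {d : ℕ} (X : (Fin d → ℤ) → Ω → ℝ)
    (Z : ℝ≥0 → (Fin d → ℤ) → Ω → ℝ) (τ : ℝ≥0) (u : Fin d → ℕ+) :
    V X Z τ u = normSum X u + normSum (Z τ) u := by
  ext ω
  simp only [V, normSum, Finset.sum_add_distrib, add_div, Pi.add_apply]

section NormSum

variable {Ω : Type*} [MeasurableSpace Ω] {P : Measure Ω} {d : ℕ} {X : (Fin d → ℤ) → Ω → ℝ}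

lemma measurable_normSum (hX : ∀ y, Measurable (X y)) (u : Fin d → ℕ+) :
    Measurable (normSum X u) :=
  (Finset.measurable_sum _ fun y _ => hX y).div_const _

lemma charFun_normSum (hX : ∀ y, Measurable (X y)) (u : Fin d → ℕ+) (s : ℝ) :
    charFun (P.map (normSum X u)) s =
      charFun (P.map (boxSum X (sides u))) (s / √(boxVol u : ℝ)) := by
  have hm : Measurable (boxSum X (sides u)) := Finset.measurable_sum _ fun y _ => hX y
  rw [normSum_eq, charFun_map_mul_comp hm.aemeasurable, ← div_eq_inv_mul]

lemma variance_normSum (X : (Fin d → ℤ) → Ω → ℝ) (u : Fin d → ℕ+) :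
    Var[normSum X u; P] = Var[boxSum X (sides u); P] / boxVol u := by
  rw [normSum_eq, variance_const_mul, inv_pow, Real.sq_sqrt (Nat.cast_nonneg _), inv_mul_eq_div]

lemma IsFKGField.memLp_normSum (hX : IsFKGField X P) (u : Fin d → ℕ+) :
    MemLp (normSum X u) 2 P := by
  rw [normSum_eq]
  exact (hX.memLp_boxSum _).const_mul _

lemma IsFKGField.integral_normSum [IsProbabilityMeasure P] (hX : IsFKGField X P)
    (u : Fin d → ℕ+) : ∫ ω, normSum X u ω ∂P = 0 := by
  rw [normSum_eq, integral_const_mul, hX.integral_boxSum, mul_zero]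

end NormSum

namespace IsGaussianPerturbation

variable {Ω : Type*} [MeasurableSpace Ω] {P : Measure Ω} {d : ℕ} {X : (Fin d → ℤ) → Ω → ℝ}
  {Z : ℝ≥0 → (Fin d → ℤ) → Ω → ℝ}

lemma measurable_V (hZ : IsGaussianPerturbation X Z P) (hX : ∀ y, Measurable (X y)) (τ : ℝ≥0)
    (u : Fin d → ℕ+) : Measurable (V X Z τ u) :=
  measurable_normSum (fun y => (hX y).add (hZ.measurable τ y)) u

lemma indepFun_normSum (hZ : IsGaussianPerturbation X Z P) (τ : ℝ≥0) (u : Fin d → ℕ+) :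
    IndepFun (normSum X u) (normSum (Z τ) u) P := by
  have hg : Measurable fun x : (Fin d → ℤ) → ℝ => (∑ y ∈ box u, x y) / √(boxVol u : ℝ) := by
    fun_prop
  exact ((hZ.indep τ).comp hg hg).symm

variable [IsProbabilityMeasure P]

lemma map_normSum (hZ : IsGaussianPerturbation X Z P) (τ : ℝ≥0) (u : Fin d → ℕ+) :
    P.map (normSum (Z τ) u) = gaussianReal 0 τ := by
  have := Measure.isProbabilityMeasure_map (μ := P)
    (measurable_normSum (hZ.measurable τ) u).aemeasurable
  have hpos : (0 : ℝ) < boxVol u := mod_cast boxVol_pos u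
  refine Measure.ext_of_charFun (funext fun s => ?_)
  have hprod := congrFun (((hZ.iIndep τ).restrict (box u)).charFun_map_fun_finsetSum_eq_prod
    (fun y _ => (hZ.measurable τ y).aemeasurable)) (s / √(boxVol u : ℝ))
  have hsq : ((s / √(boxVol u : ℝ) : ℝ) : ℂ) ^ 2 = s ^ 2 / (boxVol u : ℂ) := by
    rw [← Complex.ofReal_pow, div_pow, Real.sq_sqrt hpos.le]
    push_cast
    rfl
  rw [charFun_normSum (hZ.measurable τ)]
  refine hprod.trans ?_
  simp only [hZ.law, Finset.prod_apply, Finset.prod_const]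
  rw [card_box, charFun_gaussianReal_zero, charFun_gaussianReal_zero, ← Complex.exp_nat_mul, hsq]
  congr 1
  have hne : (boxVol u : ℂ) ≠ 0 := mod_cast (boxVol_pos u).ne'
  field_simp

lemma hasLaw_normSum (hZ : IsGaussianPerturbation X Z P) (τ : ℝ≥0) (u : Fin d → ℕ+) :
    HasLaw (normSum (Z τ) u) (gaussianReal 0 τ) P :=
  ⟨(measurable_normSum (hZ.measurable τ) u).aemeasurable, hZ.map_normSum τ u⟩

lemma memLp_normSum (hZ : IsGaussianPerturbation X Z P) (τ : ℝ≥0) (u : Fin d → ℕ+) :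
    MemLp (normSum (Z τ) u) 2 P := by
  have hid : MemLp id 2 (P.map (normSum (Z τ) u)) := by
    rw [hZ.map_normSum]
    exact memLp_id_gaussianReal' 2 (by simp)
  exact (memLp_map_measure_iff (by fun_prop) (hZ.hasLaw_normSum τ u).aemeasurable).1 hid

lemma map_V (hZ : IsGaussianPerturbation X Z P) (hX : ∀ y, Measurable (X y)) (τ : ℝ≥0)
    (u : Fin d → ℕ+) : P.map (V X Z τ u) = P.map (normSum X u) ∗ gaussianReal 0 τ := by
  rw [V_eq_add, (hZ.indepFun_normSum τ u).map_add_eq_map_conv_map₀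
    (measurable_normSum hX u).aemeasurable (hZ.hasLaw_normSum τ u).aemeasurable, hZ.map_normSum]

lemma charFun_V (hZ : IsGaussianPerturbation X Z P) (hX : ∀ y, Measurable (X y)) (τ : ℝ≥0)
    (u : Fin d → ℕ+) (s : ℝ) : charFun (P.map (V X Z τ u)) s =
      charFun (P.map (boxSum X (sides u))) (s / √(boxVol u : ℝ)) *
        (Real.exp (-(τ * s ^ 2 / 2)) : ℝ) := by
  have := Measure.isProbabilityMeasure_map (μ := P) (measurable_normSum hX u).aemeasurable
  rw [hZ.map_V hX, charFun_conv, charFun_normSum hX, charFun_gaussianReal_zero]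
  push_cast
  rfl

lemma memLp_V (hZ : IsGaussianPerturbation X Z P) (hX : IsFKGField X P) (τ : ℝ≥0)
    (u : Fin d → ℕ+) : MemLp (V X Z τ u) 2 P := by
  rw [V_eq_add]
  exact (hX.memLp_normSum u).add (hZ.memLp_normSum τ u)

lemma integral_V (hZ : IsGaussianPerturbation X Z P) (hX : IsFKGField X P) (τ : ℝ≥0)
    (u : Fin d → ℕ+) : ∫ ω, V X Z τ u ω ∂P = 0 := by
  rw [V_eq_add, integral_add' ((hX.memLp_normSum u).integrable one_le_two)
    ((hZ.memLp_normSum τ u).integrable one_le_two), hX.integral_normSum,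
    (hZ.hasLaw_normSum τ u).integral_eq, integral_id_gaussianReal, add_zero]

lemma variance_V (hZ : IsGaussianPerturbation X Z P) (hX : IsFKGField X P) (τ : ℝ≥0)
    (u : Fin d → ℕ+) : Var[V X Z τ u; P] = Var[boxSum X (sides u); P] / boxVol u + τ := by
  rw [V_eq_add, (hZ.indepFun_normSum τ u).variance_add (hX.memLp_normSum u)
    (hZ.memLp_normSum τ u), variance_normSum, (hZ.hasLaw_normSum τ u).variance_eq,
    variance_id_gaussianReal]

lemma integral_sq_V (hZ : IsGaussianPerturbation X Z P) (hX : IsFKGField X P) (τ : ℝ≥0)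
    (u : Fin d → ℕ+) : ∫ x, x ^ 2 ∂P.map (V X Z τ u) = Var[V X Z τ u; P] := by
  rw [integral_map (hZ.measurable_V hX.meas τ u).aemeasurable (by fun_prop),
    variance_of_integral_eq_zero (hZ.memLp_V hX τ u).aemeasurable (hZ.integral_V hX τ u)]

lemma memLp_id_map_V (hZ : IsGaussianPerturbation X Z P) (hX : IsFKGField X P) (τ : ℝ≥0)
    (u : Fin d → ℕ+) : MemLp id 2 (P.map (V X Z τ u)) :=
  (memLp_map_measure_iff (by fun_prop) (hZ.measurable_V hX.meas τ u).aemeasurable).2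
    (hZ.memLp_V hX τ u)

lemma variance_V_le (hZ : IsGaussianPerturbation X Z P) (hX : IsFKGField X P) (τ : ℝ≥0)
    (u : Fin d → ℕ+) : Var[V X Z τ u; P] ≤ susceptibility X P + τ := by
  have hpos : (0 : ℝ) < boxVol u := mod_cast boxVol_pos u
  rw [hZ.variance_V hX, add_le_add_iff_right, div_le_iff₀ hpos]
  simpa [boxVol, sides] using hX.variance_boxSum_le (sides u)

lemma le_variance_V (hZ : IsGaussianPerturbation X Z P) (hX : IsFKGField X P) (τ : ℝ≥0)
    (u : Fin d → ℕ+) : Var[X 0; P] + τ ≤ Var[V X Z τ u; P] := by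
  have hpos : (0 : ℝ) < boxVol u := mod_cast boxVol_pos u
  rw [hZ.variance_V hX, add_le_add_iff_right, le_div_iff₀ hpos]
  simpa [boxVol, sides] using hX.le_variance_boxSum (sides u)

end IsGaussianPerturbation

/-! ### Lindeberg estimates for characteristic functions -/

lemma abs_exp_neg_sub_le {x y : ℝ} (hx : 0 ≤ x) (hy : 0 ≤ y) :
    |Real.exp (-x) - Real.exp (-y)| ≤ |x - y| := by
  wlog hxy : x ≤ y generalizing x y
  · rw [abs_sub_comm, abs_sub_comm x]
    exact this hy hx (le_of_not_ge hxy)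
  have hmono : Real.exp (-y) ≤ Real.exp (-x) := Real.exp_le_exp.2 (neg_le_neg hxy)
  rw [abs_of_nonneg (sub_nonneg.2 hmono), abs_sub_comm, abs_of_nonneg (sub_nonneg.2 hxy)]
  calc Real.exp (-x) - Real.exp (-y) = Real.exp (-x) * (1 - Real.exp (-(y - x))) := by
        rw [mul_sub, mul_one, ← Real.exp_add]
        ring_nf
    _ ≤ 1 * (y - x) :=
        mul_le_mul (Real.exp_le_one_iff.2 (neg_nonpos.2 hx))
          (by linarith [Real.one_sub_le_exp_neg (y - x)])
          (by simpa using hxy) zero_le_one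
    _ = y - x := one_mul _

lemma abs_exp_neg_sub_taylor_le {x : ℝ} (hx : 0 ≤ x) : |Real.exp (-x) - (1 - x)| ≤ x ^ 2 := by
  rw [abs_of_nonneg (by linarith [Real.one_sub_le_exp_neg x])]
  rcases le_or_gt x 1 with h | h
  · have := (le_abs_self _).trans (Real.abs_exp_sub_one_sub_id_le (x := -x) (by
      rwa [abs_neg, abs_of_nonneg hx]))
    linarith
  · have : Real.exp (-x) ≤ 1 := Real.exp_le_one_iff.2 (by linarith)
    nlinarith

lemma norm_pow_sub_pow_le_mul {a b : ℂ} (ha : ‖a‖ ≤ 1) (hb : ‖b‖ ≤ 1) (M : ℕ) :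
    ‖a ^ M - b ^ M‖ ≤ M * ‖a - b‖ := by
  induction M with
  | zero => simp
  | succ M ih =>
    calc ‖a ^ (M + 1) - b ^ (M + 1)‖ = ‖(a ^ M - b ^ M) * a + b ^ M * (a - b)‖ := by ring_nf
      _ ≤ ‖a ^ M - b ^ M‖ * ‖a‖ + ‖b‖ ^ M * ‖a - b‖ := by
          rw [← norm_mul, ← norm_pow, ← norm_mul]
          exact norm_add_le _ _
      _ ≤ M * ‖a - b‖ * 1 + 1 * ‖a - b‖ := by
          gcongr
          exact pow_le_one₀ (norm_nonneg _) hb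
      _ = (M + 1 : ℕ) * ‖a - b‖ := by push_cast; ring

/-- The remainder in the second order Taylor expansion of `x ↦ exp (i x)` at `0`. -/
def expITaylorRemainder (x : ℝ) : ℂ :=
  Complex.exp (x * Complex.I) - (1 + x * Complex.I - (x ^ 2 / 2 : ℝ))

lemma norm_expITaylorRemainder_le (x : ℝ) :
    ‖expITaylorRemainder x‖ ≤ 4 * x ^ 2 * min 1 |x| := by
  have hn : ‖(x : ℂ) * Complex.I‖ = |x| := by simp
  rcases le_or_gt |x| 1 with h | h
  · have hb := Complex.exp_bound (x := (x : ℂ) * Complex.I) (hn.trans_le h) (n := 3) (by norm_num)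
    have hpoly : ∑ m ∈ Finset.range 3, ((x : ℂ) * Complex.I) ^ m / (m.factorial : ℂ) =
        1 + x * Complex.I - (x ^ 2 / 2 : ℝ) := by
      simp only [Finset.sum_range_succ, Finset.range_zero, Finset.sum_empty, Nat.factorial, mul_pow,
        Complex.I_sq]
      push_cast
      ring
    rw [hpoly, hn] at hb
    rw [min_eq_right h, ← sq_abs x, mul_assoc, ← pow_succ]
    refine hb.trans ?_
    rw [mul_comm]
    refine mul_le_mul_of_nonneg_right ?_ (by positivity)
    norm_num [Nat.factorial]
  · have hle : |x| ≤ x ^ 2 := by rw [← sq_abs]; nlinarith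
    rw [min_eq_left h.le, mul_one]
    calc ‖expITaylorRemainder x‖ ≤ 1 + (1 + |x| + x ^ 2 / 2) := by
          refine norm_sub_le_of_le (Complex.norm_exp_ofReal_mul_I x).le
            (norm_sub_le_of_le (norm_add_le_of_le norm_one.le hn.le) ?_)
          rw [Complex.norm_real, Real.norm_of_nonneg (by positivity)]
      _ ≤ 4 * x ^ 2 := by linarith

section Lindeberg

variable {Ω : Type*} [MeasurableSpace Ω] {P : Measure Ω} [IsProbabilityMeasure P] {U : Ω → ℝ}

lemma charFun_sub_eq_integral_remainder (hL : MemLp U 2 P) (hmean : ∫ ω, U ω ∂P = 0) (r : ℝ) :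
    charFun (P.map U) r - (1 - r ^ 2 * Var[U; P] / 2 : ℝ) =
      ∫ ω, expITaylorRemainder (r * U ω) ∂P := by
  have hexp : Integrable (fun ω => Complex.exp ((r * U ω : ℝ) * Complex.I)) P := by
    have := hL.aemeasurable
    refine Integrable.of_bound (by fun_prop) 1 (.of_forall fun ω => ?_)
    rw [Complex.norm_exp_ofReal_mul_I]
  have hlin : Integrable (fun ω => ((r * U ω : ℝ) : ℂ) * Complex.I) P :=
    ((hL.integrable one_le_two).const_mul r).ofReal.mul_const _
  have hsq : Integrable (fun ω => (((r * U ω) ^ 2 / 2 : ℝ) : ℂ)) P := by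
    simp only [mul_pow]
    exact ((hL.integrable_sq.const_mul _).div_const 2).ofReal
  have hint_lin : ∫ ω, ((r * U ω : ℝ) : ℂ) * Complex.I ∂P = 0 := by
    rw [integral_mul_const, integral_complex_ofReal, integral_const_mul, hmean]
    simp
  have hint_sq : ∫ ω, (((r * U ω) ^ 2 / 2 : ℝ) : ℂ) ∂P = (r ^ 2 * Var[U; P] / 2 : ℝ) := by
    rw [integral_complex_ofReal, variance_of_integral_eq_zero hL.aemeasurable hmean]
    simp only [mul_pow]
    rw [integral_div, integral_const_mul]
  have hadd : Integrable (fun ω => 1 + ((r * U ω : ℝ) : ℂ) * Complex.I) P :=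
    (integrable_const 1).add hlin
  have hpoly : Integrable
      (fun ω => 1 + ((r * U ω : ℝ) : ℂ) * Complex.I - ((r * U ω) ^ 2 / 2 : ℝ)) P := hadd.sub hsq
  unfold expITaylorRemainder
  rw [integral_sub hexp hpoly, integral_sub hadd hsq, integral_add (integrable_const 1) hlin,
    hint_lin, hint_sq, charFun_apply_real, integral_map hL.aemeasurable (by fun_prop)]
  simp

lemma norm_charFun_sub_one_le (hL : MemLp U 2 P) (hmean : ∫ ω, U ω ∂P = 0) (r : ℝ) :
    ‖charFun (P.map U) r - 1‖ ≤ 5 * r ^ 2 * Var[U; P] := by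
  have hv := variance_nonneg U P
  have htaylor : ‖charFun (P.map U) r - (1 - r ^ 2 * Var[U; P] / 2 : ℝ)‖ ≤
      4 * r ^ 2 * Var[U; P] := by
    rw [charFun_sub_eq_integral_remainder hL hmean,
      variance_of_integral_eq_zero hL.aemeasurable hmean, ← integral_const_mul]
    refine norm_integral_le_of_norm_le (hL.integrable_sq.const_mul _) (.of_forall fun ω => ?_)
    refine (norm_expITaylorRemainder_le _).trans ?_
    rw [mul_pow, ← mul_assoc]
    exact mul_le_of_le_one_right (by positivity) (min_le_left _ _)
  calc ‖charFun (P.map U) r - 1‖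
      = ‖(charFun (P.map U) r - (1 - r ^ 2 * Var[U; P] / 2 : ℝ)) -
          ((r ^ 2 * Var[U; P] / 2 : ℝ) : ℂ)‖ := by push_cast; ring_nf
    _ ≤ 4 * r ^ 2 * Var[U; P] + r ^ 2 * Var[U; P] / 2 := by
        refine norm_sub_le_of_le htaylor ?_
        rw [Complex.norm_real, Real.norm_of_nonneg (by positivity)]
    _ ≤ 5 * r ^ 2 * Var[U; P] := by
        have : 0 ≤ r ^ 2 * Var[U; P] := by positivity
        linarith

lemma norm_charFun_sub_le_of_inClass {ψ : ℝ → ℝ} (hm : Measurable U) (hU : InClass ψ U P)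
    (hmean : ∫ ω, U ω ∂P = 0) {r t R : ℝ} (ht : r ^ 2 * Var[U; P] = t) (hR : 0 ≤ R) :
    ‖charFun (P.map U) r - (1 - t / 2 : ℝ)‖ ≤ 4 * t * (ψ R + R * √t) := by
  obtain ⟨hL, hψ⟩ := hU
  set A : Set Ω := {ω | R * √(Var[U; P]) ≤ |U ω|}
  have hA : MeasurableSet A := measurableSet_le measurable_const hm.abs
  have hsqrt : √t = |r| * √Var[U; P] := by
    rw [← ht, Real.sqrt_mul (sq_nonneg r), Real.sqrt_sq_eq_abs]
  have hsq : Integrable (fun ω => U ω ^ 2) P := hL.integrable_sq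
  have hpt (ω : Ω) : ‖expITaylorRemainder (r * U ω)‖ ≤
      4 * r ^ 2 * (A.indicator (fun ω => U ω ^ 2) ω + R * √t * U ω ^ 2) := by
    refine (norm_expITaylorRemainder_le _).trans ?_
    rw [mul_pow, ← mul_assoc, mul_assoc _ (U ω ^ 2)]
    refine mul_le_mul_of_nonneg_left ?_ (by positivity)
    by_cases hω : ω ∈ A
    · rw [Set.indicator_of_mem hω]
      have : 0 ≤ R * √t * U ω ^ 2 := by positivity
      linarith [mul_le_of_le_one_right (sq_nonneg (U ω)) (min_le_left 1 |r * U ω|)]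
    · rw [Set.indicator_of_notMem hω, zero_add, mul_comm]
      refine mul_le_mul_of_nonneg_right ((min_le_right _ _).trans ?_) (sq_nonneg _)
      rw [abs_mul, hsqrt, mul_left_comm]
      exact mul_le_mul_of_nonneg_left (not_le.1 hω).le (abs_nonneg r)
  have hint := (hsq.indicator hA).add (hsq.const_mul (R * √t))
  rw [← ht, charFun_sub_eq_integral_remainder hL hmean, ht]
  refine (norm_integral_le_of_norm_le (hint.const_mul (4 * r ^ 2)) (.of_forall hpt)).trans ?_
  simp only [Pi.add_apply]
  rw [integral_const_mul, integral_add (hsq.indicator hA) (hsq.const_mul _), integral_const_mul,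
    integral_indicator hA, ← variance_of_integral_eq_zero hL.aemeasurable hmean]
  calc 4 * r ^ 2 * (∫ ω in A, U ω ^ 2 ∂P + R * √t * Var[U; P])
      ≤ 4 * r ^ 2 * (Var[U; P] * ψ R + R * √t * Var[U; P]) := by gcongr; exact hψ R
    _ = 4 * t * (ψ R + R * √t) := by rw [← ht]; ring

lemma norm_charFun_pow_sub_exp_le {ψ : ℝ → ℝ} (hm : Measurable U) (hU : InClass ψ U P)
    (hmean : ∫ ω, U ω ∂P = 0) {r t R L : ℝ} {M : ℕ} (ht : r ^ 2 * Var[U; P] = t) (hR : 0 ≤ R)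
    (hM : 0 < M) (hL : M * t ≤ L) :
    ‖charFun (P.map U) r ^ M - (Real.exp (-(M * t / 2)) : ℝ)‖ ≤
      4 * L * (|ψ R| + R * √(L / M)) + L * (L / M) := by
  have := Measure.isProbabilityMeasure_map (μ := P) hm.aemeasurable
  have hM' : (0 : ℝ) < M := mod_cast hM
  have ht0 : 0 ≤ t := ht ▸ mul_nonneg (sq_nonneg r) (variance_nonneg U P)
  have htL : t ≤ L / M := by rwa [le_div_iff₀' hM']
  have hL0 : 0 ≤ L := hL.trans' (by positivity)
  have hpow : ((Real.exp (-(M * t / 2)) : ℝ) : ℂ) = (Real.exp (-(t / 2)) : ℝ) ^ M := by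
    rw [← Complex.ofReal_pow, ← Real.exp_nat_mul]
    ring_nf
  have hexp : ‖((Real.exp (-(t / 2)) : ℝ) : ℂ)‖ ≤ 1 := by
    rw [Complex.norm_real, Real.norm_of_nonneg (Real.exp_nonneg _), Real.exp_le_one_iff]
    linarith
  have hone : ‖charFun (P.map U) r - (Real.exp (-(t / 2)) : ℝ)‖ ≤
      4 * t * (|ψ R| + R * √(L / M)) + t * (L / M) := by
    refine (norm_sub_le_norm_sub_add_norm_sub _ ((1 - t / 2 : ℝ) : ℂ) _).trans (add_le_add ?_ ?_)
    · refine (norm_charFun_sub_le_of_inClass hm hU hmean ht hR).trans ?_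
      gcongr
      exact le_abs_self _
    · rw [norm_sub_rev, ← Complex.ofReal_sub, Complex.norm_real]
      calc |Real.exp (-(t / 2)) - (1 - t / 2)| ≤ (t / 2) ^ 2 :=
            abs_exp_neg_sub_taylor_le (by positivity)
        _ ≤ t * t := by nlinarith
        _ ≤ t * (L / M) := by gcongr
  rw [hpow]
  calc ‖charFun (P.map U) r ^ M - (Real.exp (-(t / 2)) : ℝ) ^ M‖
      ≤ M * ‖charFun (P.map U) r - (Real.exp (-(t / 2)) : ℝ)‖ :=
        norm_pow_sub_pow_le_mul (norm_charFun_le_one r) hexp M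
    _ ≤ M * (4 * t * (|ψ R| + R * √(L / M)) + t * (L / M)) := by gcongr
    _ = 4 * (M * t) * (|ψ R| + R * √(L / M)) + M * t * (L / M) := by ring
    _ ≤ 4 * L * (|ψ R| + R * √(L / M)) + L * (L / M) := by gcongr

end Lindeberg

/-! ### The central limit theorem -/

lemma norm_mul_sub_mul_le {𝕜 : Type*} [NormedCommRing 𝕜] {a b x y : 𝕜} (hx : ‖x‖ ≤ 1)
    (hb : ‖b‖ ≤ 1) : ‖a * x - b * y‖ ≤ ‖a - b‖ + ‖x - y‖ :=
  calc ‖a * x - b * y‖ = ‖(a - b) * x + b * (x - y)‖ := by ring_nf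
    _ ≤ ‖a - b‖ * 1 + 1 * ‖x - y‖ := norm_add_le_of_le
        ((norm_mul_le _ _).trans (by gcongr)) ((norm_mul_le _ _).trans (by gcongr))
    _ = ‖a - b‖ + ‖x - y‖ := by rw [mul_one, one_mul]

section CentralLimit

variable {Ω : Type*} [MeasurableSpace Ω] {P : Measure Ω} [IsProbabilityMeasure P] {d : ℕ}
  {X : (Fin d → ℤ) → Ω → ℝ} {Z : ℝ≥0 → (Fin d → ℤ) → Ω → ℝ}

lemma IsFKGField.norm_charFun_boxSum_sub_pow_le (hX : IsFKGField X P) (n : Fin d → ℕ)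
    (i : Fin d) (M : ℕ) (r : ℝ) :
    ‖charFun (P.map (boxSum X n)) r -
      charFun (P.map (boxSum X (Function.update n i (n i / M)))) r ^ M‖ ≤
      5 * r ^ 2 * (Var[boxSum X n; P] - M * Var[boxSum X (Function.update n i (n i / M)); P]) := by
  have hslabs := hX.norm_charFun_boxSum_sub_mul_pow_le n i (n i % M) (n i / M) r M
  rw [Nat.mod_add_div, Function.update_eq_self] at hslabs
  set rest := Function.update n i (n i % M)
  set slab := Function.update n i (n i / M)
  have hrest : ‖charFun (P.map (boxSum X rest)) r - 1‖ ≤ 5 * r ^ 2 * Var[boxSum X rest; P] :=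
    norm_charFun_sub_one_le (hX.memLp_boxSum rest) (hX.integral_boxSum rest) r
  have hslab : ‖charFun (P.map (boxSum X slab)) r ^ M‖ ≤ 1 := by
    rw [norm_pow]
    exact pow_le_one₀ (norm_nonneg _) (hX.norm_charFun_boxSum_le_one slab r)
  have hnonneg := (norm_nonneg _).trans hslabs
  calc ‖charFun (P.map (boxSum X n)) r - charFun (P.map (boxSum X slab)) r ^ M‖
      = ‖(charFun (P.map (boxSum X n)) r -
            charFun (P.map (boxSum X rest)) r * charFun (P.map (boxSum X slab)) r ^ M) +
          (charFun (P.map (boxSum X rest)) r - 1) * charFun (P.map (boxSum X slab)) r ^ M‖ := by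
        ring_nf
    _ ≤ 2 * r ^ 2 * (Var[boxSum X n; P] - Var[boxSum X rest; P] - M * Var[boxSum X slab; P]) +
          5 * r ^ 2 * Var[boxSum X rest; P] * 1 := by
        refine norm_add_le_of_le hslabs ?_
        rw [norm_mul]
        exact mul_le_mul hrest hslab (norm_nonneg _) ((norm_nonneg _).trans hrest)
    _ ≤ 5 * r ^ 2 * (Var[boxSum X n; P] - M * Var[boxSum X slab; P]) := by linarith

namespace IsGaussianPerturbation

variable [Nonempty (Fin d)]

lemma variance_V_sub_mul_variance_V_slab (hZ : IsGaussianPerturbation X Z P)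
    (hX : IsFKGField X P) (τ : ℝ≥0) (M : ℕ) (u : Fin d → ℕ+) :
    Var[V X Z τ u; P] - M * slabRatio M u * Var[V X Z τ (slab M u); P] =
      (Var[boxSum X (sides u); P] - M * Var[boxSum X (sides (slab M u)); P]) / boxVol u +
        τ * (1 - M * slabRatio M u) := by
  have hu : (boxVol u : ℝ) ≠ 0 := mod_cast (boxVol_pos u).ne'
  have hs : (boxVol (slab M u) : ℝ) ≠ 0 := mod_cast (boxVol_pos (slab M u)).ne'
  rw [hZ.variance_V hX, hZ.variance_V hX, slabRatio]
  field_simp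
  ring

lemma tendsto_variance_V_sub_mul_variance_V_slab (hZ : IsGaussianPerturbation X Z P)
    (hX : IsFKGField X P) (τ : ℝ≥0) {M : ℕ} (hM : 0 < M) :
    Tendsto (fun u : Fin d → ℕ+ =>
      Var[V X Z τ u; P] - M * slabRatio M u * Var[V X Z τ (slab M u); P])
      (comap boxVol atTop) (𝓝 0) := by
  simp only [hZ.variance_V_sub_mul_variance_V_slab hX]
  simpa using (hX.tendsto_variance_sub_mul_variance_slab hM).add
    (((tendsto_mul_slabRatio hM).const_sub 1).const_mul (τ : ℝ))

lemma charFun_V_slab_pow (hZ : IsGaussianPerturbation X Z P) (hX : ∀ y, Measurable (X y))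
    (τ : ℝ≥0) (s : ℝ) (M : ℕ) (u : Fin d → ℕ+) :
    charFun (P.map (V X Z τ (slab M u))) (s * √(slabRatio M u)) ^ M =
      charFun (P.map (boxSum X (sides (slab M u)))) (s / √(boxVol u : ℝ)) ^ M *
        (Real.exp (-(τ * s ^ 2 * (M * slabRatio M u) / 2)) : ℝ) := by
  have hs : √(boxVol (slab M u) : ℝ) ≠ 0 :=
    (Real.sqrt_pos.2 (mod_cast boxVol_pos (slab M u))).ne'
  have harg : s * √(slabRatio M u) / √(boxVol (slab M u) : ℝ) = s / √(boxVol u : ℝ) := by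
    rw [slabRatio, Real.sqrt_div (Nat.cast_nonneg _)]
    field_simp
  have hratio := slabRatio_nonneg M u
  rw [hZ.charFun_V hX, harg, mul_pow (charFun _ _), ← Complex.ofReal_pow, ← Real.exp_nat_mul,
    mul_pow, Real.sq_sqrt hratio]
  congr 3
  ring_nf

lemma norm_charFun_V_sub_pow_le (hZ : IsGaussianPerturbation X Z P) (hX : IsFKGField X P)
    (τ : ℝ≥0) (s : ℝ) {M : ℕ} (hM : 0 < M) {u : Fin d → ℕ+} (hu : M ≤ side u) :
    ‖charFun (P.map (V X Z τ u)) s -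
      charFun (P.map (V X Z τ (slab M u))) (s * √(slabRatio M u)) ^ M‖ ≤
      5 * s ^ 2 * (Var[V X Z τ u; P] - M * slabRatio M u * Var[V X Z τ (slab M u); P]) := by
  have hvol : (0 : ℝ) ≤ boxVol u := Nat.cast_nonneg _
  have hratio := slabRatio_nonneg M u
  have hle : 0 ≤ 1 - M * slabRatio M u := sub_nonneg.2 (mul_slabRatio_le_one hM hu)
  have hbox := hX.norm_charFun_boxSum_sub_pow_le (sides u) (longest u) M (s / √(boxVol u : ℝ))
  rw [← sides_slab hM hu, div_pow, Real.sq_sqrt hvol] at hbox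
  have hslab :
      ‖charFun (P.map (boxSum X (sides (slab M u)))) (s / √(boxVol u : ℝ)) ^ M‖ ≤ 1 := by
    rw [norm_pow]
    exact pow_le_one₀ (norm_nonneg _) (hX.norm_charFun_boxSum_le_one _ _)
  rw [hZ.charFun_V hX.meas, hZ.charFun_V_slab_pow hX.meas,
    hZ.variance_V_sub_mul_variance_V_slab hX]
  set δ := Var[boxSum X (sides u); P] - M * Var[boxSum X (sides (slab M u)); P]
  set a := charFun (P.map (boxSum X (sides u))) (s / √(boxVol u : ℝ))
  set b := charFun (P.map (boxSum X (sides (slab M u)))) (s / √(boxVol u : ℝ)) ^ M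
  have hexp : ‖((Real.exp (-(τ * s ^ 2 / 2)) : ℝ) : ℂ)‖ ≤ 1 := by
    rw [Complex.norm_real, Real.norm_of_nonneg (Real.exp_nonneg _), Real.exp_le_one_iff]
    exact neg_nonpos.2 (by positivity)
  have hgauss : ‖((Real.exp (-(τ * s ^ 2 / 2)) : ℝ) : ℂ) -
      (Real.exp (-(τ * s ^ 2 * (M * slabRatio M u) / 2)) : ℝ)‖ ≤
      5 * s ^ 2 * (τ * (1 - M * slabRatio M u)) := by
    rw [← Complex.ofReal_sub, Complex.norm_real]
    have hτ : 0 ≤ s ^ 2 * (τ * (1 - M * slabRatio M u)) := by positivity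
    refine (abs_exp_neg_sub_le (by positivity) (by positivity)).trans ?_
    rw [abs_of_nonneg (by linarith)]
    linarith
  calc ‖a * (Real.exp (-(τ * s ^ 2 / 2)) : ℝ) -
        b * (Real.exp (-(τ * s ^ 2 * (M * slabRatio M u) / 2)) : ℝ)‖
      ≤ 5 * (s ^ 2 / boxVol u) * δ + 5 * s ^ 2 * (τ * (1 - M * slabRatio M u)) :=
        (norm_mul_sub_mul_le hexp hslab).trans (add_le_add hbox hgauss)
    _ = 5 * s ^ 2 * (δ / boxVol u + τ * (1 - M * slabRatio M u)) := by ring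

lemma norm_charFun_V_sub_exp_le (hZ : IsGaussianPerturbation X Z P) (hX : IsFKGField X P)
    (τ : ℝ≥0) {ψ : ℝ → ℝ} (hψ : ∀ u, InClass ψ (V X Z τ u) P) (s : ℝ) {R : ℝ} (hR : 0 ≤ R)
    {M : ℕ} (hM : 0 < M) {u : Fin d → ℕ+} (hu : M ≤ side u) {L : ℝ}
    (hL : s ^ 2 * (susceptibility X P + τ) = L) :
    ‖charFun (P.map (V X Z τ u)) s - (Real.exp (-(Var[V X Z τ u; P] * s ^ 2 / 2)) : ℝ)‖ ≤
      6 * s ^ 2 * |Var[V X Z τ u; P] - M * slabRatio M u * Var[V X Z τ (slab M u); P]| +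
        (4 * L * (|ψ R| + R * √(L / M)) + L * (L / M)) := by
  have hratio := slabRatio_nonneg M u
  have hv := variance_nonneg (V X Z τ u) P
  have hvs := variance_nonneg (V X Z τ (slab M u)) P
  have hslabs := hZ.norm_charFun_V_sub_pow_le hX τ s hM hu
  have hlind := norm_charFun_pow_sub_exp_le (hZ.measurable_V hX.meas τ (slab M u)) (hψ (slab M u))
    (hZ.integral_V hX τ (slab M u)) (r := s * √(slabRatio M u)) (M := M) (L := L) rfl hR hM (by
      rw [mul_pow, Real.sq_sqrt hratio, ← hL]
      calc M * (s ^ 2 * slabRatio M u * Var[V X Z τ (slab M u); P])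
          = s ^ 2 * (M * slabRatio M u * Var[V X Z τ (slab M u); P]) := by ring
        _ ≤ s ^ 2 * (1 * (susceptibility X P + τ)) := by
            gcongr
            · exact mul_slabRatio_le_one hM hu
            · exact hZ.variance_V_le hX τ (slab M u)
        _ = s ^ 2 * (susceptibility X P + τ) := by rw [one_mul])
  rw [mul_pow, Real.sq_sqrt hratio] at hlind
  set δ := Var[V X Z τ u; P] - M * slabRatio M u * Var[V X Z τ (slab M u); P] with hδ
  set v := Var[V X Z τ u; P]
  set t := s ^ 2 * slabRatio M u * Var[V X Z τ (slab M u); P] with ht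
  have hMt : M * t = s ^ 2 * (v - δ) := by rw [hδ, ht]; ring
  have hgauss : ‖((Real.exp (-(M * t / 2)) : ℝ) : ℂ) - (Real.exp (-(v * s ^ 2 / 2)) : ℝ)‖ ≤
      s ^ 2 * |δ| := by
    rw [← Complex.ofReal_sub, Complex.norm_real]
    have ht0 : 0 ≤ t := mul_nonneg (mul_nonneg (sq_nonneg s) hratio) hvs
    refine (abs_exp_neg_sub_le (div_nonneg (mul_nonneg M.cast_nonneg ht0) zero_le_two)
      (div_nonneg (mul_nonneg hv (sq_nonneg s)) zero_le_two)).trans ?_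
    rw [hMt, show s ^ 2 * (v - δ) / 2 - v * s ^ 2 / 2 = s ^ 2 * (-δ / 2) by ring, abs_mul,
      abs_of_nonneg (sq_nonneg s), abs_div, abs_neg, abs_two]
    exact mul_le_mul_of_nonneg_left (half_le_self (abs_nonneg δ)) (sq_nonneg s)
  have hδ_abs : 5 * s ^ 2 * δ ≤ 5 * s ^ 2 * |δ| :=
    mul_le_mul_of_nonneg_left (le_abs_self δ) (by positivity)
  calc ‖charFun (P.map (V X Z τ u)) s - (Real.exp (-(v * s ^ 2 / 2)) : ℝ)‖
      ≤ 5 * s ^ 2 * |δ| + (4 * L * (|ψ R| + R * √(L / M)) + L * (L / M) + s ^ 2 * |δ|) :=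
        (norm_sub_le_norm_sub_add_norm_sub _ _ _).trans <| add_le_add (hslabs.trans hδ_abs) <|
          (norm_sub_le_norm_sub_add_norm_sub _ _ _).trans (add_le_add hlind hgauss)
    _ = 6 * s ^ 2 * |δ| + (4 * L * (|ψ R| + R * √(L / M)) + L * (L / M)) := by ring

lemma tendsto_charFun_V_sub_exp (hZ : IsGaussianPerturbation X Z P) (hX : IsFKGField X P)
    (τ : ℝ≥0) (hUI : UniformIntegrability X Z P τ) (s : ℝ) :
    Tendsto (fun u : Fin d → ℕ+ => charFun (P.map (V X Z τ u)) s -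
      (Real.exp (-(Var[V X Z τ u; P] * s ^ 2 / 2)) : ℝ)) (comap boxVol atTop) (𝓝 0) := by
  obtain ⟨ψ, hψ_tendsto, hψ⟩ := hUI
  obtain ⟨L, hL⟩ : ∃ L, s ^ 2 * (susceptibility X P + τ) = L := ⟨_, rfl⟩
  refine Metric.tendsto_nhds.2 fun ε hε => ?_
  obtain ⟨R, hR, hψR⟩ : ∃ R, 0 ≤ R ∧ 4 * L * |ψ R| < ε / 2 := by
    have hlim : Tendsto (fun R => 4 * L * |ψ R|) atTop (𝓝 0) := by
      simpa using hψ_tendsto.abs.const_mul (4 * L)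
    exact ((eventually_ge_atTop 0).and (hlim.eventually_lt_const (half_pos hε))).exists
  obtain ⟨M, hM, hMε⟩ : ∃ M : ℕ, 0 < M ∧
      4 * L * (|ψ R| + R * √(L / M)) + L * (L / M) < ε / 2 := by
    have hdiv : Tendsto (fun M : ℕ => L / M) atTop (𝓝 0) := tendsto_const_div_atTop_nhds_zero_nat L
    have hlim : Tendsto (fun M : ℕ => 4 * L * (|ψ R| + R * √(L / M)) + L * (L / M)) atTop
        (𝓝 (4 * L * |ψ R|)) := by
      simpa using (((hdiv.sqrt.const_mul R).const_add |ψ R|).const_mul (4 * L)).add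
        (hdiv.const_mul L)
    exact ((eventually_gt_atTop 0).and (hlim.eventually_lt_const hψR)).exists
  have hδ : Tendsto (fun u : Fin d → ℕ+ => 6 * s ^ 2 *
      |Var[V X Z τ u; P] - M * slabRatio M u * Var[V X Z τ (slab M u); P]|)
      (comap boxVol atTop) (𝓝 0) := by
    simpa using (hZ.tendsto_variance_V_sub_mul_variance_V_slab hX τ hM).abs.const_mul (6 * s ^ 2)
  filter_upwards [tendsto_side.eventually_ge_atTop M, hδ.eventually_lt_const (half_pos hε)]
    with u hu huε
  rw [dist_zero_right]
  linarith [hZ.norm_charFun_V_sub_exp_le hX τ hψ s hR hM hu hL]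

end IsGaussianPerturbation

end CentralLimit

/-! ### Uniform integrability implies convergence of the relative entropy -/

lemma lintegral_Ioi_add_le (g : ℝ → ℝ≥0∞) {a : ℝ} (ha : 0 ≤ a) :
    ∫⁻ t in Set.Ioi 0, g (t + a) ≤ ∫⁻ t in Set.Ioi 0, g t := by
  rw [← lintegral_indicator measurableSet_Ioi, ← lintegral_indicator measurableSet_Ioi,
    ← lintegral_add_right_eq_self (Set.indicator (Set.Ioi 0) g) a]
  refine lintegral_mono fun t => Set.indicator_apply_le' (fun ht => ?_) fun _ => zero_le
  rw [Set.indicator_of_mem (Set.mem_Ioi.2 (add_pos_of_pos_of_nonneg ht ha))]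

namespace IsGaussianPerturbation

variable {Ω : Type*} [MeasurableSpace Ω] {P : Measure Ω} [IsProbabilityMeasure P] {d : ℕ}
  {X : (Fin d → ℤ) → Ω → ℝ} {Z : ℝ≥0 → (Fin d → ℤ) → Ω → ℝ}

lemma isProbabilityMeasure_map_V (hZ : IsGaussianPerturbation X Z P) (hX : ∀ y, Measurable (X y))
    (τ : ℝ≥0) (u : Fin d → ℕ+) : IsProbabilityMeasure (P.map (V X Z τ u)) :=
  Measure.isProbabilityMeasure_map (hZ.measurable_V hX τ u).aemeasurable

lemma map_V_add (hZ : IsGaussianPerturbation X Z P) (hX : ∀ y, Measurable (X y)) (τ t : ℝ≥0)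
    (u : Fin d → ℕ+) : P.map (V X Z (τ + t) u) = P.map (V X Z τ u) ∗ gaussianReal 0 t := by
  have := Measure.isProbabilityMeasure_map (μ := P) (measurable_normSum hX u).aemeasurable
  rw [hZ.map_V hX, hZ.map_V hX, Measure.conv_assoc, gaussianReal_conv_gaussianReal, add_zero]

lemma excessFisherInfo_map_V (hZ : IsGaussianPerturbation X Z P) (hX : IsFKGField X P) (τ : ℝ≥0)
    (u : Fin d → ℕ+) {t : ℝ≥0} (ht : t ≠ 0) :
    excessFisherInfo (P.map (V X Z τ u)) t =
      stdFisherInfo (V X Z (τ + t) u) P / ENNReal.ofReal (Var[V X Z τ u; P] + t) := by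
  have := hZ.isProbabilityMeasure_map_V hX.meas τ u
  have hvar : Var[V X Z (τ + t) u; P] = Var[V X Z τ u; P] + t := by
    rw [hZ.variance_V hX, hZ.variance_V hX, NNReal.coe_add, add_assoc]
  have hpos : 0 < Var[V X Z τ u; P] + t :=
    add_pos_of_nonneg_of_pos (variance_nonneg _ _) (NNReal.coe_pos.2 ht.pos)
  rw [excessFisherInfo, hZ.integral_sq_V hX, stdFisherInfo, hvar, hZ.map_V_add hX.meas,
    fisherInfo_conv_gaussianReal _ ht, ← ENNReal.ofReal_mul hpos.le, ← ENNReal.ofReal_one,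
    ← ENNReal.ofReal_sub _ zero_le_one, ← ENNReal.ofReal_div_of_pos hpos]
  congr 1
  field_simp

lemma excessFisherInfo_map_V_le (hZ : IsGaussianPerturbation X Z P) (hX : IsFKGField X P)
    {τ : ℝ≥0} (hpos : 0 < Var[X 0; P] + τ) {n : ℕ} {u : Fin d → ℕ+} (hu : n ≤ boxVol u)
    {t : ℝ} (ht : 0 < t) :
    excessFisherInfo (P.map (V X Z τ u)) t ≤
      ENNReal.ofReal (1 + 1 / (Var[X 0; P] + τ)) *
        (kappa X Z P n (t + τ).toNNReal / ENNReal.ofReal (1 + (t + τ))) := by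
  lift t to ℝ≥0 using ht.le
  have hV := hZ.le_variance_V hX τ u
  have hX0 := variance_nonneg (X 0) P
  have hkappa : stdFisherInfo (V X Z (τ + t) u) P ≤ kappa X Z P n (τ + t) :=
    le_iSup₂_of_le (f := fun (u : Fin d → ℕ+) (_ : n ≤ boxVol u) =>
      stdFisherInfo (V X Z (τ + t) u) P) u hu le_rfl
  have hinv : (Var[V X Z τ u; P] + t)⁻¹ ≤ (1 + 1 / (Var[X 0; P] + τ)) * (1 + (t + τ) : ℝ)⁻¹ := by
    rw [← div_eq_mul_inv, inv_eq_one_div, div_le_div_iff₀ (by linarith) (by linarith), one_mul]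
    calc 1 + (t + τ) ≤ Var[X 0; P] + τ + t + 1 + t / (Var[X 0; P] + τ) := by
          linarith [div_nonneg t.coe_nonneg hpos.le]
      _ = (1 + 1 / (Var[X 0; P] + τ)) * (Var[X 0; P] + τ + t) := by
          field_simp
          ring
      _ ≤ (1 + 1 / (Var[X 0; P] + τ)) * (Var[V X Z τ u; P] + t) := by gcongr
  rw [hZ.excessFisherInfo_map_V hX τ u (NNReal.coe_pos.1 ht).ne', ← NNReal.coe_add,
    Real.toNNReal_coe, add_comm t, ENNReal.div_eq_inv_mul, ENNReal.div_eq_inv_mul, ← mul_assoc]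
  refine mul_le_mul' ?_ hkappa
  rw [← ENNReal.ofReal_inv_of_pos (by linarith), ← ENNReal.ofReal_inv_of_pos (by positivity),
    ← ENNReal.ofReal_mul (by positivity)]
  exact ENNReal.ofReal_le_ofReal (by rwa [NNReal.coe_add, add_comm (τ : ℝ)])

variable [Nonempty (Fin d)]

lemma tendsto_excessFisherInfo_map_V (hZ : IsGaussianPerturbation X Z P) (hX : IsFKGField X P)
    {τ : ℝ≥0} (hUI : UniformIntegrability X Z P τ) {t : ℝ} (ht : 0 < t) :
    Tendsto (fun u : Fin d → ℕ+ => excessFisherInfo (P.map (V X Z τ u)) t)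
      (comap boxVol atTop) (𝓝 0) := by
  refine tendsto_of_subseq_tendsto fun us hus => ?_
  have hmem (k : ℕ) : Var[V X Z τ (us k); P] ∈ Set.Icc 0 (susceptibility X P + τ) :=
    ⟨variance_nonneg _ _, hZ.variance_V_le hX τ _⟩
  obtain ⟨v, hv, φ, hφ, hlim⟩ := isCompact_Icc.tendsto_subseq hmem
  lift v to ℝ≥0 using hv.1
  refine ⟨φ, tendsto_excessFisherInfo (v := v) (ν := fun k => ⟨P.map (V X Z τ (us (φ k))),
    hZ.isProbabilityMeasure_map_V hX.meas τ _⟩) ?_ ?_ ht⟩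
  · refine ProbabilityMeasure.tendsto_iff_tendsto_charFun.2 fun s => ?_
    simp only [convGaussian, ProbabilityMeasure.coe_mk, Measure.dirac_zero_conv,
      charFun_gaussianReal_zero]
    have hexp : Continuous fun w : ℝ => ((Real.exp (-(w * s ^ 2 / 2)) : ℝ) : ℂ) := by fun_prop
    have hsum := ((hZ.tendsto_charFun_V_sub_exp hX τ hUI s).comp (hus.comp hφ.tendsto_atTop)).add
      ((hexp.tendsto v).comp hlim)
    simpa using hsum
  · simpa only [ProbabilityMeasure.coe_mk, hZ.integral_sq_V hX, Function.comp_def] using hlim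

theorem tendsto_relEntropy_of_uniformIntegrability (hZ : IsGaussianPerturbation X Z P)
    (hX : IsFKGField X P) {τ : ℝ≥0} (hpos : 0 < Var[X 0; P] + τ) {n : ℕ}
    (hκ : ∫⁻ t in Set.Ioi (0 : ℝ), kappa X Z P n t.toNNReal / ENNReal.ofReal (1 + t) < ∞)
    (hUI : UniformIntegrability X Z P τ) :
    Tendsto (fun u : Fin d → ℕ+ => relEntropy (V X Z τ u) P) (comap boxVol atTop) (𝓝 0) := by
  have hprob := hZ.isProbabilityMeasure_map_V hX.meas τ
  have hlim : Tendsto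
      (fun u : Fin d → ℕ+ => ∫⁻ t in Set.Ioi 0, excessFisherInfo (P.map (V X Z τ u)) t)
      (comap boxVol atTop) (𝓝 (∫⁻ _ in Set.Ioi (0 : ℝ), 0)) := by
    refine tendsto_lintegral_filter_of_dominated_convergence
      (fun t => ENNReal.ofReal (1 + 1 / (Var[X 0; P] + τ)) *
        (kappa X Z P n (t + τ).toNNReal / ENNReal.ofReal (1 + (t + τ))))
      (.of_forall fun u => measurable_excessFisherInfo _) ?_ ?_ ?_
    · filter_upwards [tendsto_comap.eventually_ge_atTop n] with u hu
      filter_upwards [ae_restrict_mem measurableSet_Ioi] with t ht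
      exact hZ.excessFisherInfo_map_V_le hX hpos hu ht
    · rw [lintegral_const_mul' _ _ ENNReal.ofReal_ne_top]
      exact ENNReal.mul_ne_top ENNReal.ofReal_ne_top
        ((lintegral_Ioi_add_le _ τ.coe_nonneg).trans_lt hκ).ne
    · filter_upwards [ae_restrict_mem measurableSet_Ioi] with t ht
      exact hZ.tendsto_excessFisherInfo_map_V hX hUI ht
  have hhalf : Tendsto
      (fun u : Fin d → ℕ+ => (∫⁻ t in Set.Ioi 0, excessFisherInfo (P.map (V X Z τ u)) t) / 2)
      (comap boxVol atTop) (𝓝 0) := by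
    simpa using ENNReal.Tendsto.div_const hlim (.inr two_ne_zero)
  refine tendsto_of_tendsto_of_tendsto_of_le_of_le tendsto_const_nhds hhalf (fun _ => zero_le)
    fun u => klDiv_gaussianReal_le _ (hZ.memLp_id_map_V hX τ u) ?_
  rw [hZ.integral_sq_V hX, Real.coe_toNNReal _ (variance_nonneg _ _)]

end IsGaussianPerturbation

/-! ### Convergence of the relative entropy implies uniform integrability -/

/-- The truncated quadratic `x² / 4 · 1(|x| ≥ R)`, a test function in the variational formula; its
exponential is integrable against the standard normal law. -/
def tailQuad (R : ℝ) : ℝ → ℝ := Set.indicator {x | R ≤ |x|} fun x => x ^ 2 / 4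

lemma tailQuad_nonneg (R x : ℝ) : 0 ≤ tailQuad R x :=
  Set.indicator_nonneg (fun _ _ => by positivity) x

lemma tailQuad_le (R x : ℝ) : tailQuad R x ≤ x ^ 2 / 4 :=
  Set.indicator_le_self' (fun _ _ => by positivity) x

lemma measurable_tailQuad (R : ℝ) : Measurable (tailQuad R) :=
  (by fun_prop : Measurable fun x : ℝ => x ^ 2 / 4).indicator
    (measurableSet_le measurable_const (by fun_prop))

lemma tendsto_tailQuad (x : ℝ) : Tendsto (fun R => tailQuad R x) atTop (𝓝 0) := by
  refine tendsto_const_nhds.congr' ?_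
  filter_upwards [eventually_gt_atTop |x|] with R hR
  exact (Set.indicator_of_notMem (by simpa using hR) _).symm

lemma tailQuad_div (R x : ℝ) {σ : ℝ} (hσ : 0 < σ) :
    tailQuad R (x / σ) = {y : ℝ | R * σ ≤ |y|}.indicator (fun y => y ^ 2) x / (4 * σ ^ 2) := by
  simp only [tailQuad, Set.indicator_apply, Set.mem_ofPred_eq, abs_div, abs_of_pos hσ,
    le_div_iff₀ hσ]
  split_ifs
  · field_simp
  · simp

lemma integrable_exp_sq_gaussianReal :
    Integrable (fun x : ℝ => Real.exp (x ^ 2 / 4)) (gaussianReal 0 1) := by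
  rw [gaussianReal_of_var_ne_zero _ one_ne_zero,
    integrable_withDensity_iff (measurable_gaussianPDF _ _)
      (ae_of_all _ fun _ => gaussianPDF_lt_top)]
  have h := (integrable_exp_neg_mul_sq (b := 1 / 4) (by norm_num)).const_mul (√(2 * Real.pi))⁻¹
  refine h.congr (ae_of_all _ fun x => ?_)
  simp only [toReal_gaussianPDF, gaussianPDFReal, NNReal.coe_one, mul_one, sub_zero]
  rw [mul_left_comm, ← Real.exp_add]
  congr 2
  ring

lemma integrable_exp_tailQuad (R : ℝ) :
    Integrable (fun x : ℝ => Real.exp (tailQuad R x)) (gaussianReal 0 1) := by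
  refine integrable_exp_sq_gaussianReal.mono' (measurable_tailQuad R).exp.aestronglyMeasurable
    (ae_of_all _ fun x => ?_)
  rw [Real.norm_of_nonneg (Real.exp_nonneg _)]
  exact Real.exp_le_exp.2 (tailQuad_le R x)

lemma tendsto_integral_exp_tailQuad :
    Tendsto (fun R => ∫ x, (Real.exp (tailQuad R x) - 1) ∂(gaussianReal 0 1)) atTop (𝓝 0) := by
  suffices h : Tendsto (fun R => ∫ x, (Real.exp (tailQuad R x) - 1) ∂(gaussianReal 0 1)) atTop
      (𝓝 (∫ _, (0 : ℝ) ∂(gaussianReal 0 1))) by simpa using h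
  refine tendsto_integral_filter_of_dominated_convergence (fun x => Real.exp (x ^ 2 / 4))
    (.of_forall fun R => ((measurable_tailQuad R).exp.sub_const 1).aestronglyMeasurable)
    (.of_forall fun R => ae_of_all _ fun x => ?_) integrable_exp_sq_gaussianReal
    (ae_of_all _ fun x => ?_)
  · have hone := Real.one_le_exp (tailQuad_nonneg R x)
    have hle := Real.exp_le_exp.2 (tailQuad_le R x)
    rw [Real.norm_of_nonneg (by linarith)]
    linarith
  · simpa using ((Real.continuous_exp.tendsto 0).comp (tendsto_tailQuad x)).sub_const 1

lemma map_const_mul_gaussianReal_zero_one {v : ℝ} (hv : 0 ≤ v) :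
    (gaussianReal 0 1).map (√v * ·) = gaussianReal 0 v.toNNReal := by
  rw [gaussianReal_map_const_mul, mul_zero]
  congr 1
  ext
  simp [Real.sq_sqrt hv, hv]

section TailRatio

variable {Ω : Type*} [MeasurableSpace Ω] {P : Measure Ω} {U : Ω → ℝ}

/-- The normalised tail second moment `E[U² 1(|U| ≥ R σ)] / σ²`, where `σ² = Var U`. -/
def tailRatio (U : Ω → ℝ) (P : Measure Ω) (R : ℝ) : ℝ :=
  (∫ ω in {ω | R * √(Var[U; P]) ≤ |U ω|}, U ω ^ 2 ∂P) / Var[U; P]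

lemma tailRatio_nonneg (R : ℝ) : 0 ≤ tailRatio U P R :=
  div_nonneg (integral_nonneg fun _ => sq_nonneg _) (variance_nonneg _ _)

lemma tailRatio_le_one (hU : MemLp U 2 P) (hmean : ∫ ω, U ω ∂P = 0) (R : ℝ) :
    tailRatio U P R ≤ 1 := by
  refine div_le_one_of_le₀ ?_ (variance_nonneg _ _)
  rw [variance_of_integral_eq_zero hU.aemeasurable hmean]
  exact setIntegral_le_integral hU.integrable_sq (ae_of_all _ fun _ => sq_nonneg _)

lemma integral_tailQuad_div_sqrt_variance (hm : Measurable U) (hv : 0 < Var[U; P]) (R : ℝ) :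
    ∫ ω, tailQuad R (U ω / √(Var[U; P])) ∂P = tailRatio U P R / 4 := by
  have hs : MeasurableSet {ω | R * √(Var[U; P]) ≤ |U ω|} :=
    measurableSet_le measurable_const (by fun_prop)
  simp_rw [tailQuad_div R _ (Real.sqrt_pos.2 hv), Real.sq_sqrt hv.le, integral_div]
  rw [tailRatio, ← integral_indicator hs, div_div, mul_comm 4]
  rfl

lemma integrable_tailQuad_div (hm : Measurable U) (hU : MemLp U 2 P) (R σ : ℝ) :
    Integrable (fun ω => tailQuad R (U ω / σ)) P := by
  refine (hU.integrable_sq.div_const (4 * σ ^ 2)).mono'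
    ((measurable_tailQuad R).comp (hm.div_const σ)).aestronglyMeasurable (ae_of_all _ fun ω => ?_)
  rw [Real.norm_of_nonneg (tailQuad_nonneg _ _)]
  exact (tailQuad_le _ _).trans_eq (by rw [div_pow, div_div, mul_comm])

lemma tendsto_tailRatio (hm : Measurable U) (hU : MemLp U 2 P) (hv : 0 < Var[U; P]) :
    Tendsto (tailRatio U P) atTop (𝓝 0) := by
  suffices h : Tendsto (fun R => ∫ ω, tailQuad R (U ω / √(Var[U; P])) ∂P) atTop
      (𝓝 (∫ _, (0 : ℝ) ∂P)) by
    simp_rw [integral_tailQuad_div_sqrt_variance hm hv] at h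
    simpa using h.mul_const 4
  have hmeas (R : ℝ) := (integrable_tailQuad_div hm hU R √(Var[U; P])).aestronglyMeasurable
  refine tendsto_integral_filter_of_dominated_convergence
    (fun ω => (U ω / √(Var[U; P])) ^ 2 / 4) (.of_forall hmeas)
    (.of_forall fun R => ae_of_all _ fun ω => ?_) ?_ (ae_of_all _ fun ω => tendsto_tailQuad _)
  · rw [Real.norm_of_nonneg (tailQuad_nonneg _ _)]
    exact tailQuad_le _ _
  · simp_rw [div_pow]
    exact (hU.integrable_sq.div_const _).div_const 4

variable [IsProbabilityMeasure P]

lemma tailRatio_le_relEntropy (hm : Measurable U) (hU : MemLp U 2 P) (hv : 0 < Var[U; P])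
    (hkl : relEntropy U P ≠ ∞) (R : ℝ) :
    tailRatio U P R ≤ 4 * ((relEntropy U P).toReal +
      ∫ x, (Real.exp (tailQuad R x) - 1) ∂(gaussianReal 0 1)) := by
  have hσ : √(Var[U; P]) ≠ 0 := (Real.sqrt_pos.2 hv).ne'
  have hgauss := map_const_mul_gaussianReal_zero_one hv.le
  set σ := √(Var[U; P])
  have hmeas : Measurable fun x => tailQuad R (x / σ) :=
    (measurable_tailQuad R).comp (measurable_id.div_const σ)
  have hint : Integrable (fun x => tailQuad R (x / σ)) (P.map U) :=
    (integrable_map_measure hmeas.aestronglyMeasurable hm.aemeasurable).2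
      (integrable_tailQuad_div hm hU R σ)
  have hexp : Integrable (fun x => Real.exp (tailQuad R (x / σ)))
      (gaussianReal 0 Var[U; P].toNNReal) := by
    rw [← hgauss, integrable_map_measure hmeas.exp.aestronglyMeasurable (by fun_prop)]
    simpa only [Function.comp_def, mul_div_cancel_left₀ _ hσ] using integrable_exp_tailQuad R
  have hright : ∫ x, (Real.exp (tailQuad R (x / σ)) - 1) ∂(gaussianReal 0 Var[U; P].toNNReal) =
      ∫ x, (Real.exp (tailQuad R x) - 1) ∂(gaussianReal 0 1) := by
    rw [← hgauss, integral_map (by fun_prop) (hmeas.exp.sub_const 1).aestronglyMeasurable]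
    simp_rw [mul_div_cancel_left₀ _ hσ]
  have := Measure.isProbabilityMeasure_map (μ := P) hm.aemeasurable
  have hvar : ∫ x, tailQuad R (x / σ) ∂(P.map U) ≤ (relEntropy U P).toReal + _ :=
    integral_le_klDiv_add hkl hint hexp
  rw [integral_map hm.aemeasurable hmeas.aestronglyMeasurable,
    integral_tailQuad_div_sqrt_variance hm hv, hright] at hvar
  linarith

end TailRatio

lemma finite_setOf_boxVol_lt {d : ℕ} (N : ℕ) : {u : Fin d → ℕ+ | boxVol u < N}.Finite := by
  rcases Nat.eq_zero_or_pos N with rfl | hN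
  · simp
  refine (Set.finite_Iic (fun _ : Fin d => N.toPNat hN)).subset fun u hu k => ?_
  have hdvd : (u k : ℕ) ∣ boxVol u :=
    Finset.dvd_prod_of_mem (fun i => (u i : ℕ)) (Finset.mem_univ k)
  exact PNat.coe_le_coe _ _ |>.1 ((Nat.le_of_dvd (boxVol_pos u) hdvd).trans (le_of_lt hu))

namespace IsGaussianPerturbation

variable {Ω : Type*} [MeasurableSpace Ω] {P : Measure Ω} [IsProbabilityMeasure P] {d : ℕ}
  {X : (Fin d → ℤ) → Ω → ℝ} {Z : ℝ≥0 → (Fin d → ℤ) → Ω → ℝ} {τ : ℝ≥0}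

lemma eventually_forall_tailRatio_V_lt (hZ : IsGaussianPerturbation X Z P) (hX : IsFKGField X P)
    (hpos : 0 < Var[X 0; P] + τ)
    (h : Tendsto (fun u : Fin d → ℕ+ => relEntropy (V X Z τ u) P) (comap boxVol atTop) (𝓝 0))
    {ε : ℝ} (hε : 0 < ε) : ∀ᶠ R in atTop, ∀ u, tailRatio (V X Z τ u) P R < ε := by
  have hvar (u) : 0 < Var[V X Z τ u; P] := hpos.trans_le (hZ.le_variance_V hX τ u)
  have hm := hZ.measurable_V hX.meas τ
  have hL2 := hZ.memLp_V hX τ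
  -- Entropy controls the large boxes; only finitely many small ones remain.
  obtain ⟨N, hN⟩ : ∃ N, ∀ u : Fin d → ℕ+, N ≤ boxVol u →
      relEntropy (V X Z τ u) P < ENNReal.ofReal (ε / 8) := by
    have hev := h.eventually (gt_mem_nhds (ENNReal.ofReal_pos.2 (by positivity : 0 < ε / 8)))
    obtain ⟨N, hN⟩ := eventually_atTop.1 (eventually_comap.1 hev)
    exact ⟨N, fun u hu => hN _ hu u rfl⟩
  have hsmall : ∀ᶠ R in atTop, ∀ u ∈ {u : Fin d → ℕ+ | boxVol u < N},
      tailRatio (V X Z τ u) P R < ε :=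
    (eventually_all_finite (finite_setOf_boxVol_lt N)).2 fun u _ =>
      (tendsto_tailRatio (hm u) (hL2 u) (hvar u)).eventually (gt_mem_nhds hε)
  filter_upwards [hsmall, tendsto_integral_exp_tailQuad.eventually
    (gt_mem_nhds (by positivity : 0 < ε / 8))] with R hR hexp u
  rcases lt_or_ge (boxVol u) N with hu | hu
  · exact hR u hu
  have hent := hN u hu
  have hreal : (relEntropy (V X Z τ u) P).toReal < ε / 8 :=
    (ENNReal.lt_ofReal_iff_toReal_lt hent.ne_top).1 hent
  linarith [tailRatio_le_relEntropy (hm u) (hL2 u) (hvar u) hent.ne_top R]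

theorem uniformIntegrability_of_tendsto_relEntropy (hZ : IsGaussianPerturbation X Z P)
    (hX : IsFKGField X P) (hpos : 0 < Var[X 0; P] + τ)
    (h : Tendsto (fun u : Fin d → ℕ+ => relEntropy (V X Z τ u) P) (comap boxVol atTop) (𝓝 0)) :
    UniformIntegrability X Z P τ := by
  have hbdd (R : ℝ) : BddAbove (Set.range fun u => tailRatio (V X Z τ u) P R) :=
    ⟨1, Set.forall_mem_range.2 fun u =>
      tailRatio_le_one (hZ.memLp_V hX τ u) (hZ.integral_V hX τ u) R⟩
  refine ⟨fun R => ⨆ u, tailRatio (V X Z τ u) P R, Metric.tendsto_nhds.2 fun ε hε => ?_,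
    fun u => ⟨hZ.memLp_V hX τ u, fun R => ?_⟩⟩
  · filter_upwards [hZ.eventually_forall_tailRatio_V_lt hX hpos h (half_pos hε)] with R hR
    rw [dist_zero_right, Real.norm_of_nonneg (Real.iSup_nonneg fun u => tailRatio_nonneg R)]
    exact (ciSup_le fun u => (hR u).le).trans_lt (half_lt_self hε)
  · exact (div_le_iff₀' (hpos.trans_le (hZ.le_variance_V hX τ u))).1 (le_ciSup (hbdd R) u)

end IsGaussianPerturbation

/-! ### The degenerate case -/

section Degenerate

variable {Ω : Type*} [MeasurableSpace Ω] {P : Measure Ω} [IsProbabilityMeasure P]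

lemma ae_eq_zero_of_variance_eq_zero {U : Ω → ℝ} (hU : MemLp U 2 P) (hmean : ∫ ω, U ω ∂P = 0)
    (hvar : Var[U; P] = 0) : U =ᵐ[P] 0 := by
  have h := ae_eq_integral_of_variance_eq_zero hU hvar
  rwa [hmean] at h

lemma relEntropy_eq_zero_of_variance_eq_zero {U : Ω → ℝ} (hU : MemLp U 2 P)
    (hmean : ∫ ω, U ω ∂P = 0) (hvar : Var[U; P] = 0) : relEntropy U P = 0 := by
  have hmap : P.map U = Measure.dirac 0 := by
    rw [Measure.map_congr (ae_eq_zero_of_variance_eq_zero hU hmean hvar)]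
    simp [Pi.zero_def, Measure.map_const]
  simp [relEntropy, hmap, hvar, InformationTheory.klDiv_self]

lemma inClass_zero_of_variance_eq_zero {U : Ω → ℝ} (hU : MemLp U 2 P) (hmean : ∫ ω, U ω ∂P = 0)
    (hvar : Var[U; P] = 0) : InClass 0 U P := by
  refine ⟨hU, fun R => (setIntegral_eq_zero_of_ae_eq_zero ?_).le.trans_eq (by simp)⟩
  filter_upwards [ae_eq_zero_of_variance_eq_zero hU hmean hvar] with ω hω _
  simp [hω]

namespace IsGaussianPerturbation

variable {d : ℕ} {X : (Fin d → ℤ) → Ω → ℝ} {Z : ℝ≥0 → (Fin d → ℤ) → Ω → ℝ} {τ : ℝ≥0}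

lemma variance_V_eq_zero (hZ : IsGaussianPerturbation X Z P) (hX : IsFKGField X P)
    (h : Var[X 0; P] + τ = 0) (u : Fin d → ℕ+) : Var[V X Z τ u; P] = 0 := by
  obtain ⟨hvar, hτ⟩ := (add_eq_zero_iff_of_nonneg (variance_nonneg _ _) τ.coe_nonneg).1 h
  have hX0 := ae_eq_zero_of_variance_eq_zero (hX.memLp 0) (hX.mean 0) hvar
  have hcov (y) : cov[X 0, X y; P] = 0 := by
    refine (integral_congr_ae ?_).trans (integral_zero Ω ℝ)
    filter_upwards [hX0] with ω hω
    simp [hω, hX.mean 0]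
  have hle := hZ.variance_V_le hX τ u
  simp only [susceptibility, hcov, tsum_zero, hτ, add_zero] at hle
  exact hle.antisymm (variance_nonneg _ _)

end IsGaussianPerturbation

end Degenerate

end FKGEntropy

end

open FKGEntropy in
theorem theorem1p9_general {Ω : Type*} [MeasurableSpace Ω] (P : Measure Ω) [IsProbabilityMeasure P]
    (d : ℕ) (hd : 1 ≤ d)
    (X : (Fin d → ℤ) → Ω → ℝ)
    (hX_meas : ∀ y, Measurable (X y))
    (hX_L2 : ∀ y, MemLp (X y) 2 P)
    (hX_mean : ∀ y, ∫ ω, X y ω ∂P = 0)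
    (hX_stat : IsStationary X P)
    (hX_fkg : IsFKG X P)
    (hX_susc : Summable (fun y : Fin d → ℤ => cov[X 0, X y; P]))
    (Z : ℝ≥0 → (Fin d → ℤ) → Ω → ℝ)
    (hZ : IsGaussianPerturbation X Z P)
    (hκ : ∃ n : ℕ, ∫⁻ t in Set.Ioi (0 : ℝ),
      kappa X Z P n t.toNNReal / ENNReal.ofReal (1 + t) < ∞)
    (τ : ℝ≥0) :
    Tendsto (fun u : Fin d → ℕ+ => relEntropy (V X Z τ u) P) (comap boxVol atTop) (𝓝 0) ↔
      UniformIntegrability X Z P τ := by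
  have : Nonempty (Fin d) := ⟨⟨0, hd⟩⟩
  have hX : IsFKGField X P := ⟨hX_meas, hX_L2, hX_mean, hX_stat, hX_fkg, hX_susc⟩
  rcases (add_nonneg (variance_nonneg (X 0) P) τ.coe_nonneg).eq_or_lt with hzero | hpos
  · have hvar := hZ.variance_V_eq_zero hX hzero.symm
    have hL2 := hZ.memLp_V hX τ
    have hmean := hZ.integral_V hX τ
    refine iff_of_true ?_ ⟨0, tendsto_const_nhds, fun u =>
      inClass_zero_of_variance_eq_zero (hL2 u) (hmean u) (hvar u)⟩
    simp_rw [fun u => relEntropy_eq_zero_of_variance_eq_zero (hL2 u) (hmean u) (hvar u)]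
    exact tendsto_const_nhds
  · obtain ⟨n, hn⟩ := hκ
    exact ⟨hZ.uniformIntegrability_of_tendsto_relEntropy hX hpos,
      hZ.tendsto_relEntropy_of_uniformIntegrability hX hpos hn⟩

open FKGEntropy in
theorem theorem1p9 {Ω : Type*} [MeasurableSpace Ω] (P : Measure Ω) [IsProbabilityMeasure P]
    (d : ℕ) (hd : 1 ≤ d)
    (X : (Fin d → ℤ) → Ω → ℝ)
    (hX_meas : ∀ y, Measurable (X y))
    (hX_L2 : ∀ y, MemLp (X y) 2 P)
    (hX_mean : ∀ y, ∫ ω, X y ω ∂P = 0)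
    (hX_stat : IsStationary X P)
    (hX_dens : ∀ y, HasPDF (X y) P volume)
    (hX_fkg : IsFKG X P)
    (hX_susc : Summable (fun y : Fin d → ℤ => cov[X 0, X y; P]))
    (Z : ℝ≥0 → (Fin d → ℤ) → Ω → ℝ)
    (hZ : IsGaussianPerturbation X Z P)
    (hκ : ∃ n : ℕ, ∫⁻ t in Set.Ioi (0 : ℝ),
      kappa X Z P n t.toNNReal / ENNReal.ofReal (1 + t) < ∞)
    (τ : ℝ≥0) :
    Tendsto (fun u : Fin d → ℕ+ => relEntropy (V X Z τ u) P) (comap boxVol atTop) (𝓝 0) ↔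
      UniformIntegrability X Z P τ :=
  theorem1p9_general P d hd X hX_meas hX_L2 hX_mean hX_stat hX_fkg hX_susc Z hZ hκ τ
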